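/- A \emph{map} is a connected graph (loops and multiple edges allowed) properly embedded in a compact oriented surface without boundary so that every face is a disc, up to orientation-preserving homeomorphism; it is \emph{planar} if the surface is the sphere. A map is \emph{rooted} if one of its arcs (oriented edges) is distinguished, \emph{pointed} if one of its vertices is distinguished; isomorphisms carry these distinguished elements along. The map with one vertex and no edge counts as rooted in exactly one way. A \emph{planar quadrangulation} is a planar map all of whose faces have degree $4$; by convention there is also one degenerate planar quadrangulation ``with $0$ faces'', namely the single edge with its two endpoints. An \emph{embedded plane tree} is a planar map with one face whose vertices carry integer labels that differ by at most $1$ along every edge; a \emph{rooted embedded plane tree} is rooted as a map and its root vertex (the origin of the root arc, or the unique vertex if there is no edge) has label $1$. For $n\ge 0$ let $\vec q_{0,n}$ be the number of rooted planar quadrangulations with $n$ faces, $\vec q^{\,\bullet}_{0,n}$ the number of rooted pointed planar quadrangulations with $n$ faces, $a_n$ the number of rooted embedded plane trees with $n$ edges, and put \[ \overrightarrow{Q_0}^\bullet(z)=\sum_{n\ge0}\vec q^{\,\bullet}_{0,n}z^n,\qquad T(z)=\sum_{n\ge 0}a_nz^n . \] Then \[ \overrightarrow{Q_0}^\bullet(z)=2T(z),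 \] and $T$ is the unique formal power series (with rational coefficients) satisfying $T=1+3zT^2$. Moreover, for every $n\ge 0$, \[ \vec q_{0,n}=\frac{\vec q^{\,\bullet}_{0,n}}{n+2}=\frac{2}{n+2}\cdot\frac{3^n}{n+1}\binom{2n}{n}, \] and the number of rooted planar maps with $n$ edges is given by the same formula. -/

import Mathlib

/-- A map on a closed connected oriented surface, taken up to orientation preserving homeomorphism,
in its combinatorial form: an arc is an edge with an orientation, `rev` reverses arcs, and `next a`
is the arc that follows `a` counterclockwise around the origin of `a`. Loops and multiple edges are
allowed. The map with one vertex and no edge is included. -/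
structure SurfaceMap where
  Vertex : Type
  Arc : Type
  finite_vertex : Finite Vertex
  finite_arc : Finite Arc
  origin : Arc → Vertex
  rev : Arc → Arc
  rev_rev : ∀ a, rev (rev a) = a
  rev_ne : ∀ a, rev a ≠ a
  next : Equiv.Perm Arc
  /-- The arcs that leave a given vertex form exactly one cycle of `next`. -/
  origin_eq_iff : ∀ a b, origin a = origin b ↔ next.SameCycle a b
  nonempty_vertex : Nonempty Vertex
  /-- The underlying graph is connected. -/
  connected : ∀ u v : Vertex,
    Relation.ReflTransGen (fun x y => ∃ a, origin a = x ∧ origin (rev a) = y) u v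

namespace SurfaceMap

/-- The reversal of arcs as a permutation. -/
def revPerm (m : SurfaceMap) : Equiv.Perm m.Arc :=
  Function.Involutive.toPerm m.rev m.rev_rev

/-- The permutation `a ↦ next (rev a)`. Its cycles run along the boundaries of the faces, each arc
having the face on its right. -/
def facePerm (m : SurfaceMap) : Equiv.Perm m.Arc :=
  m.next * m.revPerm

/-- The faces: the cycles of `facePerm`. In the map without edges there is in addition a single face,
the complement of the vertex, which has no arc on its boundary. -/
def Face (m : SurfaceMap) : Type :=
  Quotient (Equiv.Perm.SameCycle.setoid m.facePerm) ⊕ PLift (IsEmpty m.Arc)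

/-- The degree of a face: the number of arcs that have the face on their right, so that an edge
with the same face on both sides counts twice. -/
noncomputable def faceDegree (m : SurfaceMap) : m.Face → ℕ :=
  Sum.elim
    (fun f => Nat.card {a : m.Arc // Quotient.mk (Equiv.Perm.SameCycle.setoid m.facePerm) a = f})
    (fun _ => 0)

/-- The number of vertices. -/
noncomputable def numVertices (m : SurfaceMap) : ℕ := Nat.card m.Vertex

/-- The number of edges; every edge carries exactly two arcs. -/
noncomputable def numEdges (m : SurfaceMap) : ℕ := Nat.card m.Arc / 2

/-- The number of faces. -/
noncomputable def numFaces (m : SurfaceMap) : ℕ := Nat.card m.Face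

/-- The genus of the surface, given by Euler's characteristic. -/
def HasGenus (m : SurfaceMap) (g : ℕ) : Prop :=
  (m.numVertices : ℤ) - m.numEdges + m.numFaces = 2 - 2 * g

/-- Planar maps: the maps of genus `0`. -/
def IsPlanar (m : SurfaceMap) : Prop := m.HasGenus 0

/-- Planar quadrangulations: planar maps all of whose faces have degree `4`. -/
def IsPlanarQuadrangulation (m : SurfaceMap) : Prop :=
  m.IsPlanar ∧ ∀ f : m.Face, m.faceDegree f = 4

/-- The map on the sphere that consists of two vertices joined by one edge. -/
def IsSingleEdge (m : SurfaceMap) : Prop :=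
  m.numVertices = 2 ∧ m.numEdges = 1

/-- Planar quadrangulations with `n` faces. By the usual convention the degenerate quadrangulation,
the only one with `n = 0`, is the single edge with its two endpoints (a map on the sphere has at
least one face, so no map is literally a quadrangulation with `0` faces). -/
def IsPlanarQuadrangulationOfSize (m : SurfaceMap) (n : ℕ) : Prop :=
  (m.IsPlanarQuadrangulation ∧ m.numFaces = n) ∨ (n = 0 ∧ m.IsSingleEdge)

/-- Plane trees with `n` edges: planar maps with only one face. -/
def IsPlaneTreeOfSize (m : SurfaceMap) (n : ℕ) : Prop :=
  m.IsPlanar ∧ m.numFaces = 1 ∧ m.numEdges = n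

end SurfaceMap

/-- A rooted map: a map with a distinguished arc. The map without edges counts as rooted, in one
way (`root = none`). -/
structure RootedMap extends SurfaceMap where
  root : Option Arc
  root_isSome : Nonempty Arc → root.isSome

/-- An isomorphism of rooted maps: the combinatorial form of an orientation preserving homeomorphism
of the surfaces that carries one map onto the other, and root to root. -/
structure RootedMap.Iso (m m' : RootedMap) where
  onVertex : m.Vertex ≃ m'.Vertex
  onArc : m.Arc ≃ m'.Arc
  map_origin : ∀ a, m'.origin (onArc a) = onVertex (m.origin a)
  map_rev : ∀ a, m'.rev (onArc a) = onArc (m.rev a)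
  map_next : ∀ a, m'.next (onArc a) = onArc (m.next a)
  map_root : m.root.map onArc = m'.root

namespace RootedMap

/-- The identity isomorphism. -/
def Iso.refl (m : RootedMap) : Iso m m where
  onVertex := Equiv.refl _
  onArc := Equiv.refl _
  map_origin _ := rfl
  map_rev _ := rfl
  map_next _ := rfl
  map_root := by simp

/-- The inverse isomorphism. -/
def Iso.symm {m m' : RootedMap} (e : Iso m m') : Iso m' m where
  onVertex := e.onVertex.symm
  onArc := e.onArc.symm
  map_origin a := by
    rw [Equiv.eq_symm_apply, ← e.map_origin, Equiv.apply_symm_apply]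
  map_rev a := by
    rw [Equiv.eq_symm_apply, ← e.map_rev, Equiv.apply_symm_apply]
  map_next a := by
    rw [Equiv.eq_symm_apply, ← e.map_next, Equiv.apply_symm_apply]
  map_root := by
    rw [← e.map_root, Option.map_map]
    simp

/-- The composite isomorphism. -/
def Iso.trans {m m' m'' : RootedMap} (e : Iso m m') (e' : Iso m' m'') : Iso m m'' where
  onVertex := e.onVertex.trans e'.onVertex
  onArc := e.onArc.trans e'.onArc
  map_origin a := by
    simp [e'.map_origin, e.map_origin]
  map_rev a := by
    simp [e'.map_rev, e.map_rev]
  map_next a := by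
    simp [e'.map_next, e.map_next]
  map_root := by
    rw [← e'.map_root, ← e.map_root, Option.map_map]
    rfl

/-- Rooted maps are considered the same if they are isomorphic. -/
def isoSetoid : Setoid RootedMap where
  r m m' := Nonempty (Iso m m')
  iseqv :=
    { refl := fun m => ⟨Iso.refl m⟩
      symm := fun ⟨e⟩ => ⟨e.symm⟩
      trans := fun ⟨e⟩ ⟨e'⟩ => ⟨e.trans e'⟩ }

/-- The root vertex: the origin of the root, or the only vertex of the map without edges. -/
def IsRootVertex (m : RootedMap) (v : m.Vertex) : Prop :=
  ∀ a ∈ m.root, m.origin a = v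

end RootedMap

/-- A rooted pointed map: a rooted map with a distinguished vertex, the basepoint. -/
structure RootedPointedMap extends RootedMap where
  basepoint : Vertex

/-- Rooted pointed maps are considered the same if they are isomorphic by an isomorphism that
carries root to root and basepoint to basepoint. -/
def RootedPointedMap.isoSetoid : Setoid RootedPointedMap where
  r m m' := ∃ e : RootedMap.Iso m.toRootedMap m'.toRootedMap, e.onVertex m.basepoint = m'.basepoint
  iseqv :=
    { refl := fun _ => ⟨RootedMap.Iso.refl _, rfl⟩
      symm := fun ⟨e, h⟩ => ⟨e.symm, (Equiv.symm_apply_eq _).2 h.symm⟩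
      trans := fun ⟨e, h⟩ ⟨e', h'⟩ => ⟨e.trans e', (congrArg e'.onVertex h).trans h'⟩ }

/-- A rooted map with integer labels on its vertices. -/
structure RootedLabeledMap extends RootedMap where
  label : Vertex → ℤ

namespace RootedLabeledMap

/-- Rooted labeled maps are considered the same if they are isomorphic by an isomorphism that
carries root to root and preserves the labels. -/
def isoSetoid : Setoid RootedLabeledMap where
  r m m' := ∃ e : RootedMap.Iso m.toRootedMap m'.toRootedMap,
    ∀ v, m'.label (e.onVertex v) = m.label v
  iseqv :=
    { refl := fun _ => ⟨RootedMap.Iso.refl _, fun _ => rfl⟩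
      symm := fun ⟨e, h⟩ => ⟨e.symm, fun v => by
        rw [← h]
        exact congrArg _ (e.onVertex.apply_symm_apply v)⟩
      trans := fun ⟨e, h⟩ ⟨e', h'⟩ => ⟨e.trans e', fun v => (h' _).trans (h v)⟩ }

/-- Embedded maps: the labels differ at most by one along every edge, and the root vertex has
label `1`. -/
def IsEmbedded (m : RootedLabeledMap) : Prop :=
  (∀ a, |m.label (m.origin a) - m.label (m.origin (m.rev a))| ≤ 1) ∧
    ∀ v, m.IsRootVertex v → m.label v = 1

end RootedLabeledMap

/-- The number of rooted planar maps with `n` edges. -/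
noncomputable def numRootedPlanarMaps (n : ℕ) : ℕ :=
  Nat.card (Quotient (RootedMap.isoSetoid.comap
    (Subtype.val : {m : RootedMap // m.IsPlanar ∧ m.numEdges = n} → RootedMap)))

/-- The number of rooted planar quadrangulations with `n` faces. -/
noncomputable def numRootedPlanarQuadrangulations (n : ℕ) : ℕ :=
  Nat.card (Quotient (RootedMap.isoSetoid.comap
    (Subtype.val : {m : RootedMap // m.IsPlanarQuadrangulationOfSize n} → RootedMap)))

/-- The number of rooted pointed planar quadrangulations with `n` faces. -/
noncomputable def numRootedPointedPlanarQuadrangulations (n : ℕ) : ℕ :=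
  Nat.card (Quotient (RootedPointedMap.isoSetoid.comap
    (Subtype.val : {m : RootedPointedMap // m.IsPlanarQuadrangulationOfSize n} →
      RootedPointedMap)))

/-- The number of rooted embedded plane trees with `n` edges. -/
noncomputable def numRootedEmbeddedTrees (n : ℕ) : ℕ :=
  Nat.card (Quotient (RootedLabeledMap.isoSetoid.comap
    (Subtype.val : {m : RootedLabeledMap // m.IsPlaneTreeOfSize n ∧ m.IsEmbedded} →
      RootedLabeledMap)))

/-- The generating series of rooted pointed planar quadrangulations by the number of faces. -/
noncomputable def rootedPointedQuadrangulationSeries : PowerSeries ℚ :=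
  PowerSeries.mk fun n => (numRootedPointedPlanarQuadrangulations n : ℚ)

/-- The generating series of rooted embedded plane trees by the number of edges. -/
noncomputable def rootedEmbeddedTreeSeries : PowerSeries ℚ :=
  PowerSeries.mk fun n => (numRootedEmbeddedTrees n : ℚ)

/-! The identity between quadrangulations and trees is not proved by a bijection: both sides are
computed. A map is encoded by permutations of its arcs, `φ` for the faces and `α` for the edges; `φ
* α` then gives the vertices.

The counting follows Tutte's removal of the root edge. To keep the set of arcs fixed, it treats
whole families of planar maps in which every component carries one half-edge, a fixed point of `α`
(`IsMarkedMap`). Removing the edge with arcs `r`, `s` that follows the half-edge `m` turns `r` and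
`s` into half-edges and leaves `m` as a component of its own. If both sides of the edge lie on the
root face of degree `l`, the component falls apart into two, with root degrees `a + b = l - 2`;
otherwise the root face swallows a quadrilateral and gets degree `l + 2`. So the labelled families
are counted by products of any series with `G 0 = 1` and `G l = X ^ 2 * (∑ G a * G b + G (l + 2))`
(`numMarkedMaps_eq`). Each coefficient in this system depends only on lower ones, so a solution may
simply be exhibited: `rootFaceSeries`, made of Catalan numbers and of the series `T = 1 + 3 z T ^
2`, and verified by Catalan convolutions (`boundarySeries_succ`). Rooted maps have no automorphisms,
so division by the number of labellings gives the number of rooted maps (`card_isBoundaryMap`).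

Planarity enters through linear algebra. Differences along edges of vertex functions and of face
functions are orthogonal; comparing dimensions gives Euler's inequality, and in the planar case
every cochain orthogonal to the face functions comes from a vertex function (`exists_edgeDiff_eq`).
This shows that removal of an edge inside a face disconnects, that any increments along the edges of
a plane tree integrate to labels (whence the factor `3 ^ n`), and, over `ZMod 2`, that planar
quadrangulations are bipartite.

Root degree `2 * n` with no other face gives plane trees, root degree `4` gives quadrangulations.
These have `n + 2` vertices, and pointing a rigid object multiplies the count by that number. Maps
with `n` edges correspond to quadrangulations with `n` faces by Tutte's bijection: the edges of the
quadrangulation are the corners of the map. -/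

/-! ### Cycles of a permutation and their behaviour under transpositions. -/

namespace Equiv.Perm

/-- The set of elements of the cycle of `f` through `x`. -/
def cyc {A : Type*} (f : Perm A) (x : A) : Set A := {y | f.SameCycle x y}

/-- The number of cycles of a permutation, where fixed points count as cycles. -/
noncomputable def numCycles {A : Type*} (f : Perm A) : ℕ :=
  Nat.card (Quotient (SameCycle.setoid f))

section Basic

variable {A : Type*} {f g : Perm A} {x y a b : A}

theorem apply_inv_apply (f : Perm A) (x : A) : f (f⁻¹ x) = x := f.apply_symm_apply x

theorem inv_apply_apply (f : Perm A) (x : A) : f⁻¹ (f x) = x := f.symm_apply_apply x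

theorem mem_cyc : y ∈ f.cyc x ↔ f.SameCycle x y := Iff.rfl

theorem self_mem_cyc (f : Perm A) (x : A) : x ∈ f.cyc x := SameCycle.refl f x

theorem SameCycle.cyc_eq (h : f.SameCycle x y) : f.cyc x = f.cyc y :=
  Set.ext fun _ => ⟨fun hz => h.symm.trans hz, fun hz => h.trans hz⟩

theorem apply_mem_cyc (h : a ∈ f.cyc x) : f a ∈ f.cyc x := SameCycle.apply_right h

theorem cyc_of_apply_eq (h : f x = x) : f.cyc x = {x} :=
  Set.ext fun y => ⟨fun hy => (SameCycle.eq_of_left hy h).symm, fun hy => by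
    rw [Set.mem_singleton_iff.1 hy]; exact self_mem_cyc f x⟩

theorem SameCycle.mem_of_forall [Finite A] {B : Set A} (h : f.SameCycle x y)
    (hB : ∀ z ∈ B, f z ∈ B) (hx : x ∈ B) : y ∈ B := by
  obtain ⟨n, rfl⟩ := h.exists_nat_pow_eq
  clear h
  induction n with
  | zero => exact hx
  | succ k ih => rw [pow_succ', mul_apply]; exact hB _ ih

theorem cyc_subset_of_forall [Finite A] {B : Set A} (hB : ∀ z ∈ B, f z ∈ B) (hx : x ∈ B) :
    f.cyc x ⊆ B := fun _ h => SameCycle.mem_of_forall h hB hx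

/-- Two permutations that agree on a cycle of the second have this cycle in common. -/
theorem cyc_congr [Finite A] (h : ∀ z ∈ g.cyc a, f z = g z) : f.cyc a = g.cyc a := by
  have key : ∀ n : ℕ, (f ^ n) a = (g ^ n) a := by
    intro n
    induction n with
    | zero => rfl
    | succ k ih =>
      rw [pow_succ', mul_apply, ih, pow_succ', mul_apply]
      exact h _ ⟨k, by simp⟩
  ext b
  constructor
  · intro hb
    obtain ⟨n, rfl⟩ := SameCycle.exists_nat_pow_eq hb
    rw [key]
    exact ⟨n, by simp⟩
  · intro hb
    obtain ⟨n, rfl⟩ := SameCycle.exists_nat_pow_eq hb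
    rw [← key]
    exact ⟨n, by simp⟩

theorem apply_mem_of_forall_mem [Finite A] {B : Set A} (hB : ∀ z ∈ B, f z ∈ B) (h : f x ∈ B) :
    x ∈ B :=
  SameCycle.mem_of_forall (SameCycle.symm (SameCycle.apply_right (SameCycle.refl f x))) hB h

theorem ncard_cyc_pos [Finite A] (f : Perm A) (x : A) : 0 < (f.cyc x).ncard :=
  (Set.ncard_pos (Set.toFinite _)).2 ⟨x, self_mem_cyc f x⟩

theorem disjoint_cyc (h : ¬ g.SameCycle x y) : _root_.Disjoint (g.cyc x) (g.cyc y) :=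
  Set.disjoint_left.2 fun _ h1 h2 => h (SameCycle.trans h1 (SameCycle.symm h2))

theorem sameCycle_inv_inv : g.SameCycle (g⁻¹ x) (g⁻¹ y) ↔ g.SameCycle x y := by
  conv_rhs => rw [← apply_inv_apply g x, ← apply_inv_apply g y, sameCycle_apply_left,
    sameCycle_apply_right]

theorem cyc_inv_apply (g : Perm A) (x : A) : g.cyc (g⁻¹ x) = g.cyc x :=
  SameCycle.cyc_eq (by
    have : g.SameCycle (g⁻¹ x) (g (g⁻¹ x)) := SameCycle.apply_right (SameCycle.refl _ _)
    rwa [apply_inv_apply] at this)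

end Basic

section Swap

variable {A : Type*} [Finite A] [DecidableEq A] {f g : Perm A} {x y a b : A}

theorem cyc_mul_swap_of_not_mem (hx : ¬ g.SameCycle x a) (hy : ¬ g.SameCycle y a) :
    (g * swap x y).cyc a = g.cyc a := by
  refine cyc_congr fun z hz => ?_
  rw [mul_apply, swap_apply_of_ne_of_ne]
  · rintro rfl; exact hx (SameCycle.symm hz)
  · rintro rfl; exact hy (SameCycle.symm hz)

/-- The product sends `x` to `g y` and then follows the cycle of `g` through `y`, which avoids `x`,
until it comes back to `y`. -/
theorem sameCycle_mul_swap (h : ¬ g.SameCycle x y) : (g * swap x y).SameCycle x y := by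
  by_contra hn
  have key : ∀ n : ℕ, (g * swap x y).SameCycle x ((g ^ (n + 1)) y) := by
    intro n
    induction n with
    | zero =>
      have : (g * swap x y) x = g y := by simp
      rw [zero_add, pow_one, ← this]
      exact SameCycle.apply_right (SameCycle.refl _ _)
    | succ k ih =>
      have h1 : (g ^ (k + 1)) y ≠ x := fun he => h (SameCycle.symm
        ⟨((k + 1 : ℕ) : ℤ), by rw [zpow_natCast]; exact he⟩)
      have h2 : (g ^ (k + 1)) y ≠ y := fun he => hn (by rw [he] at ih; exact ih)
      have : (g * swap x y) ((g ^ (k + 1)) y) = (g ^ (k + 2)) y := by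
        rw [mul_apply, swap_apply_of_ne_of_ne h1 h2, pow_succ' g (k + 1), mul_apply]
      rw [← this]
      exact SameCycle.apply_right ih
  obtain ⟨i, hi, -, he⟩ := SameCycle.exists_pow_eq'' (SameCycle.refl g y)
  have := key (i - 1)
  rw [Nat.sub_add_cancel hi, he] at this
  exact hn this

/-- With `j` the first positive exponent such that `(f ^ j) x = y`, the points `(f ^ i) x`, `0 < i ≤
j`, are stable under the product: it closes this arc up at `y`. They do not contain `x`. -/
theorem not_sameCycle_mul_swap (h : f.SameCycle x y) (hxy : x ≠ y) :
    ¬ (f * swap x y).SameCycle x y := by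
  classical
  have hex : ∃ i : ℕ, 0 < i ∧ (f ^ i) x = y := by
    obtain ⟨i, hi, -, he⟩ := h.exists_pow_eq''
    exact ⟨i, hi, he⟩
  obtain ⟨hj, he⟩ := Nat.find_spec hex
  have hmin : ∀ i, 0 < i → i < Nat.find hex → (f ^ i) x ≠ y := fun i h0 hi hh =>
    Nat.find_min hex hi ⟨h0, hh⟩
  set j := Nat.find hex
  have hx : ∀ i, 0 < i → i ≤ j → (f ^ i) x ≠ x := by
    intro i h0 hi hh
    rcases hi.lt_or_eq with hlt | rfl
    · refine hmin (j - i) (by omega) (by omega) ?_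
      rw [← he]
      conv_rhs => rw [show j = (j - i) + i by omega, pow_add, mul_apply, hh]
    · exact hxy (hh.symm.trans he)
  intro hs
  have hB : ∀ z ∈ {z | ∃ i, 0 < i ∧ i ≤ j ∧ (f ^ i) x = z},
      (f * swap x y) z ∈ {z | ∃ i, 0 < i ∧ i ≤ j ∧ (f ^ i) x = z} := by
    rintro z ⟨i, h0, hi, rfl⟩
    rcases hi.lt_or_eq with hlt | rfl
    · refine ⟨i + 1, by omega, by omega, ?_⟩
      rw [mul_apply, swap_apply_of_ne_of_ne (hx i h0 hi) (hmin i h0 hlt), pow_succ', mul_apply]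
    · refine ⟨1, by omega, by omega, ?_⟩
      rw [he, mul_apply, swap_apply_right, pow_one]
  obtain ⟨i, h0, hi, hh⟩ := SameCycle.mem_of_forall hs.symm hB ⟨j, hj, le_rfl, he⟩
  exact hx i h0 hi hh

theorem cyc_mul_swap (h : ¬ g.SameCycle x y) :
    (g * swap x y).cyc x = g.cyc x ∪ g.cyc y := by
  have hxy := sameCycle_mul_swap h
  have hg : g = g * swap x y * swap x y := by simp [mul_assoc]
  ext b
  constructor
  · intro hb
    by_contra hn
    rw [Set.mem_union, not_or] at hn
    have := cyc_mul_swap_of_not_mem hn.1 hn.2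
    have hx : x ∈ (g * swap x y).cyc b := SameCycle.symm hb
    rw [this] at hx
    exact hn.1 (SameCycle.symm hx)
  · intro hb
    by_contra hn
    have hy : ¬ (g * swap x y).SameCycle y b := fun hh => hn (hxy.trans hh)
    have := cyc_mul_swap_of_not_mem hn hy
    rw [← hg] at this
    rcases hb with hb | hb
    · exact hn (SameCycle.symm (this ▸ SameCycle.symm hb : x ∈ (g * swap x y).cyc b))
    · exact hy (SameCycle.symm (this ▸ SameCycle.symm hb : y ∈ (g * swap x y).cyc b))

theorem numCycles_mul_swap (h : ¬ g.SameCycle x y) :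
    (g * swap x y).numCycles + 1 = g.numCycles := by
  classical
  have := Fintype.ofFinite A
  -- The cycle of `y` is absorbed by that of `x`; all other cycles keep their identity.
  let F : {q : Quotient (SameCycle.setoid g) // q ≠ Quotient.mk _ y} →
      Quotient (SameCycle.setoid (g * swap x y)) := fun q => Quotient.mk _ q.1.out
  have hout : ∀ q : Quotient (SameCycle.setoid g), ∀ a, Quotient.mk _ a = q →
      g.SameCycle q.out a := by
    rintro q a rfl
    exact Quotient.exact (s := SameCycle.setoid g) (Quotient.out_eq _)
  have hF : ∀ a, ∀ h : ¬ g.SameCycle y a, F ⟨Quotient.mk _ a, fun hh => h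
      (SameCycle.symm (Quotient.exact hh))⟩ = Quotient.mk _ a := by
    intro a h'
    refine Quotient.sound ?_
    change (g * swap x y).SameCycle _ a
    have h1 := hout (Quotient.mk _ a) a rfl
    by_cases hx : g.SameCycle x a
    · have h2 : ∀ b, g.SameCycle x b → b ∈ (g * swap x y).cyc x := fun b hb => by
        rw [cyc_mul_swap h]; exact Or.inl hb
      exact (h2 _ (hx.trans h1.symm)).symm.trans (h2 _ hx)
    · have h3 := cyc_mul_swap_of_not_mem hx h'
      exact SameCycle.symm (h3 ▸ h1.symm : _ ∈ (g * swap x y).cyc a)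
  have hbij : Function.Bijective F := by
    constructor
    · rintro ⟨q, hq⟩ ⟨q', hq'⟩ he
      induction q using Quotient.inductionOn with | h a => ?_
      induction q' using Quotient.inductionOn with | h b => ?_
      have ha : ¬ g.SameCycle y a := fun hh => hq (Quotient.sound hh.symm)
      have hb : ¬ g.SameCycle y b := fun hh => hq' (Quotient.sound hh.symm)
      rw [hF a ha, hF b hb] at he
      have he' : (g * swap x y).SameCycle a b := Quotient.exact he
      refine Subtype.ext (Quotient.sound ?_)
      change g.SameCycle a b
      by_cases hx : g.SameCycle x a
      · have h2 : b ∈ (g * swap x y).cyc x := by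
          refine SameCycle.trans ?_ he'
          have : a ∈ (g * swap x y).cyc x := by rw [cyc_mul_swap h]; exact Or.inl hx
          exact this
        rw [cyc_mul_swap h] at h2
        exact hx.symm.trans (h2.resolve_right hb)
      · have h3 := cyc_mul_swap_of_not_mem hx ha
        exact (h3 ▸ he' : b ∈ g.cyc a)
    · intro q
      induction q using Quotient.inductionOn with | h a => ?_
      by_cases ha : g.SameCycle y a
      · refine ⟨_, (hF x fun hh => h hh.symm).trans (Quotient.sound ?_)⟩
        have : a ∈ (g * swap x y).cyc x := by rw [cyc_mul_swap h]; exact Or.inr ha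
        exact this
      · exact ⟨_, hF a ha⟩
  rw [numCycles, numCycles, ← Nat.card_eq_of_bijective F hbij, Nat.card_eq_fintype_card,
    Nat.card_eq_fintype_card, Fintype.card_subtype_compl, Fintype.card_subtype_eq,
    Nat.sub_add_cancel]
  exact Fintype.card_pos_iff.2 ⟨Quotient.mk _ y⟩

theorem cyc_swap_mul (h : ¬ g.SameCycle x y) :
    (swap x y * g).cyc x = g.cyc x ∪ g.cyc y := by
  rw [swap_mul_eq_mul_swap]
  have h' : ¬ g.SameCycle (g⁻¹ x) (g⁻¹ y) := by rwa [sameCycle_inv_inv]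
  have hu := cyc_mul_swap h'
  rw [cyc_inv_apply, cyc_inv_apply] at hu
  have : x ∈ (g * swap (g⁻¹ x) (g⁻¹ y)).cyc (g⁻¹ x) := by
    rw [hu]
    exact Or.inl (self_mem_cyc _ _)
  rw [← SameCycle.cyc_eq this, hu]

theorem cyc_swap_mul_of_not_mem (hx : ¬ g.SameCycle x a) (hy : ¬ g.SameCycle y a) :
    (swap x y * g).cyc a = g.cyc a := by
  rw [swap_mul_eq_mul_swap]
  refine cyc_mul_swap_of_not_mem ?_ ?_
  · intro h; exact hx ((cyc_inv_apply g x) ▸ h : a ∈ g.cyc x)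
  · intro h; exact hy ((cyc_inv_apply g y) ▸ h : a ∈ g.cyc y)

theorem numCycles_swap_mul (h : ¬ g.SameCycle x y) :
    (swap x y * g).numCycles + 1 = g.numCycles := by
  rw [swap_mul_eq_mul_swap]
  exact numCycles_mul_swap (by rwa [sameCycle_inv_inv])

end Swap

end Equiv.Perm

/-! ### Cochains on a surface: Euler's inequality and exactness by linear algebra. -/

open Equiv.Perm in
/-- The functions that are constant on the cycles of `f`. -/
def Equiv.Perm.invariants (K : Type*) [Field K] {A : Type*} (f : Equiv.Perm A) :
    Submodule K (A → K) where
  carrier := {h | ∀ x, h (f x) = h x}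
  add_mem' ha hb x := by simp [ha x, hb x]
  zero_mem' _ := rfl
  smul_mem' c h hh x := by simp [hh x]

namespace Equiv.Perm

section Invariants

variable {K : Type*} [Field K] {A : Type*} [Finite A] {f φ α : Perm A}

theorem eq_of_mem_invariants {h : A → K} (hh : h ∈ invariants K f) {x y : A}
    (hxy : f.SameCycle x y) : h y = h x :=
  SameCycle.mem_of_forall (B := {z | h z = h x}) hxy (fun z hz => (hh z).trans hz) rfl

/-- Invariant functions are the pullbacks of arbitrary functions on the set of cycles. -/
theorem finrank_invariants (f : Perm A) : Module.finrank K (invariants K f) = f.numCycles := by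
  have := Fintype.ofFinite (Quotient (SameCycle.setoid f))
  have hr : LinearMap.range (LinearMap.funLeft K K (Quotient.mk (SameCycle.setoid f))) =
      invariants K f := by
    ext h
    constructor
    · rintro ⟨k, rfl⟩ x
      have : Quotient.mk (SameCycle.setoid f) (f x) = Quotient.mk (SameCycle.setoid f) x :=
        Quotient.sound (show f.SameCycle (f x) x from
          (SameCycle.apply_right (SameCycle.refl f x)).symm)
      simp only [LinearMap.funLeft_apply, this]
    · intro hh
      refine ⟨fun q => Quotient.lift (s := SameCycle.setoid f) h
        (fun a b hab => (eq_of_mem_invariants hh hab).symm) q, ?_⟩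
      ext x
      rfl
  rw [← hr, LinearMap.finrank_range_of_inj
    (LinearMap.funLeft_injective_of_surjective K K _ Quotient.mk_surjective),
    Module.finrank_fintype_fun_eq_card, numCycles, Nat.card_eq_fintype_card]

end Invariants

section Orientation

variable {A : Type*} [Fintype A] [DecidableEq A] {α : Perm A}

/-- `R` contains exactly one of the two elements of every `2`-cycle of `α`, and no other element. -/
def IsOrientation (α : Perm A) (R : Finset A) : Prop :=
  (∀ x ∈ R, α x ∉ R) ∧ ∀ x, α x ≠ x ↔ (x ∈ R ∨ α x ∈ R)

theorem exists_isOrientation (hα : ∀ x, α (α x) = x) : ∃ R, IsOrientation α R := by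
  let e := Fintype.equivFin A
  refine ⟨Finset.univ.filter fun x => e x < e (α x), ?_, ?_⟩
  · intro x hx
    simp only [Finset.mem_filter, Finset.mem_univ, true_and, hα] at hx ⊢
    exact hx.asymm
  · intro x
    simp only [Finset.mem_filter, Finset.mem_univ, true_and, hα]
    rw [← ne_iff_lt_or_gt, ne_comm, e.injective.ne_iff]

theorem IsOrientation.sum_add {R : Finset A} (hR : IsOrientation α R) (hα : ∀ x, α (α x) = x)
    {N : Type*} [AddCommMonoid N] (k : A → N) :
    ∑ x ∈ R, (k x + k (α x)) = ∑ x with α x ≠ x, k x := by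
  have h : Finset.univ.filter (fun x => α x ≠ x) = R ∪ R.map α.toEmbedding := by
    ext x
    simp only [Finset.mem_filter, Finset.mem_univ, true_and, Finset.mem_union, Finset.mem_map,
      Equiv.coe_toEmbedding, hR.2 x]
    refine or_congr Iff.rfl ⟨fun h => ⟨_, h, hα x⟩, ?_⟩
    rintro ⟨y, hy, rfl⟩
    rwa [hα]
  rw [h, Finset.sum_union, Finset.sum_map, Finset.sum_add_distrib]
  · rfl
  · rw [Finset.disjoint_left]
    intro x hx hx'
    obtain ⟨y, hy, rfl⟩ := Finset.mem_map.1 hx'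
    exact hR.1 y hy hx

theorem IsOrientation.two_mul_card {R : Finset A} (hR : IsOrientation α R)
    (hα : ∀ x, α (α x) = x) :
    2 * R.card + (Finset.univ.filter fun x => α x = x).card = Fintype.card A := by
  have h := hR.sum_add hα (fun _ => 1)
  simp only [Finset.sum_const, smul_eq_mul, mul_one] at h
  rw [mul_comm, show 2 = 1 + 1 from rfl, h, add_comm]
  exact Finset.card_filter_add_card_filter_not _

end Orientation

end Equiv.Perm

section Orthogonal

variable {K : Type*} [Field K] {ι : Type*} [Fintype ι] [DecidableEq ι]
  {W W' : Submodule K (ι → K)}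

/-- `W` lies in the annihilator of `W'`, whose dimension is complementary to that of `W'`; equality
of dimensions forces the two to coincide. -/
theorem finrank_add_finrank_le_of_dotProduct_eq_zero (h : ∀ w ∈ W, ∀ w' ∈ W', w' ⬝ᵥ w = 0) :
    Module.finrank K W + Module.finrank K W' ≤ Fintype.card ι ∧
    (Module.finrank K W + Module.finrank K W' = Fintype.card ι →
      ∀ g : ι → K, (∀ w' ∈ W', w' ⬝ᵥ g = 0) → g ∈ W) := by
  let Φ : Submodule K (Module.Dual K (ι → K)) := W'.map (dotProductEquiv K ι).toLinearMap
  have hmem : ∀ g, g ∈ Φ.dualCoannihilator ↔ ∀ w' ∈ W', w' ⬝ᵥ g = 0 := by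
    intro g
    rw [Submodule.mem_dualCoannihilator]
    constructor
    · intro hg w' hw'
      exact hg _ ⟨w', hw', rfl⟩
    · rintro hg _ ⟨w', hw', rfl⟩
      exact hg w' hw'
  have hle : W ≤ Φ.dualCoannihilator := fun w hw => (hmem w).2 fun w' hw' => h w hw w' hw'
  have h1 := Subspace.finrank_add_finrank_dualCoannihilator_eq Φ
  have h2 : Module.finrank K Φ = Module.finrank K W' :=
    LinearEquiv.finrank_map_eq (dotProductEquiv K ι) W'
  rw [Module.finrank_fintype_fun_eq_card, h2] at h1
  have h3 := Submodule.finrank_mono hle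
  refine ⟨by omega, fun he g hg => ?_⟩
  rw [Submodule.eq_of_le_of_finrank_eq hle (by omega)]
  exact (hmem g).2 hg

end Orthogonal

namespace Equiv.Perm

variable {A : Type*} [Fintype A] [DecidableEq A] {φ α : Perm A} {R P : Finset A}

/-- Every nonempty set that is stable under `φ` and `α` meets `P`. -/
def MeetsStable (φ α : Perm A) (P : Finset A) : Prop :=
  ∀ B : Set A, (∀ x ∈ B, φ x ∈ B) → (∀ x ∈ B, α x ∈ B) → B.Nonempty → ∃ m ∈ P, m ∈ B

/-- The differences of a function on the arcs along the edges. -/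
def edgeDiff (K : Type*) [Field K] (α : Perm A) (R : Finset A) : (A → K) →ₗ[K] (R → K) where
  toFun h x := h (α x) - h x
  map_add' h k := by ext x; simp; ring
  map_smul' c h := by ext x; simp; ring

variable {K : Type*} [Field K]

/-- Summation by parts: `f` is a function of the vertices and `f'` one of the faces. Spread over all
arcs, the product becomes `∑ (f (α x) - f x) * f' x` up to sign; as `f (α x) = f (φ x)` and `f'` is
invariant under `φ`, reindexing by `φ` cancels the two terms. -/
theorem edgeDiff_dotProduct (hα : ∀ x, α (α x) = x) (hR : IsOrientation α R) {f f' : A → K}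
    (hf : f ∈ invariants K (φ * α)) (hf' : f' ∈ invariants K φ) :
    edgeDiff K α R f' ⬝ᵥ edgeDiff K α R f = 0 := by
  let k : A → K := fun x => f (α x) * f' x - f x * f' x
  have hφ : ∀ x, f (α x) = f (φ x) := fun x => by
    have := hf (α x)
    rw [mul_apply, hα] at this
    exact this.symm
  have h1 : edgeDiff K α R f' ⬝ᵥ edgeDiff K α R f = - ∑ x ∈ R, (k x + k (α x)) := by
    rw [← Finset.sum_neg_distrib, ← Finset.sum_coe_sort R, dotProduct]
    refine Finset.sum_congr rfl fun x _ => ?_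
    simp only [edgeDiff, LinearMap.coe_mk, AddHom.coe_mk, k, hα]
    ring
  have h2 : ∑ x with α x ≠ x, k x = ∑ x, k x := by
    refine Finset.sum_subset (Finset.filter_subset _ _) fun x _ hx => ?_
    simp only [Finset.mem_filter, Finset.mem_univ, true_and, not_not] at hx
    simp [k, hx]
  have h3 : ∑ x, f (α x) * f' x = ∑ x, f x * f' x := by
    rw [← Equiv.sum_comp φ fun x => f x * f' x]
    refine Finset.sum_congr rfl fun x _ => ?_
    rw [hφ, hf' x]
  rw [h1, hR.sum_add hα, h2]
  simp only [k, Finset.sum_sub_distrib, h3, sub_self, neg_zero]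

/-- Rank and nullity: an invariant function without differences along edges is constant on
components, hence determined by its values on `P`. The hypothesis `hf` lets the same argument serve
for faces and for vertices. -/
theorem numCycles_le_finrank_map (hα : ∀ x, α (α x) = x) (hR : IsOrientation α R)
    (hP : MeetsStable φ α P) {f : Perm A}
    (hf : ∀ h : A → K, (∀ x, h (α x) = h x) → h ∈ invariants K f → h ∈ invariants K φ) :
    f.numCycles ≤ Module.finrank K ((invariants K f).map (edgeDiff K α R)) + P.card := by
  let d := (edgeDiff K α R).domRestrict (invariants K f)
  have h1 := LinearMap.finrank_range_add_finrank_ker d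
  rw [finrank_invariants, LinearMap.range_domRestrict] at h1
  let ev : LinearMap.ker d →ₗ[K] (P → K) :=
    LinearMap.funLeft K K (Subtype.val : P → A) ∘ₗ (invariants K f).subtype ∘ₗ
      (LinearMap.ker d).subtype
  have hev : Function.Injective ev := by
    rw [injective_iff_map_eq_zero]
    rintro ⟨⟨h, hh⟩, hk⟩ he
    have hd : edgeDiff K α R h = 0 := hk
    have ha : ∀ x, h (α x) = h x := by
      have hR' : ∀ x ∈ R, h (α x) = h x := fun x hx => sub_eq_zero.1 (congrFun hd ⟨x, hx⟩)
      intro x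
      by_cases hx : α x = x
      · rw [hx]
      · rcases (hR.2 x).1 hx with hx | hx
        · exact hR' x hx
        · rw [← hR' _ hx, hα]
    have hφ := hf h ha hh
    have h0 : h = 0 := by
      by_contra hne
      obtain ⟨x, hx⟩ : ∃ x, h x ≠ 0 := by
        by_contra hn; push Not at hn; exact hne (funext hn)
      obtain ⟨m, hm, hmB⟩ := hP {x | h x ≠ 0} (fun x hx => by
        change h (φ x) ≠ 0; rw [hφ x]; exact hx) (fun x hx => by
        change h (α x) ≠ 0; rw [ha x]; exact hx) ⟨x, hx⟩
      exact hmB (congrFun he ⟨m, hm⟩)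
    exact Subtype.ext (Subtype.ext h0)
  have h2 := LinearMap.finrank_le_finrank_of_injective hev
  rw [Module.finrank_fintype_fun_eq_card, Fintype.card_coe] at h2
  omega

theorem numCycles_le_finrank_map_face (hα : ∀ x, α (α x) = x) (hR : IsOrientation α R)
    (hP : MeetsStable φ α P) :
    φ.numCycles ≤ Module.finrank K ((invariants K φ).map (edgeDiff K α R)) + P.card :=
  numCycles_le_finrank_map hα hR hP fun _ _ h => h

theorem numCycles_le_finrank_map_vertex (hα : ∀ x, α (α x) = x) (hR : IsOrientation α R)
    (hP : MeetsStable φ α P) :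
    (φ * α).numCycles ≤
      Module.finrank K ((invariants K (φ * α)).map (edgeDiff K α R)) + P.card :=
  numCycles_le_finrank_map hα hR hP fun h ha hh x => by
    have := hh (α x)
    rw [mul_apply, hα, ha] at this
    exact this

theorem dotProduct_eq_zero_of_mem_map (hα : ∀ x, α (α x) = x) (hR : IsOrientation α R) :
    ∀ w ∈ (invariants K (φ * α)).map (edgeDiff K α R),
      ∀ w' ∈ (invariants K φ).map (edgeDiff K α R), w' ⬝ᵥ w = 0 := by
  rintro _ ⟨f, hf, rfl⟩ _ ⟨f', hf', rfl⟩
  exact edgeDiff_dotProduct hα hR hf hf'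

/-- Euler's inequality: a surface with at most `P.card` components has characteristic at most
`2 * P.card`. -/
theorem numCycles_add_numCycles_le (hα : ∀ x, α (α x) = x) (hR : IsOrientation α R)
    (hP : MeetsStable φ α P) :
    φ.numCycles + (φ * α).numCycles ≤ R.card + 2 * P.card := by
  have h1 := (finrank_add_finrank_le_of_dotProduct_eq_zero
    (dotProduct_eq_zero_of_mem_map (K := ℚ) (φ := φ) hα hR)).1
  have h2 := numCycles_le_finrank_map_face (K := ℚ) hα hR hP
  have h3 := numCycles_le_finrank_map_vertex (K := ℚ) hα hR hP
  rw [Fintype.card_coe] at h1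
  omega

/-- On a union of spheres, every closed cochain is exact. -/
theorem exists_edgeDiff_eq (hα : ∀ x, α (α x) = x) (hR : IsOrientation α R)
    (hP : MeetsStable φ α P)
    (hplanar : φ.numCycles + (φ * α).numCycles = R.card + 2 * P.card)
    (g : R → K) (hg : ∀ f' ∈ invariants K φ, edgeDiff K α R f' ⬝ᵥ g = 0) :
    ∃ f ∈ invariants K (φ * α), edgeDiff K α R f = g := by
  obtain ⟨h1, h1'⟩ := finrank_add_finrank_le_of_dotProduct_eq_zero
    (dotProduct_eq_zero_of_mem_map (K := K) (φ := φ) hα hR)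
  have h2 := numCycles_le_finrank_map_face (K := K) hα hR hP
  have h3 := numCycles_le_finrank_map_vertex (K := K) hα hR hP
  rw [Fintype.card_coe] at h1 h1'
  refine h1' (by omega) g ?_
  rintro _ ⟨f', hf', rfl⟩
  exact hg f' hf'

end Equiv.Perm

/-! ### Joining and cutting face cycles, as caused by an edge. -/

namespace Equiv.Perm

section Period

variable {A : Type*} [Finite A] {f : Perm A} {x : A}

theorem pow_apply_eq_self_iff {n : ℕ} : (f ^ n) x = x ↔ (f.cyc x).ncard ∣ n := by
  classical
  have := Fintype.ofFinite A
  have h : f.IsCycleOn ((f.cyc x).toFinset : Set A) := by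
    rw [Set.coe_toFinset]
    refine ⟨⟨fun a ha => apply_mem_cyc ha, f.injective.injOn, fun a ha => ?_⟩,
      fun a ha b hb => (SameCycle.symm ha).trans hb⟩
    exact ⟨f⁻¹ a, sameCycle_symm_apply_right.2 ha, apply_inv_apply f a⟩
  rw [h.pow_apply_eq (by simpa using self_mem_cyc f x), Set.ncard_eq_toFinset_card']

end Period

section Restructure

variable {A : Type*} [Finite A] [DecidableEq A] {φ' : Perm A} {m r s : A}

/-- The cycles of `m`, `r` and `s` are joined into one. -/
theorem cyc_join (hm : φ' m = m) (hmr : m ≠ r) (hms : m ≠ s) (hrs : ¬ φ'.SameCycle r s) :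
    (swap m r * φ' * swap r s) m = r ∧
    (swap m r * φ' * swap r s).cyc m = insert m (φ'.cyc r ∪ φ'.cyc s) ∧
    ((swap m r * φ' * swap r s).cyc m).ncard = (φ'.cyc r).ncard + (φ'.cyc s).ncard + 1 ∧
    (∀ x, x ∉ (swap m r * φ' * swap r s).cyc m →
      (swap m r * φ' * swap r s).cyc x = φ'.cyc x) ∧
    (swap m r * φ' * swap r s).numCycles + 2 = φ'.numCycles := by
  have hmn : ∀ y, m ≠ y → ¬ φ'.SameCycle m y := fun y hy h => hy (SameCycle.eq_of_left h hm)
  set φ1 := swap m r * φ' with hφ1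
  have e1 : φ1.cyc m = insert m (φ'.cyc r) := by
    rw [cyc_swap_mul (hmn r hmr), cyc_of_apply_eq hm]; rfl
  have hr1 : r ∈ φ1.cyc m := by rw [e1]; exact Or.inr (self_mem_cyc _ _)
  have e2 : φ1.cyc r = insert m (φ'.cyc r) := by rw [← e1, ← SameCycle.cyc_eq hr1]
  have e3 : φ1.cyc s = φ'.cyc s := cyc_swap_mul_of_not_mem (hmn s hms) hrs
  have hn : ¬ φ1.SameCycle r s := by
    intro h
    have : s ∈ φ1.cyc r := h
    rw [e2] at this
    exact this.elim (fun h => hms h.symm) hrs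
  have e4 : (φ1 * swap r s).cyc r = insert m (φ'.cyc r ∪ φ'.cyc s) := by
    rw [cyc_mul_swap hn, e2, e3, Set.insert_union]
  have hm4 : m ∈ (φ1 * swap r s).cyc r := by rw [e4]; exact Or.inl rfl
  have e5 : (φ1 * swap r s).cyc m = insert m (φ'.cyc r ∪ φ'.cyc s) := by
    rw [← SameCycle.cyc_eq hm4, e4]
  refine ⟨?_, e5, ?_, ?_, ?_⟩
  · rw [hφ1, mul_apply, mul_apply, swap_apply_of_ne_of_ne hmr hms, hm, swap_apply_left]
  · rw [e5, Set.ncard_insert_of_notMem, Set.ncard_union_eq (disjoint_cyc hrs)]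
    rintro (h | h)
    · exact hmn r hmr (SameCycle.symm h)
    · exact hmn s hms (SameCycle.symm h)
  · intro x hx
    have hxr : x ∉ (φ1 * swap r s).cyc r := by rwa [SameCycle.cyc_eq hm4]
    rw [cyc_mul_swap hn, Set.mem_union, not_or] at hxr
    rw [cyc_mul_swap_of_not_mem hxr.1 hxr.2]
    rw [e2, Set.mem_insert_iff, not_or] at hxr
    exact cyc_swap_mul_of_not_mem (fun h => hmn x (Ne.symm hxr.1.1) h) hxr.1.2
  · have h1 := numCycles_mul_swap hn
    have h2 := numCycles_swap_mul (hmn r hmr)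
    rw [← hφ1] at h2
    omega

/-- The cycle of `r` is cut into a cycle through `s` of length four and a cycle through `m`. -/
theorem cyc_cut {x : A} (hm : φ' m = m) (hs : φ' s = s) (hmr : m ≠ r) (hms : m ≠ s) (hrs : r ≠ s)
    (hx : x = (φ' ^ 4) r) (h4 : ∀ i ∈ ({1, 2, 3} : Finset ℕ), (φ' ^ i) r ≠ r) :
    (swap m r * swap s x * φ' * swap r s) m = r ∧
    ((swap m r * swap s x * φ' * swap r s).cyc s).ncard = 4 ∧
    ¬ (swap m r * swap s x * φ' * swap r s).SameCycle m s ∧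
    (swap m r * swap s x * φ' * swap r s).cyc m ∪ (swap m r * swap s x * φ' * swap r s).cyc s =
      insert m (insert s (φ'.cyc r)) ∧
    ((swap m r * swap s x * φ' * swap r s).cyc m).ncard + 2 = (φ'.cyc r).ncard ∧
    (∀ y, y ∉ (swap m r * swap s x * φ' * swap r s).cyc m →
      y ∉ (swap m r * swap s x * φ' * swap r s).cyc s →
      (swap m r * swap s x * φ' * swap r s).cyc y = φ'.cyc y) ∧
    (swap m r * swap s x * φ' * swap r s).numCycles + 1 = φ'.numCycles := by
  have hmn : ∀ y, m ≠ y → ¬ φ'.SameCycle m y := fun y hy h => hy (SameCycle.eq_of_left h hm)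
  have hsn : ∀ y, s ≠ y → ¬ φ'.SameCycle s y := fun y hy h => hy (SameCycle.eq_of_left h hs)
  have hpow : ∀ i : ℕ, φ'.SameCycle r ((φ' ^ i) r) := fun i => ⟨i, by simp⟩
  have hpm : ∀ i : ℕ, (φ' ^ i) r ≠ m := fun i h => hmn r hmr (SameCycle.symm (h ▸ hpow i))
  have hps : ∀ i : ℕ, (φ' ^ i) r ≠ s := fun i h => hsn r hrs.symm (SameCycle.symm (h ▸ hpow i))
  have hxm : x ≠ m := hx ▸ hpm 4
  have hxs : x ≠ s := hx ▸ hps 4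
  have hrx : φ'.SameCycle r x := hx ▸ hpow 4
  have hstep : ∀ i : ℕ, φ' ((φ' ^ i) r) = (φ' ^ (i + 1)) r := fun i => by
    rw [pow_succ', mul_apply]
  -- Otherwise `4 - i`, again one of `1, 2, 3`, would be a period of `r`.
  have h4' : ∀ i ∈ ({1, 2, 3} : Finset ℕ), (φ' ^ i) r ≠ x := by
    intro i hi h
    have : (φ' ^ i) r = (φ' ^ i) ((φ' ^ (4 - i)) r) := by
      have hle : i ≤ 4 := by fin_cases hi <;> norm_num
      rw [← mul_apply, ← pow_add, Nat.add_sub_cancel' hle, h, hx]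
    refine h4 (4 - i) ?_ ((φ' ^ i).injective this).symm
    fin_cases hi <;> simp
  have h41 := h4 1 (by simp)
  have h42 := h4 2 (by simp)
  have h43 := h4 3 (by simp)
  set φ := swap m r * swap s x * φ' * swap r s with hφ
  have happ : ∀ y, φ y = swap m r (swap s x (φ' (swap r s y))) := fun y => rfl
  have a0 : φ m = r := by
    rw [happ, swap_apply_of_ne_of_ne hmr hms, hm, swap_apply_of_ne_of_ne hms hxm.symm,
      swap_apply_left]
  have a1 : φ s = (φ' ^ 1) r := by
    rw [happ, swap_apply_right, show φ' r = (φ' ^ 1) r by rw [pow_one],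
      swap_apply_of_ne_of_ne (hps 1) (h4' 1 (by simp)), swap_apply_of_ne_of_ne (hpm 1) h41]
  have a2 : φ ((φ' ^ 1) r) = (φ' ^ 2) r := by
    rw [happ, swap_apply_of_ne_of_ne h41 (hps 1), hstep,
      swap_apply_of_ne_of_ne (hps 2) (h4' 2 (by simp)), swap_apply_of_ne_of_ne (hpm 2) h42]
  have a3 : φ ((φ' ^ 2) r) = (φ' ^ 3) r := by
    rw [happ, swap_apply_of_ne_of_ne h42 (hps 2), hstep,
      swap_apply_of_ne_of_ne (hps 3) (h4' 3 (by simp)), swap_apply_of_ne_of_ne (hpm 3) h43]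
  have a4 : φ ((φ' ^ 3) r) = s := by
    rw [happ, swap_apply_of_ne_of_ne h43 (hps 3), hstep, ← hx, swap_apply_right,
      swap_apply_of_ne_of_ne hms.symm hrs.symm]
  -- The new quadrilateral: `s` takes the place of `r` in front of three steps of the old cycle, and
  -- the transposition with `x` closes it up.
  have hcs : (φ.cyc s) ⊆ {s, (φ' ^ 1) r, (φ' ^ 2) r, (φ' ^ 3) r} := by
    refine cyc_subset_of_forall ?_ (Or.inl rfl)
    rintro z (rfl | rfl | rfl | rfl)
    · rw [a1]; simp
    · rw [a2]; simp
    · rw [a3]; simp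
    · rw [a4]; simp
  have hp4 : (φ ^ 4) s = s := by
    simp only [pow_succ, pow_zero, one_mul, mul_apply] at a1 a2 a3 a4 ⊢
    rw [a1, a2, a3, a4]
  have hp2 : (φ ^ 2) s ≠ s := by
    rw [pow_two, mul_apply, a1, a2]
    exact hps 2
  -- The length divides `4` but not `2`.
  have hcard : (φ.cyc s).ncard = 4 := by
    have h1 := pow_apply_eq_self_iff.1 hp4
    rw [Ne, pow_apply_eq_self_iff] at hp2
    have : (φ.cyc s).ncard ∈ Nat.divisors 4 := Nat.mem_divisors.2 ⟨h1, by norm_num⟩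
    have hd : Nat.divisors 4 = {1, 2, 4} := by decide
    rw [hd] at this
    simp only [Finset.mem_insert, Finset.mem_singleton] at this
    rcases this with h | h | h
    · rw [h] at hp2; norm_num at hp2
    · rw [h] at hp2; norm_num at hp2
    · exact h
  have hmr' : φ.SameCycle m r := by
    have : φ.SameCycle m (φ m) := SameCycle.apply_right (SameCycle.refl _ _)
    rwa [a0] at this
  have hn : ¬ φ.SameCycle s r := by
    intro h
    rcases hcs h with h | h | h | h
    · exact hrs h
    · exact h41 h.symm
    · exact h42 h.symm
    · exact h43 h.symm
  have hn' : ¬ φ.SameCycle r s := fun h => hn h.symm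
  -- the intermediate permutations
  have hsx : ¬ φ'.SameCycle s x := hsn x hxs.symm
  set φ2 := swap s x * φ' with hφ2
  have hm2 : φ2 m = m := by
    rw [hφ2, mul_apply, hm, swap_apply_of_ne_of_ne hms hxm.symm]
  have hmn2 : ∀ y, m ≠ y → ¬ φ2.SameCycle m y := fun y hy h => hy (SameCycle.eq_of_left h hm2)
  have e1 : φ2.cyc s = insert s (φ'.cyc r) := by
    rw [cyc_swap_mul hsx, cyc_of_apply_eq hs, SameCycle.cyc_eq hrx]; rfl
  have e2 : φ2.cyc r = insert s (φ'.cyc r) := by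
    rw [← e1]
    refine (SameCycle.cyc_eq ?_).symm
    have : r ∈ φ2.cyc s := by rw [e1]; exact Or.inr (self_mem_cyc _ _)
    exact this
  have hφ1 : φ = swap m r * φ2 * swap r s := by simp only [hφ, hφ2, mul_assoc]
  set φ1 := swap m r * φ2 with hφ1'
  have e3 : φ1.cyc m = insert m (insert s (φ'.cyc r)) := by
    rw [cyc_swap_mul (hmn2 r hmr), cyc_of_apply_eq hm2, e2]; rfl
  have hr1 : r ∈ φ1.cyc m := by rw [e3]; exact Or.inr (Or.inr (self_mem_cyc _ _))
  have hs1 : s ∈ φ1.cyc m := by rw [e3]; exact Or.inr (Or.inl rfl)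
  have e4 : φ1 = φ * swap r s := by rw [hφ1]; simp [mul_assoc]
  have e5 : φ1.cyc r = φ.cyc m ∪ φ.cyc s := by
    rw [e4, cyc_mul_swap hn', SameCycle.cyc_eq hmr']
  have e6 : φ.cyc m ∪ φ.cyc s = insert m (insert s (φ'.cyc r)) := by
    rw [← e5, ← SameCycle.cyc_eq hr1, e3]
  have hms' : ¬ φ.SameCycle m s := fun h => hn' (hmr'.symm.trans h)
  refine ⟨a0, hcard, hms', e6, ?_, ?_, ?_⟩
  · have h1 := Set.ncard_union_eq (disjoint_cyc hms') (Set.toFinite _) (Set.toFinite _)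
    rw [e6, hcard, Set.ncard_insert_of_notMem, Set.ncard_insert_of_notMem] at h1
    · omega
    · exact fun h => hsn r hrs.symm (SameCycle.symm h)
    · rintro (h | h)
      · exact hms h
      · exact hmn r hmr (SameCycle.symm h)
  · intro y h1 h2
    have hy : y ∉ insert m (insert s (φ'.cyc r)) := by
      rw [← e6]; exact fun h => h.elim h1 h2
    rw [Set.mem_insert_iff, Set.mem_insert_iff, not_or, not_or] at hy
    have h3 : ¬ φ1.SameCycle r y := fun h => by
      have : y ∈ φ1.cyc r := h
      rw [e5] at this
      exact this.elim h1 h2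
    have h4 : ¬ φ1.SameCycle s y := fun h => h3 ((SameCycle.symm hr1).trans (SameCycle.trans hs1 h))
    rw [hφ1, cyc_mul_swap_of_not_mem h3 h4, hφ1', cyc_swap_mul_of_not_mem
      (hmn2 y (Ne.symm hy.1)), hφ2, cyc_swap_mul_of_not_mem (hsn y (Ne.symm hy.2.1))]
    · exact fun h => hy.2.2 (hrx.trans h)
    · intro h
      have : y ∈ φ2.cyc r := h
      rw [e2] at this
      exact this.elim hy.2.1 hy.2.2
  · have h1 := numCycles_mul_swap hn'
    have h2 := numCycles_swap_mul hsx
    have h3 := numCycles_swap_mul (hmn2 r hmr)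
    rw [← e4] at h1
    rw [← hφ1'] at h3
    rw [← hφ2] at h2
    omega

end Restructure

end Equiv.Perm

open Equiv Equiv.Perm

/-! ### Families of planar maps with half-edges, and the removal of an edge. -/

section MarkedMap

variable {A : Type*} [Fintype A] [DecidableEq A]

/-- A family of planar maps with half-edges, in which every component has exactly one half-edge.
The half-edges are the elements of `M`. The face at the half-edge `m` has degree `ℓ m` (the
half-edge itself is not counted), all the other faces have degree four. -/
structure IsMarkedMap (M : Finset A) (ℓ : A → ℕ) (φ α : Perm A) : Prop where
  invol : ∀ x, α (α x) = x
  fixed : ∀ x, α x = x ↔ x ∈ M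
  meets : MeetsStable φ α M
  euler : 2 * (φ.numCycles + (φ * α).numCycles) = Fintype.card A + 3 * M.card
  root_card : ∀ m ∈ M, (φ.cyc m).ncard = ℓ m + 1
  quad : ∀ x, (∀ m ∈ M, ¬ φ.SameCycle m x) → (φ.cyc x).ncard = 4

variable {M : Finset A} {ℓ : A → ℕ} {φ α φ' α' : Perm A} {m r s x : A}

/-- The Euler relation of a marked map is that of `M.card` spheres, with `(Fintype.card A - M.card)
/ 2` edges. Two half-edges in one component would leave fewer components than that, against Euler's
inequality. -/
theorem IsMarkedMap.eq_of_connected (h : IsMarkedMap M ℓ φ α) {m m' : A} (hm : m ∈ M)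
    (hm' : m' ∈ M) (hB : ∀ B : Set A, (∀ x ∈ B, φ x ∈ B) → (∀ x ∈ B, α x ∈ B) → m' ∈ B → m ∈ B) :
    m = m' := by
  by_contra hne
  have hP : MeetsStable φ α (M.erase m') := by
    intro B h1 h2 h3
    obtain ⟨m0, hm0, hB0⟩ := h.meets B h1 h2 h3
    by_cases he : m0 = m'
    · subst he
      exact ⟨m, Finset.mem_erase.2 ⟨hne, hm⟩, hB B h1 h2 hB0⟩
    · exact ⟨m0, Finset.mem_erase.2 ⟨he, hm0⟩, hB0⟩
  obtain ⟨R, hR⟩ := exists_isOrientation h.invol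
  have h1 := numCycles_add_numCycles_le h.invol hR hP
  have h2 := hR.two_mul_card h.invol
  have h3 : (Finset.univ.filter fun x => α x = x) = M := by ext; simp [h.fixed]
  have h4 := Finset.card_erase_of_mem hm'
  have h5 := Finset.card_pos.2 ⟨m', hm'⟩
  have h6 := h.euler
  rw [h3] at h2
  omega

theorem IsMarkedMap.eq_of_sameCycle (h : IsMarkedMap M ℓ φ α) {m m' : A} (hm : m ∈ M)
    (hm' : m' ∈ M) (hs : φ.SameCycle m m') : m = m' :=
  h.eq_of_connected hm hm' fun _ h1 _ h3 => SameCycle.mem_of_forall hs.symm h1 h3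

/-- This makes the right factors `swap r s` of `φ` and `α` cancel in the vertex permutation `φ * α`.
-/
theorem swap_mul_mul_swap_of_fixed (h1 : α r = r) (h2 : α s = s) :
    swap r s * α * swap r s = α := by
  have hr : α⁻¹ r = r := by conv_lhs => rw [← h1]; exact inv_apply_apply α r
  have hs : α⁻¹ s = s := by conv_lhs => rw [← h2]; exact inv_apply_apply α s
  rw [swap_mul_eq_mul_swap, hr, hs, mul_assoc, swap_mul_self, mul_one]

theorem isMarkedMap_invol_iff (h1 : α' r = r) (h2 : α' s = s) :
    (∀ x, (α' * swap r s) ((α' * swap r s) x) = x) ↔ ∀ x, α' (α' x) = x := by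
  have : ∀ x, (α' * swap r s) ((α' * swap r s) x) = α' (α' x) := fun x => by
    rw [← mul_apply, show α' * swap r s * (α' * swap r s) = α' * (swap r s * α' * swap r s) by
      simp only [mul_assoc], swap_mul_mul_swap_of_fixed h1 h2]; rfl
  simp only [this]

theorem isMarkedMap_fixed_iff (h1 : α' r = r) (h2 : α' s = s) (hr : r ∉ M) (hs : s ∉ M)
    (hrs : r ≠ s) :
    (∀ x, (α' * swap r s) x = x ↔ x ∈ M) ↔ ∀ x, α' x = x ↔ x ∈ insert r (insert s M) := by
  refine forall_congr' fun x => ?_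
  by_cases hxr : x = r
  · subst hxr; simp [h2, hr, hrs.symm, h1]
  by_cases hxs : x = s
  · subst hxs; simp [h1, hs, hrs, h2]
  simp [swap_apply_of_ne_of_ne hxr hxs, hxr, hxs]

/-- The connectivity condition only depends on the permutations away from the marked points. -/
theorem Equiv.Perm.MeetsStable.of_agree {M M' : Finset A} (h : MeetsStable φ α M)
    (hM : M ⊆ M') (hagree : ∀ B : Set A, (∀ x ∈ B, φ' x ∈ B) → (∀ x ∈ B, α' x ∈ B) →
      (∀ m ∈ M', m ∉ B) → ∀ x ∈ B, φ x = φ' x ∧ α x = α' x) : MeetsStable φ' α' M' := by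
  intro B h1 h2 h3
  by_contra hn
  push Not at hn
  have ha := hagree B h1 h2 hn
  obtain ⟨m, hm, hmB⟩ := h B (fun x hx => by rw [(ha x hx).1]; exact h1 x hx)
    (fun x hx => by rw [(ha x hx).2]; exact h2 x hx) h3
  exact hn m (hM hm) hmB

/-- A stable set that misses all marked points also misses `m`, `r` and `s`, and there the maps with
and without the edge agree. The case `τ = 1` is an edge with the root face on both sides, `τ = swap
s x` an edge that borders a quadrilateral. -/
theorem meetsStable_join_iff {τ : Perm A} (hm : m ∈ M) (hr : α' r = r) (hs : α' s = s)
    (hφm : (swap m r * τ * φ' * swap r s) m = r) (hrs : r ≠ s)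
    (hτ : ∀ B : Set A, (∀ x ∈ B, φ' x ∈ B) → r ∉ B → s ∉ B → ∀ x ∈ B, τ x = x)
    (hτ' : ∀ B : Set A, (∀ x ∈ B, (swap m r * τ * φ' * swap r s) x ∈ B) → r ∉ B → s ∉ B →
      ∀ x ∈ B, (τ * φ') x = φ' x ∧ φ' x ∈ B) :
    MeetsStable (swap m r * τ * φ' * swap r s) (α' * swap r s) M ↔
      MeetsStable φ' α' (insert r (insert s M)) := by
  have happ : ∀ x, (swap m r * τ * φ' * swap r s) x = swap m r (τ (φ' (swap r s x))) :=
    fun x => rfl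
  constructor
  · intro h
    refine h.of_agree (fun x hx => by simp [hx]) fun B h1 h2 h3 x hx => ?_
    have hmB := h3 m (by simp [hm])
    have hrB := h3 r (by simp)
    have hsB := h3 s (by simp)
    have hxr : x ≠ r := fun h => hrB (h ▸ hx)
    have hxs : x ≠ s := fun h => hsB (h ▸ hx)
    constructor
    · have := h1 x hx
      rw [happ, swap_apply_of_ne_of_ne hxr hxs, hτ B h1 hrB hsB _ this,
        swap_apply_of_ne_of_ne]
      · exact fun h => hmB (h ▸ this)
      · exact fun h => hrB (h ▸ this)
    · rw [mul_apply, swap_apply_of_ne_of_ne hxr hxs]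
  · intro h B h1 h2 h3
    by_contra hn
    push Not at hn
    have hmB := hn m hm
    have hrB : r ∉ B := fun h => hmB (apply_mem_of_forall_mem h1 (by rwa [hφm]))
    have hsB : s ∉ B := fun h => hrB (by
      have := h2 s h
      rwa [mul_apply, swap_apply_right, hr] at this)
    obtain ⟨m0, hm0, hm0B⟩ := h B (fun x hx => (hτ' B h1 hrB hsB x hx).2) (fun x hx => by
      have := h2 x hx
      rwa [mul_apply, swap_apply_of_ne_of_ne (ne_of_mem_of_not_mem hx hrB)
        (ne_of_mem_of_not_mem hx hsB)] at this) h3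
    rcases Finset.mem_insert.1 hm0 with rfl | hm0
    · exact hrB hm0B
    rcases Finset.mem_insert.1 hm0 with rfl | hm0
    · exact hsB hm0B
    exact hn m0 hm0 hm0B

/-- The degrees after an edge with the root face on both sides has been removed. -/
def splitDeg (ℓ : A → ℕ) (m r s : A) (a b : ℕ) : A → ℕ :=
  Function.update (Function.update (Function.update ℓ m 0) r b) s a

/-- The degrees after an edge with only one side on the root face has been removed. -/
def mergeDeg (ℓ : A → ℕ) (m r s : A) : A → ℕ :=
  Function.update (Function.update (Function.update ℓ m 0) s 0) r (ℓ m + 2)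

/-- Removal of an edge that has the root face on both sides. -/
theorem isMarkedMap_split_iff (hm : m ∈ M) (hr : r ∉ M) (hs : s ∉ M) (hrs : r ≠ s)
    (hφm : φ' m = m) (hφrs : ¬ φ'.SameCycle r s) (hαr : α' r = r) (hαs : α' s = s) :
    IsMarkedMap M ℓ (swap m r * φ' * swap r s) (α' * swap r s) ↔
      ∃ a b, a + b + 2 = ℓ m ∧
        IsMarkedMap (insert r (insert s M)) (splitDeg ℓ m r s a b) φ' α' := by
  have hmr : m ≠ r := fun h => hr (h ▸ hm)
  have hms : m ≠ s := fun h => hs (h ▸ hm)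
  obtain ⟨j1, j2, j3, j4, j5⟩ := cyc_join hφm hmr hms hφrs
  -- At the vertices, adding the edge only inserts `m` in front of `r`.
  have hσ : swap m r * φ' * swap r s * (α' * swap r s) = swap m r * (φ' * α') := by
    rw [show swap m r * φ' * swap r s * (α' * swap r s) =
      swap m r * φ' * (swap r s * α' * swap r s) by simp only [mul_assoc],
      swap_mul_mul_swap_of_fixed hαr hαs, mul_assoc]
  have hcardM : (insert r (insert s M)).card = M.card + 2 := by
    rw [Finset.card_insert_of_notMem (by simp [hrs, hr]), Finset.card_insert_of_notMem hs]
  have hmeets : MeetsStable (swap m r * φ' * swap r s) (α' * swap r s) M ↔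
      MeetsStable φ' α' (insert r (insert s M)) := by
    have h := meetsStable_join_iff (τ := 1) (φ' := φ') hm hαr hαs (by rw [mul_one]; exact j1) hrs
      (fun _ _ _ _ _ _ => rfl) ?_
    · rwa [mul_one] at h
    · intro B h1 hrB hsB x hx
      refine ⟨rfl, ?_⟩
      have hmB : m ∉ B := fun h => hrB (by
        have := h1 m h
        rwa [mul_one, j1] at this)
      have := h1 x hx
      rw [mul_one, mul_apply, mul_apply, swap_apply_of_ne_of_ne (ne_of_mem_of_not_mem hx hrB)
        (ne_of_mem_of_not_mem hx hsB)] at this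
      by_cases h3 : φ' x = m
      · rw [h3, swap_apply_left] at this; exact absurd this hrB
      by_cases h4 : φ' x = r
      · rw [h4, swap_apply_right] at this; exact absurd this hmB
      rwa [swap_apply_of_ne_of_ne h3 h4] at this
  have heuler : ∀ hm' : φ' m = m ∧ α' m = m,
      (2 * ((swap m r * φ' * swap r s).numCycles +
        (swap m r * φ' * swap r s * (α' * swap r s)).numCycles) =
        Fintype.card A + 3 * M.card ↔
      2 * (φ'.numCycles + (φ' * α').numCycles) =
        Fintype.card A + 3 * (insert r (insert s M)).card) := by
    rintro ⟨-, h1⟩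
    have h2 : (φ' * α') m = m := by rw [mul_apply, h1, hφm]
    have h3 := numCycles_swap_mul (g := φ' * α') (x := m) (y := r)
      (fun h => hmr (SameCycle.eq_of_left h h2))
    rw [hσ, hcardM]
    omega
  have hfix := isMarkedMap_fixed_iff (M := M) hαr hαs hr hs hrs
  have hinv := isMarkedMap_invol_iff (α' := α') hαr hαs
  have hrm : r ∈ (swap m r * φ' * swap r s).cyc m := by
    rw [j2]; exact Or.inr (Or.inl (self_mem_cyc _ _))
  have hsm : s ∈ (swap m r * φ' * swap r s).cyc m := by
    rw [j2]; exact Or.inr (Or.inr (self_mem_cyc _ _))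
  constructor
  · intro h
    have hf := hfix.1 h.fixed
    have hcm := h.root_card m hm
    rw [j3] at hcm
    have hp1 := ncard_cyc_pos φ' r
    have hp2 := ncard_cyc_pos φ' s
    -- The half-edges `s` and `r` lie on their own cycles but do not count for the degree.
    refine ⟨(φ'.cyc s).ncard - 1, (φ'.cyc r).ncard - 1, by omega, hinv.1 h.invol, hf,
      hmeets.1 h.meets, (heuler ⟨hφm, (hf m).2 (by simp [hm])⟩).1 h.euler, ?_, ?_⟩
    · intro m' hm'
      by_cases h1 : m' = s
      · subst h1
        simp only [splitDeg, Function.update_self]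
        omega
      by_cases h2 : m' = r
      · subst h2
        simp only [splitDeg, Function.update_self, Function.update_of_ne hrs]
        omega
      by_cases h3 : m' = m
      · subst h3
        simp only [splitDeg, Function.update_self, Function.update_of_ne hms,
          Function.update_of_ne hmr]
        rw [cyc_of_apply_eq hφm, Set.ncard_singleton]
      have hm'' : m' ∈ M := by simpa [h1, h2] using hm'
      rw [← j4 m' fun hc => h3 (h.eq_of_sameCycle hm hm'' hc).symm, h.root_card m' hm'']
      simp only [splitDeg, Function.update_of_ne h1, Function.update_of_ne h2,
        Function.update_of_ne h3]
    · intro x hx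
      have hxm : x ∉ (swap m r * φ' * swap r s).cyc m := by
        rw [j2]
        rintro (h | h | h)
        · exact hx m (by simp [hm]) (h ▸ SameCycle.refl _ _)
        · exact hx r (by simp) h
        · exact hx s (by simp) h
      have hcx := j4 x hxm
      rw [← hcx]
      refine h.quad x fun m' hm' hc => hx m' (by simp [hm']) ?_
      have : m' ∈ (swap m r * φ' * swap r s).cyc x := SameCycle.symm hc
      rw [hcx] at this
      exact SameCycle.symm this
  · rintro ⟨a, b, hab, h⟩
    have hf := h.fixed
    have hcr := h.root_card r (by simp)
    have hcs := h.root_card s (by simp)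
    simp only [splitDeg, Function.update_self, Function.update_of_ne hrs] at hcr hcs
    refine ⟨hinv.2 h.invol, hfix.2 hf, hmeets.2 h.meets,
      (heuler ⟨hφm, (hf m).2 (by simp [hm])⟩).2 h.euler, ?_, ?_⟩
    · intro m' hm'
      by_cases h3 : m' = m
      · subst h3; omega
      have h1 : m' ≠ s := fun he => hs (he ▸ hm')
      have h2 : m' ≠ r := fun he => hr (he ▸ hm')
      rw [j4 m', h.root_card m' (by simp [hm'])]
      · simp only [splitDeg, Function.update_of_ne h1, Function.update_of_ne h2,
          Function.update_of_ne h3]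
      · rw [j2]
        rintro (h | hc | hc)
        · exact h3 h
        · exact h2 (h.eq_of_sameCycle (by simp) (by simp [hm']) hc).symm
        · exact h1 (h.eq_of_sameCycle (by simp) (by simp [hm']) hc).symm
    · intro x hx
      have hxm := hx m hm
      have hcx := j4 x hxm
      rw [hcx]
      refine h.quad x fun m' hm' hc => ?_
      have hc' : m' ∈ (swap m r * φ' * swap r s).cyc x := by rw [hcx]; exact SameCycle.symm hc
      rcases Finset.mem_insert.1 hm' with rfl | hm'
      · exact hxm (SameCycle.trans hrm (SameCycle.symm hc'))
      rcases Finset.mem_insert.1 hm' with rfl | hm'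
      · exact hxm (SameCycle.trans hsm (SameCycle.symm hc'))
      exact hx m' hm' (SameCycle.symm hc')

/-- Removal of an edge that has only one side on the root face. -/
theorem isMarkedMap_merge_iff (hm : m ∈ M) (hr : r ∉ M) (hs : s ∉ M) (hrs : r ≠ s)
    (hφm : φ' m = m) (hφs : φ' s = s) (hx : x = (φ' ^ 4) r)
    (h4 : ∀ i ∈ ({1, 2, 3} : Finset ℕ), (φ' ^ i) r ≠ r) (hαr : α' r = r) (hαs : α' s = s) :
    IsMarkedMap M ℓ (swap m r * swap s x * φ' * swap r s) (α' * swap r s) ↔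
      IsMarkedMap (insert r (insert s M)) (mergeDeg ℓ m r s) φ' α' := by
  have hmr : m ≠ r := fun h => hr (h ▸ hm)
  have hms : m ≠ s := fun h => hs (h ▸ hm)
  obtain ⟨j1, j2, j3, j4, j5, j6, j7⟩ := cyc_cut hφm hφs hmr hms hrs hx h4
  have hrx : φ'.SameCycle r x := hx ▸ ⟨4, by rfl⟩
  have hxm : x ≠ m := fun h => hmr (SameCycle.eq_of_right (h ▸ hrx) hφm).symm
  have hxs : x ≠ s := fun h => hrs (SameCycle.eq_of_right (h ▸ hrx) hφs)
  -- At the vertices, `s` is inserted in front of `x` and `m` in front of `r`.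
  have hσ : swap m r * swap s x * φ' * swap r s * (α' * swap r s) =
      swap m r * (swap s x * (φ' * α')) := by
    rw [show swap m r * swap s x * φ' * swap r s * (α' * swap r s) =
      swap m r * swap s x * φ' * (swap r s * α' * swap r s) by simp only [mul_assoc],
      swap_mul_mul_swap_of_fixed hαr hαs]
    simp only [mul_assoc]
  have hcardM : (insert r (insert s M)).card = M.card + 2 := by
    rw [Finset.card_insert_of_notMem (by simp [hrs, hr]), Finset.card_insert_of_notMem hs]
  have hmeets : MeetsStable (swap m r * swap s x * φ' * swap r s) (α' * swap r s) M ↔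
      MeetsStable φ' α' (insert r (insert s M)) := by
    refine meetsStable_join_iff (τ := swap s x) hm hαr hαs j1 hrs ?_ ?_
    · intro B h1 hrB hsB y hy
      refine swap_apply_of_ne_of_ne (ne_of_mem_of_not_mem hy hsB) fun h => hrB ?_
      exact SameCycle.mem_of_forall (hrx.symm) h1 (h ▸ hy)
    · intro B h1 hrB hsB y hy
      have hmB : m ∉ B := fun h => hrB (by
        have := h1 m h
        rwa [j1] at this)
      have hz := h1 y hy
      rw [show (swap m r * swap s x * φ' * swap r s) y =
        swap m r (swap s x (φ' (swap r s y))) from rfl, swap_apply_of_ne_of_ne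
        (ne_of_mem_of_not_mem hy hrB) (ne_of_mem_of_not_mem hy hsB)] at hz
      by_cases h3 : swap s x (φ' y) = m
      · rw [h3, swap_apply_left] at hz; exact absurd hz hrB
      by_cases h4 : swap s x (φ' y) = r
      · rw [h4, swap_apply_right] at hz; exact absurd hz hmB
      rw [swap_apply_of_ne_of_ne h3 h4] at hz
      by_cases h5 : φ' y = x
      · rw [h5, swap_apply_right] at hz; exact absurd hz hsB
      by_cases h6 : φ' y = s
      · have : y = s := φ'.injective (h6.trans hφs.symm)
        exact absurd (this ▸ hy) hsB
      rw [mul_apply]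
      rw [swap_apply_of_ne_of_ne h6 h5] at hz ⊢
      exact ⟨rfl, hz⟩
  have heuler : ∀ hm' : α' m = m,
      (2 * ((swap m r * swap s x * φ' * swap r s).numCycles +
        (swap m r * swap s x * φ' * swap r s * (α' * swap r s)).numCycles) =
        Fintype.card A + 3 * M.card ↔
      2 * (φ'.numCycles + (φ' * α').numCycles) =
        Fintype.card A + 3 * (insert r (insert s M)).card) := by
    intro h1
    have h2 : (φ' * α') m = m := by rw [mul_apply, h1, hφm]
    have h3 : (φ' * α') s = s := by rw [mul_apply, hαs, hφs]
    have h4 := numCycles_swap_mul (g := φ' * α') (x := s) (y := x)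
      (fun h => hxs (SameCycle.eq_of_left h h3).symm)
    have h5 : (swap s x * (φ' * α')) m = m := by
      rw [mul_apply, h2, swap_apply_of_ne_of_ne hms hxm.symm]
    have h6 := numCycles_swap_mul (g := swap s x * (φ' * α')) (x := m) (y := r)
      (fun h => hmr (SameCycle.eq_of_left h h5))
    rw [hσ, hcardM]
    omega
  have hfix := isMarkedMap_fixed_iff (M := M) hαr hαs hr hs hrs
  have hinv := isMarkedMap_invol_iff (α' := α') hαr hαs
  have hαs' : (α' * swap r s) s = r := by rw [mul_apply, swap_apply_right, hαr]
  set φ := swap m r * swap s x * φ' * swap r s with hφ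
  have hcyc : ∀ y, y ∈ φ.cyc m ∨ y ∈ φ.cyc s ↔ y = m ∨ y = s ∨ y ∈ φ'.cyc r := by
    intro y
    have := Set.ext_iff.1 j4 y
    simpa using this
  constructor
  · intro h
    have hf := hfix.1 h.fixed
    have hcm := h.root_card m hm
    refine ⟨hinv.1 h.invol, hf,
      hmeets.1 h.meets, (heuler ((hf m).2 (by simp [hm]))).1 h.euler, ?_, ?_⟩
    · intro m' hm'
      by_cases h2 : m' = r
      · subst h2
        simp only [mergeDeg, Function.update_self]
        omega
      by_cases h1 : m' = s
      · subst h1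
        simp only [mergeDeg, Function.update_self, Function.update_of_ne hrs.symm]
        rw [cyc_of_apply_eq hφs, Set.ncard_singleton]
      by_cases h3 : m' = m
      · subst h3
        simp only [mergeDeg, Function.update_self, Function.update_of_ne hms,
          Function.update_of_ne hmr]
        rw [cyc_of_apply_eq hφm, Set.ncard_singleton]
      have hm'' : m' ∈ M := by simpa [h1, h2] using hm'
      rw [← j6 m' (fun hc => h3 (h.eq_of_sameCycle hm hm'' hc).symm), h.root_card m' hm'']
      · simp only [mergeDeg, Function.update_of_ne h1, Function.update_of_ne h2,
          Function.update_of_ne h3]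
      -- A half-edge on the face across the edge would lie in the component of `m`, because `s` and
      -- `r` are the two arcs of that edge.
      · intro hc
        refine h3 (h.eq_of_connected hm hm'' fun B b1 b2 b3 => ?_).symm
        have hsB : s ∈ B := SameCycle.mem_of_forall (SameCycle.symm hc) b1 b3
        have hrB : r ∈ B := by
          have := b2 s hsB
          rwa [hαs'] at this
        exact apply_mem_of_forall_mem b1 (j1.symm ▸ hrB)
    · intro y hy
      have hym : ¬ (y ∈ φ.cyc m ∨ y ∈ φ.cyc s) := by
        rw [hcyc]
        rintro (h | h | h)
        · exact hy m (by simp [hm]) (h ▸ SameCycle.refl _ _)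
        · exact hy s (by simp) (h ▸ SameCycle.refl _ _)
        · exact hy r (by simp) h
      rw [not_or] at hym
      have hcx := j6 y hym.1 hym.2
      rw [← hcx]
      refine h.quad y fun m' hm' hc => hy m' (by simp [hm']) ?_
      have : m' ∈ φ.cyc y := SameCycle.symm hc
      rw [hcx] at this
      exact SameCycle.symm this
  · intro h
    have hf := h.fixed
    have hcr := h.root_card r (by simp)
    simp only [mergeDeg, Function.update_self] at hcr
    refine ⟨hinv.2 h.invol, hfix.2 hf, hmeets.2 h.meets,
      (heuler ((hf m).2 (by simp [hm]))).2 h.euler, ?_, ?_⟩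
    · intro m' hm'
      by_cases h3 : m' = m
      · subst h3; omega
      have h1 : m' ≠ s := fun he => hs (he ▸ hm')
      have h2 : m' ≠ r := fun he => hr (he ▸ hm')
      have hn : ¬ (m' ∈ φ.cyc m ∨ m' ∈ φ.cyc s) := by
        rw [hcyc]
        rintro (h | h | hc)
        · exact h3 h
        · exact h1 h
        · exact h2 (h.eq_of_sameCycle (by simp) (by simp [hm']) hc).symm
      rw [not_or] at hn
      rw [j6 m' hn.1 hn.2, h.root_card m' (by simp [hm'])]
      simp only [mergeDeg, Function.update_of_ne h1, Function.update_of_ne h2,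
          Function.update_of_ne h3]
    · intro y hy
      have hym := hy m hm
      by_cases hys : y ∈ φ.cyc s
      · rw [← SameCycle.cyc_eq hys, j2]
      have hcx := j6 y hym hys
      rw [hcx]
      refine h.quad y fun m' hm' hc => ?_
      have hc' : m' ∈ φ.cyc y := by rw [hcx]; exact SameCycle.symm hc
      have hr' : r ∈ φ.cyc m ∨ r ∈ φ.cyc s := (hcyc r).2 (Or.inr (Or.inr (self_mem_cyc _ _)))
      rcases Finset.mem_insert.1 hm' with rfl | hm'
      · rcases hr' with hr' | hr'
        · exact hym (SameCycle.trans hr' (SameCycle.symm hc'))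
        · exact hys (SameCycle.trans hr' (SameCycle.symm hc'))
      rcases Finset.mem_insert.1 hm' with rfl | hm'
      · exact hys (SameCycle.symm hc')
      exact hy m' hm' (SameCycle.symm hc')

end MarkedMap

/-! ### The recursion for labelled marked maps and its solution by generating series. -/

section Counting

variable {A : Type*} [Fintype A] [DecidableEq A]

open Classical in
/-- The number of families of maps on the set of arcs `A` with half-edges `M` and prescribed
degrees. -/
noncomputable def numMarkedMaps (M : Finset A) (ℓ : A → ℕ) : ℕ :=
  (Finset.univ.filter fun p : Perm A × Perm A => IsMarkedMap M ℓ p.1 p.2).card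

/-- The pairs of degrees of the two faces that arise when an edge is removed that has a face of
degree `l` on both sides. -/
def splits (l : ℕ) : Finset (ℕ × ℕ) :=
  if 2 ≤ l then Finset.HasAntidiagonal.antidiagonal (l - 2) else ∅

theorem mem_splits {l a b : ℕ} : (a, b) ∈ splits l ↔ a + b + 2 = l := by
  unfold splits
  split_ifs with h
  · rw [Finset.HasAntidiagonal.mem_antidiagonal]; omega
  · simp only [Finset.notMem_empty, false_iff]; omega

variable {M : Finset A} {ℓ : A → ℕ} {φ α φ' α' : Perm A} {m r s : A}

theorem IsMarkedMap.apply_notMem (h : IsMarkedMap M ℓ φ α) (hm : m ∈ M) (hl : ℓ m ≠ 0) :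
    φ m ∉ M ∧ α (φ m) ∉ M ∧ φ m ≠ α (φ m) := by
  have h1 : φ m ∉ M := by
    intro hmem
    have := h.eq_of_sameCycle hm hmem (SameCycle.apply_right (SameCycle.refl φ m))
    have hc := h.root_card m hm
    rw [cyc_of_apply_eq this.symm, Set.ncard_singleton] at hc
    omega
  refine ⟨h1, fun hmem => h1 ?_, fun he => h1 ((h.fixed _).1 he.symm)⟩
  have := (h.fixed _).2 hmem
  rw [h.invol] at this
  rw [← h.fixed]
  exact this.symm

/-- The removal of an edge between the root face and a quadrilateral can be undone: four steps from
`r` along the merged face lead to the arc `x` at which the quadrilateral has to be closed. -/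
theorem IsMarkedMap.merge_setup (h : IsMarkedMap M ℓ φ α) (hm : m ∈ M) (hr : r ∉ M) (hs : s ∉ M)
    (hφ : φ m = r) (hα : α r = s) (hrs : ¬ φ.SameCycle r s) :
    ∃ φ' : Perm A, φ' = swap s (swap m r (φ r)) * swap m r * φ * swap r s ∧
      φ = swap m r * swap s ((φ' ^ 4) r) * φ' * swap r s ∧
      φ' m = m ∧ φ' s = s ∧ ∀ i ∈ ({1, 2, 3} : Finset ℕ), (φ' ^ i) r ≠ r := by
  have hmr : m ≠ r := fun h => hr (h ▸ hm)
  have hms : m ≠ s := fun h => hs (h ▸ hm)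
  have hrs' : r ≠ s := fun h => hrs (h ▸ SameCycle.refl _ _)
  have hsame : φ.SameCycle m r := hφ ▸ SameCycle.apply_right (SameCycle.refl φ m)
  -- A half-edge on the face of `s` would be connected to `m`, hence equal to `m`, and `s` would lie
  -- on the root face.
  have hs4 : (φ.cyc s).ncard = 4 := by
    refine h.quad s fun m' hm' hc => ?_
    have : m = m' := h.eq_of_connected hm hm' fun B b1 b2 b3 => by
      have hsB : s ∈ B := SameCycle.mem_of_forall hc b1 b3
      have hrB : r ∈ B := by
        have := b2 s hsB
        rwa [← hα, h.invol] at this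
      exact apply_mem_of_forall_mem b1 (hφ.symm ▸ hrB)
    subst this
    exact hrs (hsame.symm.trans hc)
  have hpow : ∀ i : ℕ, φ.SameCycle s ((φ ^ i) s) := fun i => ⟨i, by simp⟩
  have hpr : ∀ i : ℕ, (φ ^ i) s ≠ r := fun i he => hrs (SameCycle.symm (he ▸ hpow i))
  have hpm : ∀ i : ℕ, (φ ^ i) s ≠ m := fun i he => hrs (hsame.symm.trans
    (SameCycle.symm (he ▸ hpow i)))
  have hd : ∀ i, ¬ 4 ∣ i → (φ ^ i) s ≠ s := fun i hi he => hi (by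
    rw [pow_apply_eq_self_iff, hs4] at he; exact he)
  have h4 : (φ ^ 4) s = s := by rw [pow_apply_eq_self_iff, hs4]
  have hstep : ∀ i : ℕ, φ ((φ ^ i) s) = (φ ^ (i + 1)) s := fun i => by
    rw [pow_succ', mul_apply]
  have hφr : φ r ≠ r := fun he => hmr (φ.injective (hφ.trans he.symm))
  -- The successor of `r` on the root face once `m` is taken out; if `r` is the only arc of that
  -- face besides `m`, it is `r` itself.
  set x := swap m r (φ r) with hx
  have hxr : φ.SameCycle r x := by
    by_cases hc : φ r = m
    · rw [hx, hc, swap_apply_left]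
    · rw [hx, swap_apply_of_ne_of_ne hc hφr]; exact SameCycle.apply_right (SameCycle.refl _ _)
  have hxs : x ≠ s := fun he => hrs (he ▸ hxr)
  have hpx : ∀ i : ℕ, (φ ^ i) s ≠ x := fun i he => hrs (hxr.trans (SameCycle.symm (he ▸ hpow i)))
  have hxm : x ≠ m := by
    intro he
    have : swap m r (φ r) = m := he
    rw [swap_apply_eq_iff, swap_apply_left] at this
    exact hφr this
  set φ' := swap s x * swap m r * φ * swap r s with hφ'
  have happ : ∀ y, φ' y = swap s x (swap m r (φ (swap r s y))) := fun y => rfl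
  have b1 : φ' r = (φ ^ 1) s := by
    rw [happ, swap_apply_left, show φ s = (φ ^ 1) s by rw [pow_one],
      swap_apply_of_ne_of_ne (hpm 1) (hpr 1), swap_apply_of_ne_of_ne (hd 1 (by norm_num)) (hpx 1)]
  have b2 : φ' ((φ ^ 1) s) = (φ ^ 2) s := by
    rw [happ, swap_apply_of_ne_of_ne (hpr 1) (hd 1 (by norm_num)), hstep,
      swap_apply_of_ne_of_ne (hpm 2) (hpr 2), swap_apply_of_ne_of_ne (hd 2 (by norm_num)) (hpx 2)]
  have b3 : φ' ((φ ^ 2) s) = (φ ^ 3) s := by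
    rw [happ, swap_apply_of_ne_of_ne (hpr 2) (hd 2 (by norm_num)), hstep,
      swap_apply_of_ne_of_ne (hpm 3) (hpr 3), swap_apply_of_ne_of_ne (hd 3 (by norm_num)) (hpx 3)]
  have b4 : φ' ((φ ^ 3) s) = x := by
    rw [happ, swap_apply_of_ne_of_ne (hpr 3) (hd 3 (by norm_num)), hstep, h4,
      swap_apply_of_ne_of_ne hms.symm hrs'.symm, swap_apply_left]
  have c2 : (φ' ^ 2) r = (φ ^ 2) s := by rw [pow_two, mul_apply, b1, b2]
  have c3 : (φ' ^ 3) r = (φ ^ 3) s := by rw [pow_succ', mul_apply, c2, b3]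
  have c4 : (φ' ^ 4) r = x := by rw [pow_succ', mul_apply, c3, b4]
  refine ⟨φ', rfl, ?_, ?_, ?_, ?_⟩
  · rw [c4, hφ']
    simp [mul_assoc]
  · rw [happ, swap_apply_of_ne_of_ne hmr hms, hφ, swap_apply_right,
      swap_apply_of_ne_of_ne hms hxm.symm]
  · rw [happ, swap_apply_right, ← hx, swap_apply_right]
  · intro i hi
    simp only [Finset.mem_insert, Finset.mem_singleton] at hi
    rcases hi with rfl | rfl | rfl
    · rw [pow_one, b1]; exact hpr 1
    · rw [c2]; exact hpr 2
    · rw [c3]; exact hpr 3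

theorem mul_swap_fixed_of_invol (hα : ∀ x, α (α x) = x) (hr : α r = s) :
    (α * swap r s) r = r ∧ (α * swap r s) s = s := by
  have : α s = r := by rw [← hr, hα]
  simp [this, hr]

open Classical in
-- The operation on pairs of permutations is its own inverse. Different `(a, b)` give disjoint sets,
-- as the degrees can be read off from the cycles of `r` and `s`.
theorem card_split_eq (hm : m ∈ M) (hr : r ∉ M) (hs : s ∉ M) (hrs : r ≠ s) :
    (Finset.univ.filter fun p : Perm A × Perm A => IsMarkedMap M ℓ p.1 p.2 ∧
      p.1 m = r ∧ p.2 r = s ∧ p.1.SameCycle r s).card =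
    ∑ ab ∈ splits (ℓ m),
      numMarkedMaps (insert r (insert s M)) (splitDeg ℓ m r s ab.1 ab.2) := by
  have hmr : m ≠ r := fun h => hr (h ▸ hm)
  have hms : m ≠ s := fun h => hs (h ▸ hm)
  have hinv : ∀ f : Perm A, swap m r * (swap m r * f * swap r s) * swap r s = f := fun f => by
    simp [mul_assoc]
  have hinv' : ∀ f : Perm A, f * swap r s * swap r s = f := fun f => by simp [mul_assoc]
  unfold numMarkedMaps
  rw [← Finset.card_biUnion]
  · refine Finset.card_bij' (fun p _ => (swap m r * p.1 * swap r s, p.2 * swap r s))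
      (fun p _ => (swap m r * p.1 * swap r s, p.2 * swap r s)) ?_ ?_ ?_ ?_
    · rintro ⟨φ, α⟩ hp
      simp only [Finset.mem_filter, Finset.mem_univ, true_and, Finset.mem_biUnion] at hp ⊢
      obtain ⟨hv, h1, h2, h3⟩ := hp
      obtain ⟨f1, f2⟩ := mul_swap_fixed_of_invol hv.invol h2
      have hφm : (φ * swap r s) m = r := by
        rw [mul_apply, swap_apply_of_ne_of_ne hmr hms, h1]
      have hφm' : (swap m r * φ * swap r s) m = m := by
        rw [mul_assoc, mul_apply, hφm, swap_apply_right]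
      have hn : ¬ (swap m r * φ * swap r s).SameCycle r s := by
        -- If `r` and `s` stayed on one cycle, putting `m` back would leave them on one cycle of `φ
        -- * swap r s`; but that transposition cuts their common cycle.
        intro hc
        have hne := not_sameCycle_mul_swap h3 hrs
        have hmn : ¬ (swap m r * φ * swap r s).SameCycle m r :=
          fun h => hmr (SameCycle.eq_of_left h hφm')
        have he := cyc_swap_mul hmn
        rw [show swap m r * (swap m r * φ * swap r s) = φ * swap r s by simp [mul_assoc]] at he
        have hr' : r ∈ (φ * swap r s).cyc m := by rw [he]; exact Or.inr (self_mem_cyc _ _)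
        have hs' : s ∈ (φ * swap r s).cyc m := by rw [he]; exact Or.inr hc
        exact hne (SameCycle.trans (SameCycle.symm hr') hs')
      rw [← hinv φ, ← hinv' α] at hv
      obtain ⟨a, b, hab, hv'⟩ := (isMarkedMap_split_iff hm hr hs hrs hφm' hn f1 f2).1 hv
      exact ⟨(a, b), mem_splits.2 hab, hv'⟩
    · rintro ⟨φ', α'⟩ hp
      simp only [Finset.mem_filter, Finset.mem_univ, true_and, Finset.mem_biUnion] at hp ⊢
      obtain ⟨⟨a, b⟩, hab, hv⟩ := hp
      have f1 := (hv.fixed r).2 (by simp)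
      have f2 := (hv.fixed s).2 (by simp)
      have hφrs : ¬ φ'.SameCycle r s := fun hc =>
        hrs (hv.eq_of_sameCycle (by simp) (by simp) hc)
      have hc := hv.root_card m (by simp [hm])
      have hφm : φ' m = m := by
        simp only [splitDeg, Function.update_of_ne hms, Function.update_of_ne hmr,
          Function.update_self, zero_add, Set.ncard_eq_one] at hc
        obtain ⟨y, hy⟩ := hc
        have h1 : m ∈ φ'.cyc m := self_mem_cyc _ _
        have h2 : φ' m ∈ φ'.cyc m := apply_mem_cyc h1
        rw [hy] at h1 h2
        exact h2.trans h1.symm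
      obtain ⟨j1, j2, -, -, -⟩ := cyc_join hφm hmr hms hφrs
      refine ⟨(isMarkedMap_split_iff hm hr hs hrs hφm hφrs f1 f2).2
        ⟨a, b, mem_splits.1 hab, hv⟩, j1, ?_, ?_⟩
      · rw [mul_apply, swap_apply_left, f2]
      · have h1 : r ∈ (swap m r * φ' * swap r s).cyc m := by
          rw [j2]; exact Or.inr (Or.inl (self_mem_cyc _ _))
        have h2 : s ∈ (swap m r * φ' * swap r s).cyc m := by
          rw [j2]; exact Or.inr (Or.inr (self_mem_cyc _ _))
        exact SameCycle.trans (SameCycle.symm h1) h2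
    · rintro ⟨φ, α⟩ -
      exact Prod.ext (hinv φ) (hinv' α)
    · rintro ⟨φ, α⟩ -
      exact Prod.ext (hinv φ) (hinv' α)
  · rintro ⟨a, b⟩ - ⟨a', b'⟩ - hne
    change _root_.Disjoint _ _
    rw [Finset.disjoint_left]
    rintro ⟨φ, α⟩ h1 h2
    simp only [Finset.mem_filter, Finset.mem_univ, true_and] at h1 h2
    apply hne
    have a1 := h1.root_card r (by simp)
    have a2 := h2.root_card r (by simp)
    have b1 := h1.root_card s (by simp)
    have b2 := h2.root_card s (by simp)
    simp only [splitDeg, Function.update_self, Function.update_of_ne hrs] at a1 a2 b1 b2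
    exact Prod.ext (by dsimp only; omega) (by dsimp only; omega)

open Classical in
theorem card_merge_eq (hm : m ∈ M) (hr : r ∉ M) (hs : s ∉ M) (hrs : r ≠ s) (hl : ℓ m ≠ 0) :
    (Finset.univ.filter fun p : Perm A × Perm A => IsMarkedMap M ℓ p.1 p.2 ∧
      p.1 m = r ∧ p.2 r = s ∧ ¬ p.1.SameCycle r s).card =
      numMarkedMaps (insert r (insert s M)) (mergeDeg ℓ m r s) := by
  have hmr : m ≠ r := fun h => hr (h ▸ hm)
  have hms : m ≠ s := fun h => hs (h ▸ hm)
  have hinv' : ∀ f : Perm A, f * swap r s * swap r s = f := fun f => by simp [mul_assoc]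
  have hback : ∀ φ' α', IsMarkedMap (insert r (insert s M)) (mergeDeg ℓ m r s) φ' α' →
      φ' m = m ∧ φ' s = s ∧ (∀ i ∈ ({1, 2, 3} : Finset ℕ), (φ' ^ i) r ≠ r) := by
    intro φ' α' hv
    have hc := hv.root_card m (by simp [hm])
    have hcs := hv.root_card s (by simp)
    have hcr := hv.root_card r (by simp)
    simp only [mergeDeg, Function.update_of_ne hms, Function.update_of_ne hmr,
      Function.update_of_ne hrs.symm, Function.update_self, zero_add] at hc hcs hcr
    have key : ∀ z, (φ'.cyc z).ncard = 1 → φ' z = z := fun z hz => by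
      have := (pow_apply_eq_self_iff (f := φ') (x := z) (n := 1)).2 (by rw [hz])
      rwa [pow_one] at this
    -- The merged face has `ℓ m + 2` arcs besides `r`, and `ℓ m ≠ 0`: its cycle has length at least
    -- four, so a quadrilateral can be cut off.
    refine ⟨key m hc, key s hcs, fun i hi => ?_⟩
    rw [Ne, pow_apply_eq_self_iff, hcr]
    intro hdvd
    have h0 : 0 < i ∧ i < 4 := by
      simp only [Finset.mem_insert, Finset.mem_singleton] at hi; omega
    have := Nat.le_of_dvd h0.1 hdvd
    omega
  refine Finset.card_bij'
    (fun p _ => (swap s (swap m r (p.1 r)) * swap m r * p.1 * swap r s, p.2 * swap r s))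
    (fun p _ => (swap m r * swap s ((p.1 ^ 4) r) * p.1 * swap r s, p.2 * swap r s)) ?_ ?_ ?_ ?_
  · rintro ⟨φ, α⟩ hp
    simp only [Finset.mem_filter, Finset.mem_univ, true_and] at hp ⊢
    obtain ⟨hv, h1, h2, h3⟩ := hp
    obtain ⟨f1, f2⟩ := mul_swap_fixed_of_invol hv.invol h2
    obtain ⟨φ', e1, e2, e3, e4, e5⟩ := hv.merge_setup hm hr hs h1 h2 h3
    rw [← e1]
    rw [e2, ← hinv' α] at hv
    exact (isMarkedMap_merge_iff hm hr hs hrs e3 e4 rfl e5 f1 f2).1 hv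
  · rintro ⟨φ', α'⟩ hp
    simp only [Finset.mem_filter, Finset.mem_univ, true_and] at hp ⊢
    have f1 := (hp.fixed r).2 (by simp)
    have f2 := (hp.fixed s).2 (by simp)
    obtain ⟨e3, e4, e5⟩ := hback φ' α' hp
    obtain ⟨j1, -, j3, -⟩ := cyc_cut e3 e4 hmr hms hrs rfl e5
    refine ⟨(isMarkedMap_merge_iff hm hr hs hrs e3 e4 rfl e5 f1 f2).2 hp, j1, ?_, fun hc => ?_⟩
    · rw [mul_apply, swap_apply_left, f2]
    · have hc' : (swap m r * swap s ((φ' ^ 4) r) * φ' * swap r s).SameCycle m r :=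
        (SameCycle.apply_right (SameCycle.refl _ m)).trans (Eq.sameCycle j1 _)
      exact j3 (hc'.trans hc)
  · rintro ⟨φ, α⟩ hp
    simp only [Finset.mem_filter, Finset.mem_univ, true_and] at hp ⊢
    obtain ⟨hv, h1, h2, h3⟩ := hp
    obtain ⟨φ', e1, e2, -⟩ := hv.merge_setup hm hr hs h1 h2 h3
    rw [← e1]
    exact Prod.ext e2.symm (hinv' α)
  · rintro ⟨φ', α'⟩ hp
    simp only [Finset.mem_filter, Finset.mem_univ, true_and] at hp ⊢
    obtain ⟨e3, e4, e5⟩ := hback φ' α' hp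
    refine Prod.ext ?_ (hinv' α')
    have hrx : φ'.SameCycle r ((φ' ^ 4) r) := ⟨4, by rfl⟩
    have hxm : (φ' ^ 4) r ≠ m := fun h => hmr (SameCycle.eq_of_right (h ▸ hrx) e3).symm
    have hxs : (φ' ^ 4) r ≠ s := fun h => hrs (SameCycle.eq_of_right (h ▸ hrx) e4)
    have : swap m r ((swap m r * swap s ((φ' ^ 4) r) * φ' * swap r s) r) = (φ' ^ 4) r := by
      rw [show (swap m r * swap s ((φ' ^ 4) r) * φ' * swap r s) r =
        swap m r (swap s ((φ' ^ 4) r) (φ' (swap r s r))) from rfl, swap_apply_left, e4,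
        swap_apply_left, swap_apply_self]
    simp only [this]
    simp [mul_assoc]

/-- The maps are sorted by the arcs `r = φ m` and `s = α r` of the edge that follows the half-edge,
and then by whether both sides of this edge lie on the same face. -/
theorem numMarkedMaps_eq_sum (hm : m ∈ M) (hl : ℓ m ≠ 0) :
    numMarkedMaps M ℓ = ∑ rs ∈ Mᶜ.offDiag,
      (∑ ab ∈ splits (ℓ m),
        numMarkedMaps (insert rs.1 (insert rs.2 M)) (splitDeg ℓ m rs.1 rs.2 ab.1 ab.2) +
      numMarkedMaps (insert rs.1 (insert rs.2 M)) (mergeDeg ℓ m rs.1 rs.2)) := by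
  classical
  conv_lhs => unfold numMarkedMaps
  rw [Finset.card_eq_sum_card_fiberwise (f := fun p => (p.1 m, p.2 (p.1 m))) (t := Mᶜ.offDiag)]
  · refine Finset.sum_congr rfl ?_
    rintro ⟨r, s⟩ hrs
    simp only [Finset.mem_offDiag, Finset.mem_compl] at hrs
    rw [← card_split_eq hm hrs.1 hrs.2.1 hrs.2.2, ← card_merge_eq hm hrs.1 hrs.2.1 hrs.2.2 hl,
      ← Finset.card_filter_add_card_filter_not (fun p : Perm A × Perm A => p.1.SameCycle r s)]
    simp only [Finset.filter_filter]
    congr 2 <;> refine Finset.filter_congr fun p _ => ?_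
    · constructor
      · rintro ⟨⟨h1, h2⟩, h3⟩
        obtain ⟨h2, h4⟩ := Prod.ext_iff.1 h2
        dsimp only at h2 h4
        exact ⟨h1, h2, h2 ▸ h4, h3⟩
      · rintro ⟨h1, h2, h3, h4⟩
        exact ⟨⟨h1, by rw [h2, h3]⟩, h4⟩
    · constructor
      · rintro ⟨⟨h1, h2⟩, h3⟩
        obtain ⟨h2, h4⟩ := Prod.ext_iff.1 h2
        dsimp only at h2 h4
        exact ⟨h1, h2, h2 ▸ h4, h3⟩
      · rintro ⟨h1, h2, h3, h4⟩
        exact ⟨⟨h1, by rw [h2, h3]⟩, h4⟩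
  · rintro ⟨φ, α⟩ hp
    have hv : IsMarkedMap M ℓ φ α := by simpa using hp
    obtain ⟨h1, h2, h3⟩ := hv.apply_notMem hm hl
    simpa [h1, h2] using h3

theorem numCycles_one : (1 : Perm A).numCycles = Fintype.card A := by
  rw [← Nat.card_eq_fintype_card]
  refine (Nat.card_eq_of_bijective (Quotient.mk (SameCycle.setoid (1 : Perm A)))
    ⟨fun a b hab => ?_, Quotient.mk_surjective⟩).symm
  have : (1 : Perm A).SameCycle a b := Quotient.exact hab
  simpa using this

/-- With degree zero every half-edge is a whole component. Since each component has a half-edge,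
there is no room for other arcs. -/
theorem numMarkedMaps_of_zero (hl : ∀ m ∈ M, ℓ m = 0) :
    numMarkedMaps M ℓ = if Mᶜ.card = 0 then 1 else 0 := by
  classical
  have hfix : ∀ φ α, IsMarkedMap M ℓ φ α → ∀ m ∈ M, φ m = m := by
    intro φ α h m hm
    have hc := h.root_card m hm
    rw [hl m hm] at hc
    have := (pow_apply_eq_self_iff (f := φ) (x := m) (n := 1)).2 (by rw [hc])
    rwa [pow_one] at this
  unfold numMarkedMaps
  split_ifs with h0
  · have hM : ∀ x, x ∈ M := fun x => by
      rw [Finset.card_eq_zero] at h0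
      by_contra hx
      have : x ∈ Mᶜ := Finset.mem_compl.2 hx
      rw [h0] at this
      simp at this
    rw [Finset.card_eq_one]
    refine ⟨(1, 1), ?_⟩
    ext ⟨φ, α⟩
    simp only [Finset.mem_filter, Finset.mem_univ, true_and, Finset.mem_singleton]
    constructor
    · intro h
      exact Prod.ext (Equiv.ext fun x => hfix φ α h x (hM x))
        (Equiv.ext fun x => (h.fixed x).2 (hM x))
    · rintro h
      obtain ⟨rfl, rfl⟩ := Prod.ext_iff.1 h
      have hMu : M = Finset.univ := Finset.eq_univ_iff_forall.2 hM
      refine ⟨fun _ => rfl, fun x => by simp [hM], fun B _ _ hB => ?_, ?_, ?_, ?_⟩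
      · obtain ⟨x, hx⟩ := hB
        exact ⟨x, hM x, hx⟩
      · dsimp only
        rw [mul_one, numCycles_one, hMu, Finset.card_univ]
        omega
      · intro m hm
        rw [cyc_of_apply_eq rfl, Set.ncard_singleton, hl m hm]
      · intro x hx
        exact absurd (SameCycle.refl _ _) (hx x (hM x))
  · rw [Finset.card_eq_zero, Finset.filter_eq_empty_iff]
    rintro ⟨φ, α⟩ - h
    dsimp only at h
    obtain ⟨x, hx⟩ := Finset.card_pos.1 (Nat.pos_of_ne_zero h0)
    obtain ⟨m, hm, hmB⟩ := h.meets {x | x ∉ M} (fun x hx hmem => hx (by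
        have := hfix φ α h _ hmem
        rw [φ.injective this] at hmem
        exact hmem)) (fun x hx hmem => hx (by
        have := (h.fixed _).2 hmem
        rw [α.injective this] at hmem
        exact hmem)) ⟨x, by simpa using hx⟩
    exact hmB hm

/-- The labelled maps are counted by every family of power series that solves the recursion of the
removal of a root edge. -/
theorem numMarkedMaps_eq (G : ℕ → PowerSeries ℚ) (hG0 : G 0 = 1)
    (hG : ∀ l, l ≠ 0 → G l = PowerSeries.X ^ 2 *
      (∑ ab ∈ splits l, G ab.1 * G ab.2 + G (l + 2))) (M : Finset A) (ℓ : A → ℕ) :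
    (numMarkedMaps M ℓ : ℚ) =
      (Mᶜ.card.factorial : ℚ) * PowerSeries.coeff Mᶜ.card (∏ m ∈ M, G (ℓ m)) := by
  induction hn : Mᶜ.card using Nat.strong_induction_on generalizing M ℓ with
  | _ n ih =>
  by_cases hl : ∀ m ∈ M, ℓ m = 0
  · rw [numMarkedMaps_of_zero hl, Finset.prod_congr rfl (fun m hm => by rw [hl m hm, hG0]),
      Finset.prod_const_one, PowerSeries.coeff_one, hn]
    split_ifs with h
    · simp [h]
    · simp
  push Not at hl
  obtain ⟨m, hm, hl⟩ := hl
  have hMprod : ∀ ℓ' : A → ℕ, ∏ m ∈ M, G (ℓ' m) = G (ℓ' m) * ∏ x ∈ M.erase m, G (ℓ' x) :=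
    fun ℓ' => (Finset.mul_prod_erase M (fun x => G (ℓ' x)) hm).symm
  set P := ∏ x ∈ M.erase m, G (ℓ x) with hP
  set H := (∑ ab ∈ splits (ℓ m), G ab.1 * G ab.2 + G (ℓ m + 2)) * P with hH
  -- The contribution does not depend on `(r, s)`: isolated half-edges have weight `G 0 = 1`, so
  -- only the factors of the new root faces and those of `M.erase m` remain.
  have hterm : ∀ rs ∈ Mᶜ.offDiag, 2 ≤ n ∧
      ((∑ ab ∈ splits (ℓ m),
        numMarkedMaps (insert rs.1 (insert rs.2 M)) (splitDeg ℓ m rs.1 rs.2 ab.1 ab.2) +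
      numMarkedMaps (insert rs.1 (insert rs.2 M)) (mergeDeg ℓ m rs.1 rs.2) : ℕ) : ℚ) =
      ((n - 2).factorial : ℚ) * PowerSeries.coeff (n - 2) H := by
    rintro ⟨r, s⟩ hrs
    simp only [Finset.mem_offDiag, Finset.mem_compl] at hrs
    obtain ⟨hr, hs, hrs⟩ := hrs
    have hmr : m ≠ r := fun h => hr (h ▸ hm)
    have hms : m ≠ s := fun h => hs (h ▸ hm)
    have hc : (insert r (insert s M))ᶜ.card + 2 = n := by
      rw [← hn, Finset.compl_insert, Finset.compl_insert, Finset.card_erase_of_mem,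
        Finset.card_erase_of_mem]
      · have : 2 ≤ Mᶜ.card := by
          have h1 : ({r, s} : Finset A) ⊆ Mᶜ := by
            intro z hz
            simp only [Finset.mem_insert, Finset.mem_singleton] at hz
            rcases hz with rfl | rfl <;> simpa
          have := Finset.card_le_card h1
          rwa [Finset.card_pair hrs] at this
        omega
      · simpa using hs
      · simp [hrs, hr]
    have hc' : (insert r (insert s M))ᶜ.card = n - 2 := by omega
    refine ⟨by omega, ?_⟩
    have hprod : ∀ ℓ' : A → ℕ, ℓ' m = 0 → (∀ x ∈ M, x ≠ m → ℓ' x = ℓ x) →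
        ∏ x ∈ insert r (insert s M), G (ℓ' x) = G (ℓ' r) * G (ℓ' s) * P := by
      intro ℓ' h1 h2
      rw [Finset.prod_insert (by simp [hrs, hr]), Finset.prod_insert hs, hMprod ℓ', h1, hG0,
        one_mul, hP, mul_assoc]
      congr 2
      refine Finset.prod_congr rfl fun x hx => ?_
      rw [h2 x (Finset.mem_of_mem_erase hx) (Finset.ne_of_mem_erase hx)]
    push_cast
    have e1 : ∀ ab ∈ splits (ℓ m), (numMarkedMaps (insert r (insert s M))
        (splitDeg ℓ m r s ab.1 ab.2) : ℚ) =
        ((n - 2).factorial : ℚ) * PowerSeries.coeff (n - 2) (G ab.1 * G ab.2 * P) := by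
      rintro ⟨a, b⟩ -
      rw [ih (n - 2) (by omega) _ _ hc', hprod]
      · simp only [splitDeg, Function.update_self, Function.update_of_ne hrs]
        rw [mul_comm (G b)]
      · simp only [splitDeg, Function.update_self, Function.update_of_ne hmr,
          Function.update_of_ne hms]
      · intro x hx hxm
        have hxr : x ≠ r := fun h => hr (h ▸ hx)
        have hxs : x ≠ s := fun h => hs (h ▸ hx)
        simp only [splitDeg, Function.update_of_ne hxr, Function.update_of_ne hxs,
          Function.update_of_ne hxm]
    have e2 : (numMarkedMaps (insert r (insert s M)) (mergeDeg ℓ m r s) : ℚ) =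
        ((n - 2).factorial : ℚ) * PowerSeries.coeff (n - 2) (G (ℓ m + 2) * P) := by
      rw [ih (n - 2) (by omega) _ _ hc', hprod]
      · simp only [mergeDeg, Function.update_self, Function.update_of_ne hrs.symm, hG0, mul_one]
      · simp only [mergeDeg, Function.update_self, Function.update_of_ne hmr,
          Function.update_of_ne hms]
      · intro x hx hxm
        have hxr : x ≠ r := fun h => hr (h ▸ hx)
        have hxs : x ≠ s := fun h => hs (h ▸ hx)
        simp only [mergeDeg, Function.update_of_ne hxr, Function.update_of_ne hxs,
          Function.update_of_ne hxm]
    rw [Finset.sum_congr rfl e1, e2, ← Finset.mul_sum, ← mul_add, ← map_sum, ← map_add, hH,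
      add_mul, Finset.sum_mul]
  rw [numMarkedMaps_eq_sum hm hl, Nat.cast_sum, Finset.sum_congr rfl fun rs h => (hterm rs h).2,
    Finset.sum_const, Finset.offDiag_card, hn, nsmul_eq_mul, hMprod ℓ, hG _ hl, mul_assoc, ← hP,
    ← hH]
  rcases lt_or_ge n 2 with h2 | h2
  · have h0 : PowerSeries.coeff n (PowerSeries.X ^ 2 * H) = 0 := by
      rw [PowerSeries.coeff_X_pow_mul', if_neg (by omega)]
    rw [h0]
    interval_cases n <;> simp
  · obtain ⟨k, rfl⟩ := Nat.exists_eq_add_of_le' h2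
    -- The `n * (n - 1)` ordered pairs `(r, s)` turn `(n - 2)!` into `n!`, and `X ^ 2` accounts for
    -- the two arcs.
    rw [Nat.add_sub_cancel, PowerSeries.coeff_X_pow_mul, Nat.factorial_succ, Nat.factorial_succ,
      show (k + 2) * (k + 2) - (k + 2) = (k + 2) * (k + 1) by
        rw [show (k + 2) * (k + 2) = (k + 2) * (k + 1) + (k + 2) by ring, Nat.add_sub_cancel]]
    push_cast
    ring

end Counting

/-! ### The explicit solution of the recursion and its coefficients. -/

section Series

open PowerSeries

/-- The Catalan series with weight three on every edge. -/
noncomputable def tripleCatalanSeries : PowerSeries ℚ :=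
  PowerSeries.mk fun n => (3 : ℚ) ^ n * (catalan n : ℚ)

theorem eq_one_add_iff_coeff (S : PowerSeries ℚ) :
    S = 1 + 3 * X * S ^ 2 ↔ coeff 0 S = 1 ∧ ∀ n, coeff (n + 1) S =
      3 * ∑ ij ∈ Finset.HasAntidiagonal.antidiagonal n, coeff ij.1 S * coeff ij.2 S := by
  have h3 : (3 : PowerSeries ℚ) = C 3 := (map_ofNat C 3).symm
  have hs : ∀ n, coeff (n + 1) (1 + 3 * X * S ^ 2) =
      3 * ∑ ij ∈ Finset.HasAntidiagonal.antidiagonal n, coeff ij.1 S * coeff ij.2 S := by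
    intro n
    rw [map_add, coeff_one, if_neg (by omega), zero_add, h3, mul_assoc, coeff_C_mul,
      coeff_succ_X_mul, pow_two, coeff_mul]
  have h0 : coeff 0 (1 + 3 * X * S ^ 2) = 1 := by
    rw [map_add, coeff_one, if_pos rfl, h3, mul_assoc, coeff_C_mul, coeff_zero_X_mul, mul_zero,
      add_zero]
  constructor
  · intro h
    exact ⟨(congrArg (coeff 0) h).trans h0, fun n => (congrArg (coeff (n + 1)) h).trans (hs n)⟩
  · rintro ⟨h1, h2⟩
    ext n
    cases n with
    | zero => rw [h1, h0]
    | succ n => rw [h2, hs]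

theorem tripleCatalanSeries_eq :
    tripleCatalanSeries = 1 + 3 * X * tripleCatalanSeries ^ 2 := by
  rw [eq_one_add_iff_coeff]
  refine ⟨by simp [tripleCatalanSeries], fun n => ?_⟩
  simp only [tripleCatalanSeries, coeff_mk]
  rw [catalan_succ', Nat.cast_sum, pow_succ', mul_assoc, Finset.mul_sum]
  congr 1
  refine Finset.sum_congr rfl fun ij hij => ?_
  rw [Finset.HasAntidiagonal.mem_antidiagonal] at hij
  rw [← hij, pow_add]
  push_cast
  ring

theorem eq_one_add_iff_eq_tripleCatalanSeries (S : PowerSeries ℚ) :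
    S = 1 + 3 * X * S ^ 2 ↔ S = tripleCatalanSeries := by
  refine ⟨fun h => ?_, fun h => h ▸ tripleCatalanSeries_eq⟩
  obtain ⟨h1, h2⟩ := (eq_one_add_iff_coeff S).1 h
  obtain ⟨h3, h4⟩ := (eq_one_add_iff_coeff _).1 tripleCatalanSeries_eq
  ext n
  induction n using Nat.strong_induction_on with
  | _ n ih =>
  cases n with
  | zero => rw [h1, h3]
  | succ n =>
    rw [h2, h4]
    congr 1
    refine Finset.sum_congr rfl fun ij hij => ?_
    rw [Finset.HasAntidiagonal.mem_antidiagonal] at hij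
    rw [ih ij.1 (by omega), ih ij.2 (by omega)]

/-- The convolution for `catalan (q + 2)` with its first term removed. -/
theorem sum_catalan_succ_mul_catalan (q : ℕ) :
    ∑ ij ∈ Finset.HasAntidiagonal.antidiagonal q,
      (catalan (ij.1 + 1) : ℚ) * (catalan ij.2 : ℚ) = catalan (q + 2) - catalan (q + 1) := by
  have h := catalan_succ' (q + 1)
  rw [Finset.Nat.sum_antidiagonal_succ, catalan_zero, one_mul] at h
  rw [h]
  push_cast
  ring

theorem sum_catalan_succ_mul_catalan_succ (q : ℕ) :
    ∑ ij ∈ Finset.HasAntidiagonal.antidiagonal q,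
      (catalan (ij.1 + 1) : ℚ) * (catalan (ij.2 + 1) : ℚ) =
      catalan (q + 3) - 2 * catalan (q + 2) := by
  have h := sum_catalan_succ_mul_catalan (q + 1)
  rw [Finset.Nat.sum_antidiagonal_succ', catalan_zero] at h
  push_cast at h
  linear_combination h

/-- The series `C_p T ^ p - (C_{p+1} - C_p) z T ^ (p + 2)` of the quadrangulations with a boundary of
length `2 * p`, where `C_p` is a Catalan number. -/
noncomputable def boundarySeries (Z T : PowerSeries ℚ) (p : ℕ) : PowerSeries ℚ :=
  C (catalan p : ℚ) * T ^ p - C ((catalan (p + 1) : ℚ) - catalan p) * Z * T ^ (p + 2)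

/-- The product of two boundary series is a combination of `T ^ q`, `Z * T ^ (q + 2)` and `Z ^ 2 * T
^ (q + 4)`, with coefficients that are shifted Catalan convolutions. Once these are summed, the
claim is a multiple of the equation for `T`. -/
theorem boundarySeries_succ {Z T : PowerSeries ℚ} (hT : T = 1 + 3 * Z * T ^ 2) (q : ℕ) :
    boundarySeries Z T (q + 1) =
      ∑ ij ∈ Finset.HasAntidiagonal.antidiagonal q,
        boundarySeries Z T ij.1 * boundarySeries Z T ij.2 + Z * boundarySeries Z T (q + 2) := by
  set c : ℕ → PowerSeries ℚ := fun p => C (catalan p : ℚ) with hc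
  have hF : ∀ p, boundarySeries Z T p = c p * T ^ p - (c (p + 1) - c p) * Z * T ^ (p + 2) :=
    fun p => by rw [boundarySeries, map_sub]
  have hC : ∑ ij ∈ Finset.HasAntidiagonal.antidiagonal q, c ij.1 * c ij.2 = c (q + 1) := by
    simp only [hc, ← map_mul, ← map_sum]
    rw [catalan_succ']
    push_cast
    rfl
  have hCs : ∑ ij ∈ Finset.HasAntidiagonal.antidiagonal q, c (ij.1 + 1) * c ij.2 =
      c (q + 2) - c (q + 1) := by
    simp only [hc, ← map_mul, ← map_sum, ← map_sub]
    rw [sum_catalan_succ_mul_catalan]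
  have hCs' : ∑ ij ∈ Finset.HasAntidiagonal.antidiagonal q, c ij.1 * c (ij.2 + 1) =
      c (q + 2) - c (q + 1) := by
    rw [← hCs, ← Finset.Nat.sum_antidiagonal_swap]
    exact Finset.sum_congr rfl fun ij _ => mul_comm _ _
  have hCss : ∑ ij ∈ Finset.HasAntidiagonal.antidiagonal q, c (ij.1 + 1) * c (ij.2 + 1) =
      c (q + 3) - 2 * c (q + 2) := by
    have h2 : (2 : PowerSeries ℚ) = C 2 := (map_ofNat C 2).symm
    simp only [hc, h2, ← map_mul, ← map_sum, ← map_sub]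
    rw [sum_catalan_succ_mul_catalan_succ]
  have hsum : ∑ ij ∈ Finset.HasAntidiagonal.antidiagonal q,
        boundarySeries Z T ij.1 * boundarySeries Z T ij.2 =
      T ^ q * c (q + 1) - Z * T ^ (q + 2) * (2 * (c (q + 2) - 2 * c (q + 1))) +
        Z ^ 2 * T ^ (q + 4) * (c (q + 3) - 4 * c (q + 2) + 3 * c (q + 1)) := by
    have h1 : ∀ ij ∈ Finset.HasAntidiagonal.antidiagonal q,
        boundarySeries Z T ij.1 * boundarySeries Z T ij.2 =
        T ^ q * (c ij.1 * c ij.2) - Z * T ^ (q + 2) * (c (ij.1 + 1) * c ij.2 - c ij.1 * c ij.2 +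
          (c ij.1 * c (ij.2 + 1) - c ij.1 * c ij.2)) + Z ^ 2 * T ^ (q + 4) *
          (c (ij.1 + 1) * c (ij.2 + 1) - c (ij.1 + 1) * c ij.2 - c ij.1 * c (ij.2 + 1) +
            c ij.1 * c ij.2) := by
      rintro ⟨i, j⟩ hij
      rw [Finset.HasAntidiagonal.mem_antidiagonal] at hij
      simp only at hij
      simp only [hF, ← hij]
      ring
    rw [Finset.sum_congr rfl h1]
    simp only [Finset.sum_add_distrib, Finset.sum_sub_distrib, ← Finset.mul_sum, hC, hCs, hCs',
      hCss]
    ring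
  rw [hsum, hF, hF]
  have e1 : T ^ (q + 1) = T ^ q * (1 + 3 * Z * T ^ 2) := by rw [pow_succ]; congr 1
  linear_combination (c (q + 1) * T ^ q - Z * T ^ (q + 2) * (c (q + 2) - c (q + 1))) * hT

theorem expand_tripleCatalanSeries :
    expand 4 (by norm_num) tripleCatalanSeries =
      1 + 3 * X ^ 4 * expand 4 (by norm_num) tripleCatalanSeries ^ 2 := by
  conv_lhs => rw [tripleCatalanSeries_eq]
  rw [map_add, map_one, map_mul, map_mul, map_pow, expand_X, map_ofNat]

/-- The series of rooted planar maps with a root face of degree `l` and all other faces of degree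
four, by the number of arcs. -/
noncomputable def rootFaceSeries (l : ℕ) : PowerSeries ℚ :=
  if Even l then
    X ^ l * boundarySeries (X ^ 4) (expand 4 (by norm_num) tripleCatalanSeries) (l / 2)
  else 0

theorem rootFaceSeries_two_mul (p : ℕ) : rootFaceSeries (2 * p) =
    X ^ (2 * p) * boundarySeries (X ^ 4) (expand 4 (by norm_num) tripleCatalanSeries) p := by
  rw [rootFaceSeries, if_pos (even_two_mul p), Nat.mul_div_cancel_left _ (by norm_num)]

theorem rootFaceSeries_of_odd {l : ℕ} (hl : ¬ Even l) : rootFaceSeries l = 0 := if_neg hl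

theorem rootFaceSeries_zero : rootFaceSeries 0 = 1 := by
  rw [show 0 = 2 * 0 from rfl, rootFaceSeries_two_mul]
  simp [boundarySeries]

/-- A map with root degree `2 * p` and `k` quadrilaterals has `2 * p + 4 * k` arcs, which explains
the substitution `z = X ^ 4` and the factor `X ^ l`. In odd degree both sides vanish: `a + b + 2`
odd makes `a` or `b` odd. -/
theorem rootFaceSeries_eq (l : ℕ) (hl : l ≠ 0) :
    rootFaceSeries l = X ^ 2 * (∑ ab ∈ splits l, rootFaceSeries ab.1 * rootFaceSeries ab.2 +
      rootFaceSeries (l + 2)) := by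
  by_cases he : Even l
  · obtain ⟨p, rfl⟩ := he.two_dvd
    obtain ⟨q, rfl⟩ : ∃ q, p = q + 1 := ⟨p - 1, by omega⟩
    have hsum : ∑ ab ∈ splits (2 * (q + 1)), rootFaceSeries ab.1 * rootFaceSeries ab.2 =
        ∑ ij ∈ Finset.HasAntidiagonal.antidiagonal q,
          rootFaceSeries (2 * ij.1) * rootFaceSeries (2 * ij.2) := by
      symm
      refine Finset.sum_of_injOn (fun ij => (2 * ij.1, 2 * ij.2)) ?_ ?_ ?_ ?_
      · rintro ⟨a, b⟩ - ⟨a', b'⟩ - h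
        simp only [Prod.mk.injEq] at h ⊢
        omega
      · rintro ⟨a, b⟩ h
        have : a + b = q := by simpa using h
        exact mem_splits.2 (by omega)
      · rintro ⟨a, b⟩ h hn
        rw [mem_splits] at h
        by_cases ha : Even a
        · obtain ⟨a', rfl⟩ := ha.two_dvd
          exfalso
          refine hn ⟨(a', q - a'), ?_, ?_⟩
          · have : a' + (q - a') = q := by omega
            simpa using this
          · have hb : 2 * (q - a') = b := by omega
            exact Prod.ext rfl hb
        · simp only [rootFaceSeries_of_odd ha, zero_mul]
      · rintro ⟨a, b⟩ -
        rfl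
    have hterm : ∀ ij ∈ Finset.HasAntidiagonal.antidiagonal q,
        rootFaceSeries (2 * ij.1) * rootFaceSeries (2 * ij.2) = X ^ (2 * q) *
          (boundarySeries (X ^ 4) (expand 4 (by norm_num) tripleCatalanSeries) ij.1 *
          boundarySeries (X ^ 4) (expand 4 (by norm_num) tripleCatalanSeries) ij.2) := by
      rintro ⟨i, j⟩ hij
      rw [Finset.HasAntidiagonal.mem_antidiagonal] at hij
      simp only at hij
      simp only [rootFaceSeries_two_mul, ← hij]
      ring
    rw [hsum, Finset.sum_congr rfl hterm, ← Finset.mul_sum,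
      show 2 * (q + 1) + 2 = 2 * (q + 2) by ring, rootFaceSeries_two_mul, rootFaceSeries_two_mul,
      boundarySeries_succ expand_tripleCatalanSeries q]
    ring
  · rw [rootFaceSeries_of_odd he, rootFaceSeries_of_odd (by simpa [Nat.even_add] using he),
      Finset.sum_eq_zero, add_zero, mul_zero]
    rintro ⟨a, b⟩ h
    rw [mem_splits] at h
    have : ¬ Even a ∨ ¬ Even b := by
      by_contra hn
      push Not at hn
      exact he (h ▸ (hn.1.add hn.2).add even_two)
    rcases this with h | h
    · rw [rootFaceSeries_of_odd h, zero_mul]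
    · rw [rootFaceSeries_of_odd h, mul_zero]

/-- The lowest coefficient belongs to the maps without quadrilaterals, the plane trees. -/
theorem coeff_rootFaceSeries_self (p : ℕ) :
    coeff (2 * p) (rootFaceSeries (2 * p)) = (catalan p : ℚ) := by
  rw [rootFaceSeries_two_mul, coeff_X_pow_mul', if_pos le_rfl, Nat.sub_self, boundarySeries]
  rw [coeff_zero_eq_constantCoeff_apply]
  simp [tripleCatalanSeries]

theorem succ_succ_mul_catalan_succ (n : ℕ) :
    (n + 2) * catalan (n + 1) = 2 * (2 * n + 1) * catalan n := by
  have h1 := succ_mul_catalan_eq_centralBinom n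
  have h2 := succ_mul_catalan_eq_centralBinom (n + 1)
  have h3 := Nat.succ_mul_centralBinom_succ n
  rw [← h1, ← h2] at h3
  have h4 : 0 < n + 1 := by omega
  refine Nat.eq_of_mul_eq_mul_left h4 ?_
  linarith

theorem coeff_rootFaceSeries_four {n : ℕ} (hn : n ≠ 0) :
    coeff (4 * n) (rootFaceSeries 4) =
      2 / ((n : ℚ) + 2) * (3 ^ n / ((n : ℚ) + 1)) * ((2 * n).choose n : ℚ) := by
  -- Opening the root edge into a face of degree two: the recursion in degree `2` reads `G 2 = X ^ 2
  -- * (1 + G 4)`.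
  have h0 : coeff (4 * n) (rootFaceSeries 4) = coeff (4 * n + 2) (rootFaceSeries 2) := by
    rw [rootFaceSeries_eq 2 (by norm_num), coeff_X_pow_mul]
    have : splits 2 = {(0, 0)} := by decide
    rw [this, Finset.sum_singleton, rootFaceSeries_zero, mul_one, map_add, coeff_one,
      if_neg (by omega), zero_add]
  set T := tripleCatalanSeries with hT
  have h1 : coeff (4 * n + 2) (rootFaceSeries 2) = coeff n (T - X * T ^ 3) := by
    rw [show 2 = 2 * 1 from rfl, rootFaceSeries_two_mul, mul_one, coeff_X_pow_mul,
      ← coeff_expand_mul 4 (by norm_num) (T - X * T ^ 3)]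
    congr 1
    have e1 : ((2 : ℕ) : ℚ) - ((1 : ℕ) : ℚ) = 1 := by norm_num
    rw [boundarySeries, catalan_two, catalan_one, e1, Nat.cast_one, map_one, one_mul, one_mul,
      pow_one, map_sub, map_mul, map_pow, expand_X]
  have hTeq := tripleCatalanSeries_eq
  rw [← hT] at hTeq
  -- The equation for `T` makes the cubic expression linear in `T`, so its coefficients are
  -- combinations of two consecutive Catalan numbers.
  have h2 : 9 * (X * (T - X * T ^ 3)) = 12 * (X * T) - T + 1 := by
    linear_combination (1 + 3 * X * T) * hTeq
  have h3 := congrArg (coeff (n + 1)) h2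
  have e9 : (9 : PowerSeries ℚ) = C 9 := (map_ofNat C 9).symm
  have e12 : (12 : PowerSeries ℚ) = C 12 := (map_ofNat C 12).symm
  rw [map_add, map_sub, e9, e12, coeff_C_mul, coeff_C_mul, coeff_succ_X_mul, coeff_succ_X_mul,
    coeff_one, if_neg (by omega), hT, tripleCatalanSeries, coeff_mk, coeff_mk,
    ← tripleCatalanSeries, ← hT] at h3
  rw [h0, h1]
  have h4 : ((n : ℚ) + 2) * (catalan (n + 1) : ℚ) = 2 * (2 * n + 1) * catalan n := by
    exact_mod_cast succ_succ_mul_catalan_succ n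
  have h5 : ((n : ℚ) + 1) * (catalan n : ℚ) = ((2 * n).choose n : ℚ) := by
    have := succ_mul_catalan_eq_centralBinom n
    rw [Nat.centralBinom] at this
    exact_mod_cast this
  have hn1 : (n : ℚ) + 1 ≠ 0 := by positivity
  have hn2 : (n : ℚ) + 2 ≠ 0 := by positivity
  rw [← h5]
  field_simp
  have h6 : 9 * coeff n (T - X * T ^ 3) * ((n : ℚ) + 2) = 9 * (2 * 3 ^ n * catalan n) := by
    rw [h3]
    rw [pow_succ]
    linear_combination (-3 * 3 ^ n) * h4
  linarith

end Series

/-! ### Relabelling of arcs, and the exchange of a root arc for a half-edge. -/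

section Transport

variable {A B : Type*} {f φ α : Perm A}

theorem Equiv.Perm.sameCycle_permCongr (e : A ≃ B) {a b : A} :
    (e.permCongr f).SameCycle (e a) (e b) ↔ f.SameCycle a b := by
  have h : ∀ n : ℕ, ∀ a, ((e.permCongr f) ^ n) (e a) = e ((f ^ n) a) := by
    intro n
    induction n with
    | zero => intro a; rfl
    | succ k ih =>
      intro a
      rw [pow_succ, mul_apply, Equiv.permCongr_apply, Equiv.symm_apply_apply, ih, ← mul_apply,
        ← pow_succ]
  have h' : ∀ n : ℤ, ∀ a, ((e.permCongr f) ^ n) (e a) = e ((f ^ n) a) := by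
    intro n a
    cases n with
    | ofNat n => exact h n a
    | negSucc n =>
      rw [zpow_negSucc, zpow_negSucc, Perm.inv_eq_iff_eq, h, apply_inv_apply]
  exact exists_congr fun n => by rw [h', e.injective.eq_iff]

theorem Equiv.Perm.cyc_permCongr (e : A ≃ B) (a : A) :
    (e.permCongr f).cyc (e a) = e '' f.cyc a := by
  ext b
  obtain ⟨b, rfl⟩ := e.surjective b
  rw [e.injective.mem_set_image]
  exact sameCycle_permCongr e

theorem Equiv.Perm.ncard_cyc_permCongr (e : A ≃ B) (a : A) :
    ((e.permCongr f).cyc (e a)).ncard = (f.cyc a).ncard := by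
  rw [cyc_permCongr, Set.ncard_image_of_injective _ e.injective]

theorem Equiv.Perm.numCycles_permCongr (e : A ≃ B) : (e.permCongr f).numCycles = f.numCycles := by
  refine Nat.card_congr (Quotient.congr e fun a b => ?_).symm
  exact (sameCycle_permCongr e).symm

/-- The extension of a permutation to one more point, which is fixed. -/
def extendNone (f : Perm A) : Perm (Option A) := optionCongr f

theorem extendNone_some (f : Perm A) (a : A) : extendNone f (some a) = some (f a) := rfl

theorem extendNone_none (f : Perm A) : extendNone f none = none := rfl

theorem Equiv.Perm.cyc_extendNone [Finite A] (f : Perm A) (a : A) :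
    (extendNone f).cyc (some a) = some '' f.cyc a := by
  apply subset_antisymm
  · refine cyc_subset_of_forall ?_ ⟨a, self_mem_cyc f a, rfl⟩
    rintro _ ⟨b, hb, rfl⟩
    exact ⟨f b, apply_mem_cyc hb, rfl⟩
  · rintro _ ⟨b, hb, rfl⟩
    exact SameCycle.mem_of_forall (B := {b | some b ∈ (extendNone f).cyc (some a)}) hb
      (fun z hz => apply_mem_cyc (f := extendNone f) hz) (self_mem_cyc _ _)

theorem Equiv.Perm.numCycles_extendNone [Finite A] (f : Perm A) :
    (extendNone f).numCycles = f.numCycles + 1 := by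
  rw [numCycles, numCycles, ← Finite.card_option]
  have hsome : ∀ a b, (extendNone f).SameCycle (some a) (some b) ↔ f.SameCycle a b := by
    intro a b
    rw [← mem_cyc, cyc_extendNone, (Option.some_injective A).mem_set_image, mem_cyc]
  have hnone : ∀ a, ¬ (extendNone f).SameCycle none (some a) := fun a h => by
    have := SameCycle.eq_of_left h (extendNone_none f)
    simp at this
  let F : Option (Quotient (SameCycle.setoid f)) →
      Quotient (SameCycle.setoid (extendNone f)) := fun q =>
    q.elim (Quotient.mk _ none) (fun q => Quotient.map' (s₁ := SameCycle.setoid f)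
      (s₂ := SameCycle.setoid (extendNone f)) some (fun a b h => (hsome a b).2 h) q)
  refine (Nat.card_eq_of_bijective F ⟨?_, ?_⟩).symm
  · rintro (_ | q) (_ | q') h
    · rfl
    · induction q' using Quotient.inductionOn with | h a => ?_
      exact absurd (Quotient.exact h) (hnone a)
    · induction q using Quotient.inductionOn with | h a => ?_
      exact absurd (SameCycle.symm (Quotient.exact h)) (hnone a)
    · induction q using Quotient.inductionOn with | h a => ?_
      induction q' using Quotient.inductionOn with | h b => ?_
      exact congrArg some (Quotient.sound ((hsome a b).1 (Quotient.exact h)))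
  · intro q
    induction q using Quotient.inductionOn with | h a => ?_
    cases a with
    | none => exact ⟨none, rfl⟩
    | some a => exact ⟨some (Quotient.mk _ a), rfl⟩

end Transport

/-- The permutations `φ` (faces) and `α` (reversal of arcs) describe a planar map in which the face
at `r` has degree `d` and all the other faces have degree four. -/
structure IsRootedPlanar {A : Type*} (d : ℕ) (φ α : Perm A) (r : A) : Prop where
  invol : ∀ x, α (α x) = x
  fixed : ∀ x, α x ≠ x
  meets : MeetsStable φ α {r}
  euler : 2 * (φ.numCycles + (φ * α).numCycles) = Nat.card A + 4
  root_card : (φ.cyc r).ncard = d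
  quad : ∀ x, ¬ φ.SameCycle r x → (φ.cyc x).ncard = 4

theorem IsRootedPlanar.permCongr {A B : Type*} {d : ℕ} {φ α : Perm A} {r : A}
    (h : IsRootedPlanar d φ α r) (e : A ≃ B) :
    IsRootedPlanar d (e.permCongr φ) (e.permCongr α) (e r) where
  invol x := by
    obtain ⟨x, rfl⟩ := e.surjective x
    simp [h.invol]
  fixed x := by
    obtain ⟨x, rfl⟩ := e.surjective x
    simp [h.fixed]
  meets := by
    intro U h1 h2 h3
    obtain ⟨m, hm, hmU⟩ := h.meets (e ⁻¹' U) (fun x hx => by simpa using h1 _ hx)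
      (fun x hx => by simpa using h2 _ hx) (h3.preimage e.surjective)
    rw [Finset.mem_singleton] at hm
    subst hm
    exact ⟨e m, Finset.mem_singleton_self _, hmU⟩
  euler := by
    have : e.permCongr φ * e.permCongr α = e.permCongr (φ * α) := by
      ext x
      simp
    rw [this, numCycles_permCongr, numCycles_permCongr, h.euler, Nat.card_congr e]
  root_card := by rw [ncard_cyc_permCongr, h.root_card]
  quad x hx := by
    obtain ⟨x, rfl⟩ := e.surjective x
    rw [sameCycle_permCongr] at hx
    rw [ncard_cyc_permCongr, h.quad x hx]

section Marker

variable {A : Type*} [Fintype A] [DecidableEq A] {φ α : Perm A} {r : A} {d : ℕ}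

/-- The permutation with a new element that is inserted in front of `r`. -/
def insertNone (φ : Perm A) (r : A) : Perm (Option A) := swap none (some r) * extendNone φ

theorem insertNone_none (φ : Perm A) (r : A) : insertNone φ r none = some r := by
  rw [insertNone, mul_apply, extendNone_none, swap_apply_left]

theorem insertNone_some_of_ne {x : A} (h : φ x ≠ r) :
    insertNone φ r (some x) = some (φ x) := by
  rw [insertNone, mul_apply, extendNone_some, swap_apply_of_ne_of_ne (by simp)]
  simpa using h

theorem insertNone_some_of_eq {x : A} (h : φ x = r) : insertNone φ r (some x) = none := by
  rw [insertNone, mul_apply, extendNone_some, h, swap_apply_right]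

theorem not_sameCycle_none (φ : Perm A) (x : A) :
    ¬ (extendNone φ).SameCycle none (some x) := fun h => by
  have := SameCycle.eq_of_left h (extendNone_none φ)
  simp at this

theorem cyc_insertNone (φ : Perm A) (r : A) :
    (insertNone φ r).cyc none = insert none (some '' φ.cyc r) := by
  rw [insertNone, cyc_swap_mul (not_sameCycle_none φ r), cyc_extendNone,
    cyc_of_apply_eq (extendNone_none φ)]
  rfl

theorem cyc_insertNone_of_not_sameCycle {x : A} (hx : ¬ φ.SameCycle r x) :
    (insertNone φ r).cyc (some x) = some '' φ.cyc x := by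
  rw [insertNone, cyc_swap_mul_of_not_mem (not_sameCycle_none φ x), cyc_extendNone]
  intro h
  have : some x ∈ (extendNone φ).cyc (some r) := h
  rw [cyc_extendNone, (Option.some_injective A).mem_set_image] at this
  exact hx this

theorem numCycles_insertNone (φ : Perm A) (r : A) :
    (insertNone φ r).numCycles = φ.numCycles := by
  have := numCycles_swap_mul (not_sameCycle_none φ r)
  rw [numCycles_extendNone] at this
  exact Nat.add_right_cancel this

theorem meetsStable_insertNone_iff :
    MeetsStable (insertNone φ r) (extendNone α) {none} ↔ MeetsStable φ α {r} := by
  constructor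
  · intro h B h1 h2 h3
    by_contra hn
    simp only [Finset.mem_singleton, exists_eq_left] at hn
    have h4 : ∀ x ∈ some '' B, insertNone φ r x ∈ some '' B := by
      rintro _ ⟨x, hx, rfl⟩
      rw [insertNone_some_of_ne (ne_of_mem_of_not_mem (h1 x hx) hn)]
      exact ⟨_, h1 x hx, rfl⟩
    have h5 : ∀ x ∈ some '' B, extendNone α x ∈ some '' B := by
      rintro _ ⟨x, hx, rfl⟩
      exact ⟨_, h2 x hx, rfl⟩
    obtain ⟨m, hm, hmB⟩ := h (some '' B) h4 h5 (h3.image some)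
    rw [Finset.mem_singleton] at hm
    subst hm
    simp at hmB
  · intro h B h1 h2 h3
    by_contra hn
    simp only [Finset.mem_singleton, exists_eq_left] at hn
    have hstable : ∀ x ∈ some ⁻¹' B, φ x ∈ some ⁻¹' B ∧ φ x ≠ r := by
      intro x hx
      have := h1 _ hx
      by_cases he : φ x = r
      · rw [insertNone_some_of_eq he] at this
        exact absurd this hn
      · rw [insertNone_some_of_ne he] at this
        exact ⟨this, he⟩
    obtain ⟨m, hm, hmB⟩ := h (some ⁻¹' B) (fun x hx => (hstable x hx).1) (fun x hx => h2 _ hx) (by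
      obtain ⟨x, hx⟩ := h3
      cases x with
      | none => exact absurd hx hn
      | some x => exact ⟨x, hx⟩)
    rw [Finset.mem_singleton] at hm
    subst hm
    have h4 : φ⁻¹ m ∈ some ⁻¹' B :=
      apply_mem_of_forall_mem (f := φ) (fun x hx => (hstable x hx).1) (by
        rw [apply_inv_apply]; exact hmB)
    exact (hstable _ h4).2 (apply_inv_apply φ m)

/-- The half-edge `none` is drawn in the corner in front of the root arc `r`. It lengthens the root
face and the root vertex by one element and changes neither their number nor the other faces. -/
theorem isMarkedMap_insertNone_iff :
    IsMarkedMap {none} (fun _ => d) (insertNone φ r) (extendNone α) ↔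
      IsRootedPlanar d φ α r := by
  have hmul : insertNone φ r * extendNone α = insertNone (φ * α) r := by
    rw [insertNone, insertNone, mul_assoc]
    congr 1
    ext x
    cases x <;> rfl
  have hcard : Fintype.card (Option A) = Nat.card A + 1 := by
    rw [Fintype.card_option, Nat.card_eq_fintype_card]
  constructor
  · intro h
    refine ⟨fun x => ?_, fun x hx => ?_, meetsStable_insertNone_iff.1 h.meets, ?_, ?_,
      fun x hx => ?_⟩
    · exact Option.some_injective _ (h.invol (some x))
    · have := (h.fixed (some x)).1 (congrArg some hx)
      simp at this
    · have := h.euler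
      rw [hmul, numCycles_insertNone, numCycles_insertNone, hcard, Finset.card_singleton] at this
      omega
    · have := h.root_card none (Finset.mem_singleton_self _)
      rw [cyc_insertNone, Set.ncard_insert_of_notMem (by simp),
        Set.ncard_image_of_injective _ (Option.some_injective A)] at this
      omega
    · have := h.quad (some x) ?_
      · rwa [cyc_insertNone_of_not_sameCycle hx,
          Set.ncard_image_of_injective _ (Option.some_injective A)] at this
      · intro m hm hc
        rw [Finset.mem_singleton] at hm
        subst hm
        have : some x ∈ (insertNone φ r).cyc none := hc
        rw [cyc_insertNone] at this
        simp only [Set.mem_insert_iff, reduceCtorEq, false_or,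
          (Option.some_injective A).mem_set_image] at this
        exact hx this
  · intro h
    refine ⟨fun x => ?_, fun x => ?_, meetsStable_insertNone_iff.2 h.meets, ?_, fun m hm => ?_,
      fun x hx => ?_⟩
    · cases x with
      | none => rfl
      | some x => exact congrArg some (h.invol x)
    · cases x with
      | none => simp [extendNone_none]
      | some x => simpa [extendNone_some] using h.fixed x
    · have := h.euler
      rw [hmul, numCycles_insertNone, numCycles_insertNone, hcard, Finset.card_singleton]
      omega
    · rw [Finset.mem_singleton] at hm
      subst hm
      rw [cyc_insertNone, Set.ncard_insert_of_notMem (by simp),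
        Set.ncard_image_of_injective _ (Option.some_injective A), h.root_card]
    · have hxn := hx none (Finset.mem_singleton_self _)
      cases x with
      | none => exact absurd (SameCycle.refl _ _) hxn
      | some x =>
        have hx' : ¬ φ.SameCycle r x := fun hc => hxn (by
          have : some x ∈ (insertNone φ r).cyc none := by
            rw [cyc_insertNone]; exact Or.inr ⟨x, hc, rfl⟩
          exact this)
        rw [cyc_insertNone_of_not_sameCycle hx',
          Set.ncard_image_of_injective _ (Option.some_injective A), h.quad x hx']

/-- As the root face has positive degree, the half-edge is followed by an arc, which serves as the
root. -/
theorem exists_eq_insertNone {φ' α' : Perm (Option A)} (hd : d ≠ 0)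
    (h : IsMarkedMap {none} (fun _ => d) φ' α') :
    ∃ φ α r, φ' = insertNone φ r ∧ α' = extendNone α := by
  have h1 : α' none = none := (h.fixed none).2 (Finset.mem_singleton_self _)
  have h2 : φ' none ≠ none := by
    intro hn
    have := h.root_card none (Finset.mem_singleton_self _)
    rw [cyc_of_apply_eq hn, Set.ncard_singleton] at this
    omega
  obtain ⟨r, hr⟩ := Option.ne_none_iff_exists'.1 h2
  refine ⟨removeNone φ', removeNone α', r, ?_, ?_⟩
  · rw [insertNone, extendNone, map_equiv_removeNone, hr, ← mul_assoc, swap_mul_self, one_mul]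
  · rw [extendNone, map_equiv_removeNone, h1, swap_self]
    rfl

theorem insertNone_injective {φ φ' : Perm A} {r r' : A}
    (h : insertNone φ r = insertNone φ' r') : φ = φ' ∧ r = r' := by
  have h1 : r = r' := by
    have := congrArg (fun f => f none) h
    simpa [insertNone_none] using this
  subst h1
  exact ⟨optionCongr_injective (mul_left_cancel h), rfl⟩

end Marker

/-! ### Surface maps as pairs of permutations. -/

namespace SurfaceMap

section

variable (m : SurfaceMap)

instance : Finite m.Arc := m.finite_arc

instance : Nonempty m.Vertex := m.nonempty_vertex

theorem revPerm_apply (a : m.Arc) : m.revPerm a = m.rev a := rfl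

theorem facePerm_apply (a : m.Arc) : m.facePerm a = m.next (m.rev a) := rfl

theorem facePerm_mul_revPerm : m.facePerm * m.revPerm = m.next := by
  ext a
  simp [facePerm_apply, revPerm_apply, m.rev_rev]

theorem origin_next (a : m.Arc) : m.origin (m.next a) = m.origin a :=
  (m.origin_eq_iff _ _).2 (sameCycle_apply_left.2 (SameCycle.refl _ _))

theorem origin_surjective [hne : Nonempty m.Arc] : Function.Surjective m.origin := by
  obtain ⟨a⟩ := hne
  intro v
  rcases Relation.ReflTransGen.cases_tail (m.connected (m.origin a) v) with h | ⟨w, -, b, -, hb⟩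
  · exact ⟨a, h.symm⟩
  · exact ⟨_, hb⟩

/-- Connectedness as an induction principle for arcs: what is preserved by rotation and reversal and
holds for one arc holds for all. -/
theorem mem_of_stable {B : Set m.Arc} (h1 : ∀ x ∈ B, m.next x ∈ B) (h2 : ∀ x ∈ B, m.rev x ∈ B)
    (h3 : B.Nonempty) (a : m.Arc) : a ∈ B := by
  have key : ∀ x ∈ B, ∀ y, m.origin x = m.origin y → y ∈ B := fun x hx y hxy =>
    SameCycle.mem_of_forall ((m.origin_eq_iff x y).1 hxy) h1 hx
  obtain ⟨x, hx⟩ := h3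
  suffices h : ∀ v, Relation.ReflTransGen (fun x y => ∃ a, m.origin a = x ∧ m.origin (m.rev a) = y)
      (m.origin x) v → ∀ y, m.origin y = v → y ∈ B from h _ (m.connected _ _) a rfl
  intro v hv
  induction hv with
  | refl => exact fun y hy => key x hx y hy.symm
  | tail _ hb ih =>
    obtain ⟨c, hc1, hc2⟩ := hb
    intro y hy
    exact key _ (h2 c (ih c hc1)) y (hc2.trans hy.symm)

theorem meetsStable (a : m.Arc) : MeetsStable m.facePerm m.revPerm {a} := by
  intro B h1 h2 h3
  refine ⟨a, Finset.mem_singleton_self a, m.mem_of_stable (fun x hx => ?_) h2 h3 a⟩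
  have := h1 _ (h2 x hx)
  rwa [← mul_apply, facePerm_mul_revPerm] at this

theorem numVertices_eq [Nonempty m.Arc] : m.numVertices = m.next.numCycles := by
  let F : Quotient (SameCycle.setoid m.next) → m.Vertex := fun q =>
    Quotient.lift (s := SameCycle.setoid m.next) m.origin
      (fun a b hab => (m.origin_eq_iff a b).2 hab) q
  refine (Nat.card_eq_of_bijective F ⟨?_, ?_⟩).symm
  · intro q q' h
    induction q using Quotient.inductionOn with | h a => ?_
    induction q' using Quotient.inductionOn with | h b => ?_
    exact Quotient.sound ((m.origin_eq_iff a b).1 h)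
  · intro v
    obtain ⟨a, rfl⟩ := m.origin_surjective v
    exact ⟨Quotient.mk _ a, rfl⟩

theorem numFaces_eq [hne : Nonempty m.Arc] : m.numFaces = m.facePerm.numCycles := by
  have : IsEmpty (PLift (IsEmpty m.Arc)) := ⟨fun h => not_isEmpty_of_nonempty _ h.down⟩
  exact Nat.card_congr (Equiv.sumEmpty _ _)

theorem numFaces_of_isEmpty [hne : IsEmpty m.Arc] : m.numFaces = 1 := by
  have h1 : IsEmpty (Quotient (SameCycle.setoid m.facePerm)) :=
    ⟨fun q => Quotient.inductionOn q fun a => hne.elim a⟩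
  rw [numFaces, Face, Nat.card_congr (Equiv.emptySum _ _)]
  have : Unique (PLift (IsEmpty m.Arc)) := ⟨⟨⟨hne⟩⟩, fun _ => rfl⟩
  exact Nat.card_unique

theorem subsingleton_vertex [hne : IsEmpty m.Arc] : Subsingleton m.Vertex := by
  refine ⟨fun u v => ?_⟩
  rcases Relation.ReflTransGen.cases_tail (m.connected u v) with h | ⟨w, -, b, -, hb⟩
  · exact h.symm
  · exact hne.elim b

theorem two_mul_numEdges : 2 * m.numEdges = Nat.card m.Arc := by
  classical
  have := Fintype.ofFinite m.Arc
  obtain ⟨R, hR⟩ := exists_isOrientation (α := m.revPerm) m.rev_rev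
  have h := hR.two_mul_card m.rev_rev
  have h0 : (Finset.univ.filter fun x => m.revPerm x = x) = ∅ :=
    Finset.filter_eq_empty_iff.2 fun x _ => m.rev_ne x
  rw [h0, Finset.card_empty, add_zero, ← Nat.card_eq_fintype_card] at h
  rw [numEdges, ← h, Nat.mul_div_cancel_left _ (by norm_num)]

theorem isPlanar_iff [Nonempty m.Arc] : m.IsPlanar ↔
    2 * (m.facePerm.numCycles + m.next.numCycles) = Nat.card m.Arc + 4 := by
  rw [IsPlanar, HasGenus, numVertices_eq, numFaces_eq, ← two_mul_numEdges]
  push_cast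
  omega

theorem faceDegree_mk (a : m.Arc) :
    m.faceDegree (Sum.inl (Quotient.mk (SameCycle.setoid m.facePerm) a)) =
      (m.facePerm.cyc a).ncard := by
  rw [faceDegree, Sum.elim_inl, ← Nat.card_coe_set_eq]
  refine Nat.card_congr (Equiv.subtypeEquivRight fun b => ?_)
  constructor
  · exact fun h => SameCycle.symm (Quotient.exact h)
  · exact fun h => Quotient.sound (SameCycle.symm h)

end

/-- The map given by a permutation with the vertices as cycles and a reversal of arcs. -/
def ofPerms {A : Type} [Finite A] [Nonempty A] (σ α : Perm A) (hα : ∀ x, α (α x) = x)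
    (hfix : ∀ x, α x ≠ x)
    (hconn : ∀ B : Set A, (∀ x ∈ B, σ x ∈ B) → (∀ x ∈ B, α x ∈ B) → B.Nonempty → ∀ x, x ∈ B) :
    SurfaceMap where
  Vertex := Quotient (SameCycle.setoid σ)
  Arc := A
  finite_vertex := inferInstance
  finite_arc := inferInstance
  origin := Quotient.mk _
  rev := α
  rev_rev := hα
  rev_ne := hfix
  next := σ
  origin_eq_iff _ _ := ⟨fun h => Quotient.exact h, fun h => Quotient.sound h⟩
  nonempty_vertex := Nonempty.map (Quotient.mk _) ‹Nonempty A›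
  connected u v := by
    induction u using Quotient.inductionOn with | h a => ?_
    induction v using Quotient.inductionOn with | h b => ?_
    refine hconn {x | Relation.ReflTransGen _ (Quotient.mk (SameCycle.setoid σ) a)
      (Quotient.mk (SameCycle.setoid σ) x)} (fun x hx => ?_) (fun x hx => ?_)
      ⟨a, Relation.ReflTransGen.refl⟩ b
    · have : Quotient.mk (SameCycle.setoid σ) (σ x) = Quotient.mk (SameCycle.setoid σ) x :=
        Quotient.sound (show σ.SameCycle (σ x) x from
          sameCycle_apply_left.2 (SameCycle.refl _ _))
      change Relation.ReflTransGen _ _ _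
      rw [this]
      exact hx
    · exact Relation.ReflTransGen.tail hx ⟨x, rfl, rfl⟩

end SurfaceMap

/-! ### From labelled marked maps to isomorphism classes of rooted maps. -/

namespace RootedMap

theorem Iso.map_face {m m' : RootedMap} (e : Iso m m') (a : m.Arc) :
    m'.facePerm (e.onArc a) = e.onArc (m.facePerm a) := by
  rw [SurfaceMap.facePerm_apply, SurfaceMap.facePerm_apply, e.map_rev, e.map_next]

/-- A bijection of the arcs that is compatible with the structure is an isomorphism. -/
theorem exists_iso_of_arc {m m' : RootedMap} [hne : Nonempty m.Arc] (e : m.Arc ≃ m'.Arc)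
    (hrev : ∀ a, m'.rev (e a) = e (m.rev a)) (hnext : ∀ a, m'.next (e a) = e (m.next a))
    (hroot : m.root.map e = m'.root) : ∃ i : Iso m m', i.onArc = e := by
  have hne' : Nonempty m'.Arc := hne.map e
  have hperm : m'.next = e.permCongr m.next := by
    ext b
    obtain ⟨a, rfl⟩ := e.surjective b
    simp [hnext]
  have horig : ∀ a b, m.origin a = m.origin b ↔ m'.origin (e a) = m'.origin (e b) := by
    intro a b
    rw [m.origin_eq_iff, m'.origin_eq_iff, hperm, sameCycle_permCongr]
  let F : m.Vertex → m'.Vertex := fun v => m'.origin (e (Function.surjInv m.origin_surjective v))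
  have hF : ∀ a, F (m.origin a) = m'.origin (e a) := fun a =>
    (horig _ _).1 (Function.surjInv_eq m.origin_surjective _)
  have hbij : Function.Bijective F := by
    constructor
    · intro v w h
      obtain ⟨a, rfl⟩ := m.origin_surjective v
      obtain ⟨b, rfl⟩ := m.origin_surjective w
      rw [hF, hF] at h
      exact (horig a b).2 h
    · intro v
      obtain ⟨b, rfl⟩ := m'.origin_surjective v
      obtain ⟨a, rfl⟩ := e.surjective b
      exact ⟨_, hF a⟩
  exact ⟨⟨Equiv.ofBijective F hbij, e, fun a => (hF a).symm, hrev, hnext, hroot⟩, rfl⟩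

/-- Rooted maps have no nontrivial automorphisms. -/
theorem Iso.eq {m m' : RootedMap} (e e' : Iso m m') :
    e.onVertex = e'.onVertex ∧ e.onArc = e'.onArc := by
  rcases isEmpty_or_nonempty m.Arc with hA | hA
  · have := m.subsingleton_vertex
    have hA' : IsEmpty m'.Arc := e.onArc.symm.isEmpty
    have := m'.subsingleton_vertex
    exact ⟨Equiv.ext fun _ => Subsingleton.elim _ _, Equiv.ext fun a => hA.elim a⟩
  · obtain ⟨r, hr⟩ := Option.isSome_iff_exists.1 (m.root_isSome hA)
    have hroot : e.onArc r = e'.onArc r := by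
      have := e.map_root.trans e'.map_root.symm
      simpa [hr] using this
    have harc : ∀ a, e.onArc a = e'.onArc a := fun a =>
      m.mem_of_stable (B := {a | e.onArc a = e'.onArc a})
        (fun x (hx : _ = _) => by
          change _ = _
          rw [← e.map_next, ← e'.map_next, hx])
        (fun x (hx : _ = _) => by
          change _ = _
          rw [← e.map_rev, ← e'.map_rev, hx]) ⟨r, hroot⟩ a
    refine ⟨Equiv.ext fun v => ?_, Equiv.ext harc⟩
    obtain ⟨a, rfl⟩ := m.origin_surjective v
    rw [← e.map_origin, ← e'.map_origin, harc]

/-- The rooted planar maps with `N` arcs and a root face of degree `d`, all of whose other faces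
have degree four. -/
def IsBoundaryMap (N d : ℕ) (m : RootedMap) : Prop :=
  Nat.card m.Arc = N ∧ ∃ r, m.root = some r ∧ IsRootedPlanar d m.facePerm m.revPerm r

/-- Since rooted maps are rigid, each class has exactly `N !` distinct labellings by `Fin N`. -/
theorem numMarkedMaps_option (N d : ℕ) (hd : d ≠ 0) :
    numMarkedMaps ({none} : Finset (Option (Fin N))) (fun _ => d) =
      Nat.card (Quotient (RootedMap.isoSetoid.comap
        (Subtype.val : {m : RootedMap // m.IsBoundaryMap N d} → RootedMap))) * N.factorial := by
  classical
  set S := RootedMap.isoSetoid.comap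
    (Subtype.val : {m : RootedMap // m.IsBoundaryMap N d} → RootedMap) with hS
  have hequiv : ∀ q : Quotient S, Nonempty (q.out.1.Arc ≃ Fin N) := fun q =>
    ⟨Finite.equivFinOfCardEq q.out.2.1⟩
  let e : ∀ q : Quotient S, Perm (Fin N) → (q.out.1.Arc ≃ Fin N) := fun q π =>
    (hequiv q).some.trans π
  choose r hr using fun q : Quotient S => q.out.2.2
  -- A representative of each class, with a fixed labelling, is relabelled in all possible ways.
  let F : Quotient S × Perm (Fin N) →
      {p : Perm (Option (Fin N)) × Perm (Option (Fin N)) //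
        IsMarkedMap {none} (fun _ => d) p.1 p.2} := fun x =>
    ⟨(insertNone ((e x.1 x.2).permCongr x.1.out.1.facePerm) (e x.1 x.2 (r x.1)),
      extendNone ((e x.1 x.2).permCongr x.1.out.1.revPerm)),
      isMarkedMap_insertNone_iff.2 ((hr x.1).2.permCongr _)⟩
  have hF : Function.Bijective F := by
    constructor
    · rintro ⟨q, π⟩ ⟨q', π'⟩ h
      have h' := congrArg Subtype.val h
      obtain ⟨h1, h2⟩ := Prod.ext_iff.1 h'
      obtain ⟨h1, h3⟩ := insertNone_injective h1
      have h2 := optionCongr_injective h2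
      dsimp only at h1 h2 h3
      set i := (e q π).trans (e q' π').symm with hi
      have hface : ∀ a, q'.out.1.facePerm (i a) = i (q.out.1.facePerm a) := by
        intro a
        have := congrArg (fun f => (e q' π').symm (f (e q π a))) h1
        simpa [hi] using this.symm
      have hrev : ∀ a, q'.out.1.rev (i a) = i (q.out.1.rev a) := by
        intro a
        have := congrArg (fun f => (e q' π').symm (f (e q π a))) h2
        simpa [hi, SurfaceMap.revPerm_apply] using this.symm
      have hnext : ∀ a, q'.out.1.next (i a) = i (q.out.1.next a) := by
        intro a
        rw [← SurfaceMap.facePerm_mul_revPerm, ← SurfaceMap.facePerm_mul_revPerm, mul_apply,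
          mul_apply, SurfaceMap.revPerm_apply, SurfaceMap.revPerm_apply, hrev, hface]
      have hroot : q.out.1.root.map i = q'.out.1.root := by
        rw [(hr q).1, (hr q').1, Option.map_some, hi, Equiv.trans_apply, h3,
          Equiv.symm_apply_apply]
      have : Nonempty q.out.1.Arc := ⟨r q⟩
      obtain ⟨j, hj⟩ := exists_iso_of_arc i hrev hnext hroot
      have hqq : q = q' := by
        rw [← Quotient.out_eq q, ← Quotient.out_eq q']
        exact Quotient.sound (s := S) ⟨j⟩
      subst hqq
      have h4 := (Iso.eq j (Iso.refl _)).2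
      rw [hj] at h4
      refine Prod.ext rfl (Equiv.ext fun x => ?_)
      have h5 := congrArg (fun f => e q π' (f ((hequiv q).some.symm x))) h4
      simpa [hi, e, Iso.refl] using h5
    · rintro ⟨⟨φ', α'⟩, hp⟩
      obtain ⟨φ, α, s, rfl, rfl⟩ := exists_eq_insertNone hd hp
      have hv := isMarkedMap_insertNone_iff.1 hp
      have hne : Nonempty (Fin N) := ⟨s⟩
      let m0 : SurfaceMap := SurfaceMap.ofPerms (φ * α) α hv.invol hv.fixed (by
        intro B h1 h2 h3
        have h1' : ∀ x ∈ B, φ x ∈ B := fun x hx => by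
          have := h1 _ (h2 x hx)
          rwa [mul_apply, hv.invol] at this
        intro x
        by_contra hx
        -- The complement of a stable set is stable too, and both would have to contain the root.
        have hcompl : ∀ f : Perm (Fin N), (∀ x ∈ B, f x ∈ B) → ∀ x ∈ Bᶜ, f x ∈ Bᶜ :=
          fun f hf x hx hfx => hx (apply_mem_of_forall_mem hf hfx)
        obtain ⟨m1, hm1, hB1⟩ := hv.meets B h1' h2 h3
        obtain ⟨m2, hm2, hB2⟩ := hv.meets Bᶜ (hcompl φ h1') (hcompl α h2) ⟨x, hx⟩
        rw [Finset.mem_singleton] at hm1 hm2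
        exact hB2 (hm2 ▸ hm1 ▸ hB1))
      let m1 : RootedMap := ⟨m0, some s, fun _ => rfl⟩
      have hface : m1.facePerm = φ := by
        refine Equiv.ext fun x => ?_
        exact congrArg φ (hv.invol x)
      have hrev : m1.revPerm = α := by
        ext x
        rfl
      have hm1 : m1.IsBoundaryMap N d := by
        refine ⟨Nat.card_fin N, s, rfl, ?_⟩
        rw [hface, hrev]
        exact hv
      set q : Quotient S := Quotient.mk S ⟨m1, hm1⟩ with hq
      obtain ⟨j⟩ : Nonempty (Iso q.out.1 m1) :=
        Quotient.exact (s := S) (Quotient.out_eq q)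
      let j' : q.out.1.Arc ≃ Fin N := j.onArc
      have he : e q ((hequiv q).some.symm.trans j') = j' := by
        refine Equiv.ext fun x => ?_
        change j' ((hequiv q).some.symm ((hequiv q).some x)) = j' x
        rw [Equiv.symm_apply_apply]
      have hs : j' (r q) = s := by
        have := j.map_root
        rw [(hr q).1] at this
        exact Option.some_injective _ this
      have e1 : j'.permCongr q.out.1.facePerm = φ := by
        refine Equiv.ext fun x => ?_
        obtain ⟨a, rfl⟩ := j'.surjective x
        rw [Equiv.permCongr_apply, Equiv.symm_apply_apply, ← hface]
        exact (j.map_face a).symm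
      have e2 : j'.permCongr q.out.1.revPerm = α := by
        refine Equiv.ext fun x => ?_
        obtain ⟨a, rfl⟩ := j'.surjective x
        rw [Equiv.permCongr_apply, Equiv.symm_apply_apply, ← hrev]
        exact (j.map_rev a).symm
      refine ⟨(q, (hequiv q).some.symm.trans j'), Subtype.ext ?_⟩
      change (insertNone ((e q ((hequiv q).some.symm.trans j')).permCongr q.out.1.facePerm)
        ((e q ((hequiv q).some.symm.trans j')) (r q)), extendNone
        ((e q ((hequiv q).some.symm.trans j')).permCongr q.out.1.revPerm)) = _
      rw [he, hs, e1, e2]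
  rw [numMarkedMaps, ← Fintype.card_subtype, ← Nat.card_eq_fintype_card,
    ← Nat.card_eq_of_bijective F hF, Nat.card_prod, Nat.card_eq_fintype_card (α := Perm (Fin N)),
    Fintype.card_perm, Fintype.card_fin]

/-- The number of rooted planar maps with a root face of degree `d` and all other faces of degree
four. -/
theorem card_isBoundaryMap (N d : ℕ) (hd : d ≠ 0) :
    (Nat.card (Quotient (RootedMap.isoSetoid.comap
      (Subtype.val : {m : RootedMap // m.IsBoundaryMap N d} → RootedMap))) : ℚ) =
      PowerSeries.coeff N (rootFaceSeries d) := by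
  have h1 := numMarkedMaps_option N d hd
  have h2 := numMarkedMaps_eq rootFaceSeries rootFaceSeries_zero rootFaceSeries_eq
    ({none} : Finset (Option (Fin N))) (fun _ => d)
  have hc : ({none} : Finset (Option (Fin N)))ᶜ.card = N := by
    rw [Finset.card_compl, Finset.card_singleton, Fintype.card_option, Fintype.card_fin,
      Nat.add_sub_cancel]
  rw [hc, Finset.prod_singleton, h1] at h2
  push_cast at h2
  have h3 : (N.factorial : ℚ) ≠ 0 := by exact_mod_cast N.factorial_ne_zero
  rw [mul_comm] at h2
  exact mul_left_cancel₀ h3 h2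

end RootedMap

/-- Counting structures with an additional datum: if isomorphism classes of structures with a datum
over a given structure correspond to the `k` data, then the number of classes is multiplied by
`k`. -/
theorem card_quotient_eq_mul {X Y : Type*} (sX : Setoid X) (sY : Setoid Y) (π : Y → X)
    (D : X → Type*) (dec : ∀ x, D x → Y) (k : ℕ) (hfin : ∀ x, Finite (D x))
    (hk : ∀ x, Nat.card (D x) = k) (hπ : ∀ y y', sY y y' → sX (π y) (π y'))
    (hdec : ∀ x d, sX (π (dec x d)) x) (hinj : ∀ x d d', sY (dec x d) (dec x d') → d = d')
    (hsurj : ∀ x y, sX (π y) x → ∃ d, sY (dec x d) y) :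
    Nat.card (Quotient sY) = Nat.card (Quotient sX) * k := by
  have hD : ∀ q : Quotient sX, Nonempty (D q.out ≃ Fin k) := fun q =>
    ⟨Finite.equivFinOfCardEq (hk _)⟩
  let F : Quotient sX × Fin k → Quotient sY := fun x =>
    Quotient.mk sY (dec x.1.out ((hD x.1).some.symm x.2))
  have hF : Function.Bijective F := by
    constructor
    · rintro ⟨q, i⟩ ⟨q', i'⟩ h
      have h1 : sY _ _ := Quotient.exact h
      have h2 := hπ _ _ h1
      have h3 : q = q' := by
        rw [← Quotient.out_eq q, ← Quotient.out_eq q']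
        exact Quotient.sound (s := sX) (sX.trans (sX.symm (hdec _ _)) (sX.trans h2 (hdec _ _)))
      subst h3
      have h4 := hinj _ _ _ h1
      exact Prod.ext rfl ((hD q).some.symm.injective h4)
    · intro q
      induction q using Quotient.inductionOn with | h y => ?_
      have h1 : sX (π y) (Quotient.mk sX (π y)).out :=
        sX.symm (Quotient.exact (s := sX) (Quotient.out_eq _))
      obtain ⟨d, hd⟩ := hsurj _ _ h1
      refine ⟨(Quotient.mk sX (π y), (hD _).some d), Quotient.sound (s := sY) ?_⟩
      dsimp only
      rw [Equiv.symm_apply_apply]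
      exact hd
  rw [← Nat.card_eq_of_bijective F hF, Nat.card_prod, Nat.card_eq_fintype_card (α := Fin k),
    Fintype.card_fin]

/-! ### Plane trees and their labels. -/

namespace Equiv.Perm

variable {A : Type*} [Finite A] {f : Perm A} {r : A}

theorem numCycles_eq_one_iff : f.numCycles = 1 ↔ ∃ r, ∀ x, f.SameCycle r x := by
  rw [numCycles, Nat.card_eq_one_iff_exists]
  constructor
  · rintro ⟨q, hq⟩
    induction q using Quotient.inductionOn with | h r => ?_
    exact ⟨r, fun x => SameCycle.symm (Quotient.exact (hq (Quotient.mk _ x)))⟩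
  · rintro ⟨r, hr⟩
    refine ⟨Quotient.mk _ r, fun q => ?_⟩
    induction q using Quotient.inductionOn with | h x => ?_
    exact Quotient.sound (SameCycle.symm (hr x))

theorem ncard_cyc_eq_card_iff : (f.cyc r).ncard = Nat.card A ↔ ∀ x, f.SameCycle r x := by
  rw [← Set.ncard_univ]
  constructor
  · intro h x
    have := Set.eq_of_subset_of_ncard_le (Set.subset_univ (f.cyc r)) h.ge (Set.toFinite _)
    have hx : x ∈ f.cyc r := this ▸ Set.mem_univ x
    exact hx
  · intro h
    congr 1
    exact Set.eq_univ_of_forall h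

end Equiv.Perm

namespace RootedMap

theorem nonempty_arc_of_numEdges {m : RootedMap} (h : m.numEdges ≠ 0) : Nonempty m.Arc := by
  have h1 := m.two_mul_numEdges
  by_contra hn
  rw [not_nonempty_iff] at hn
  rw [Nat.card_of_isEmpty] at h1
  omega

theorem root_eq_none {m : RootedMap} [hne : IsEmpty m.Arc] : m.root = none := by
  cases h : m.root with
  | none => rfl
  | some a => exact hne.elim a

theorem isRootedPlanar_iff {m : RootedMap} {d : ℕ} {r : m.Arc} :
    IsRootedPlanar d m.facePerm m.revPerm r ↔ m.IsPlanar ∧ (m.facePerm.cyc r).ncard = d ∧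
      ∀ x, ¬ m.facePerm.SameCycle r x → (m.facePerm.cyc x).ncard = 4 := by
  have : Nonempty m.Arc := ⟨r⟩
  constructor
  · intro h
    refine ⟨?_, h.root_card, h.quad⟩
    rw [SurfaceMap.isPlanar_iff, ← h.euler, SurfaceMap.facePerm_mul_revPerm]
  · rintro ⟨h1, h2, h3⟩
    refine ⟨m.rev_rev, m.rev_ne, m.meetsStable r, ?_, h2, h3⟩
    rw [SurfaceMap.facePerm_mul_revPerm]
    exact m.isPlanar_iff.1 h1

/-- With a single face, the root face contains all `2 * n` arcs. -/
theorem isPlaneTreeOfSize_iff {m : RootedMap} {n : ℕ} (hn : n ≠ 0) :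
    m.IsPlaneTreeOfSize n ↔ m.IsBoundaryMap (2 * n) (2 * n) := by
  have hE := m.two_mul_numEdges
  constructor
  · rintro ⟨h1, h2, h3⟩
    have hne : Nonempty m.Arc := nonempty_arc_of_numEdges (by omega)
    obtain ⟨r, hr⟩ := Option.isSome_iff_exists.1 (m.root_isSome hne)
    rw [SurfaceMap.numFaces_eq, numCycles_eq_one_iff] at h2
    obtain ⟨r', hr'⟩ := h2
    have hall : ∀ x, m.facePerm.SameCycle r x := fun x => (hr' r).symm.trans (hr' x)
    refine ⟨by omega, r, hr, isRootedPlanar_iff.2 ⟨h1, ?_, fun x hx => absurd (hall x) hx⟩⟩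
    rw [ncard_cyc_eq_card_iff.2 hall]
    omega
  · rintro ⟨h1, r, hr, h2⟩
    have hne : Nonempty m.Arc := ⟨r⟩
    obtain ⟨h3, h4, -⟩ := isRootedPlanar_iff.1 h2
    refine ⟨h3, ?_, by omega⟩
    rw [SurfaceMap.numFaces_eq, numCycles_eq_one_iff]
    exact ⟨r, ncard_cyc_eq_card_iff.1 (h4.trans h1.symm)⟩

/-- The map with one vertex and no edge. -/
def vertexMap : RootedMap where
  Vertex := Unit
  Arc := Empty
  finite_vertex := inferInstance
  finite_arc := inferInstance
  origin a := a.elim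
  rev a := a.elim
  rev_rev a := a.elim
  rev_ne a := a.elim
  next := 1
  origin_eq_iff a := a.elim
  nonempty_vertex := inferInstance
  connected _ _ := Relation.ReflTransGen.refl
  root := none
  root_isSome h := h.some.elim

theorem isPlanar_of_isEmpty {m : RootedMap} [hne : IsEmpty m.Arc] : m.IsPlanar := by
  have := m.subsingleton_vertex
  have : Unique m.Vertex := ⟨⟨m.nonempty_vertex.some⟩, fun _ => Subsingleton.elim _ _⟩
  have h1 : m.numVertices = 1 := Nat.card_unique
  have h2 := m.two_mul_numEdges
  rw [Nat.card_of_isEmpty] at h2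
  rw [SurfaceMap.IsPlanar, SurfaceMap.HasGenus, h1, m.numFaces_of_isEmpty]
  have : m.numEdges = 0 := by omega
  rw [this]
  norm_num

theorem isEmpty_arc_of_numEdges {m : RootedMap} (h : m.numEdges = 0) : IsEmpty m.Arc := by
  have h1 := m.two_mul_numEdges
  rw [h, mul_zero] at h1
  exact (Nat.card_eq_zero.1 h1.symm).resolve_right fun h => h.not_finite m.finite_arc

theorem nonempty_iso_of_isEmpty (m m' : RootedMap) [h : IsEmpty m.Arc] [h' : IsEmpty m'.Arc] :
    Nonempty (Iso m m') := by
  have := m.subsingleton_vertex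
  have := m'.subsingleton_vertex
  exact ⟨⟨⟨fun _ => m'.nonempty_vertex.some, fun _ => m.nonempty_vertex.some,
    fun _ => Subsingleton.elim _ _, fun _ => Subsingleton.elim _ _⟩, Equiv.equivOfIsEmpty _ _,
    fun a => h.elim a, fun a => h.elim a, fun a => h.elim a,
    by rw [root_eq_none, root_eq_none]; rfl⟩⟩

theorem card_planar_zero : Nat.card (Quotient (RootedMap.isoSetoid.comap
    (Subtype.val : {m : RootedMap // m.IsPlanar ∧ m.numEdges = 0} → RootedMap))) = 1 := by
  have hE : IsEmpty vertexMap.Arc := inferInstanceAs (IsEmpty Empty)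
  have h2 := vertexMap.two_mul_numEdges
  rw [Nat.card_of_isEmpty] at h2
  rw [Nat.card_eq_one_iff_exists]
  refine ⟨Quotient.mk _ ⟨vertexMap, isPlanar_of_isEmpty, by omega⟩, fun q => ?_⟩
  induction q using Quotient.inductionOn with | h m => ?_
  have := isEmpty_arc_of_numEdges m.2.2
  exact Quotient.sound (nonempty_iso_of_isEmpty m.1 vertexMap)

theorem isPlaneTreeOfSize_zero_iff {m : RootedMap} :
    m.IsPlaneTreeOfSize 0 ↔ m.IsPlanar ∧ m.numEdges = 0 := by
  refine ⟨fun h => ⟨h.1, h.2.2⟩, fun h => ?_⟩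
  have := isEmpty_arc_of_numEdges h.2
  exact ⟨h.1, m.numFaces_of_isEmpty, h.2⟩

theorem card_isPlaneTreeOfSize (n : ℕ) : Nat.card (Quotient (RootedMap.isoSetoid.comap
    (Subtype.val : {m : RootedMap // m.IsPlaneTreeOfSize n} → RootedMap))) = catalan n := by
  by_cases hn : n = 0
  · subst hn
    have hP : (fun m : RootedMap => m.IsPlaneTreeOfSize 0) =
        fun m : RootedMap => m.IsPlanar ∧ m.numEdges = 0 :=
      funext fun m => propext isPlaneTreeOfSize_zero_iff
    rw [hP, card_planar_zero, catalan_zero]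
  · have hP : (fun m : RootedMap => m.IsPlaneTreeOfSize n) =
        fun m : RootedMap => m.IsBoundaryMap (2 * n) (2 * n) :=
      funext fun m => propext (isPlaneTreeOfSize_iff hn)
    rw [hP]
    have := card_isBoundaryMap (2 * n) (2 * n) (by omega)
    rw [coeff_rootFaceSeries_self] at this
    exact_mod_cast this

/-- The conditions on the labels of an embedded map. -/
def IsEmbedding (m : RootedMap) (f : m.Vertex → ℤ) : Prop :=
  (∀ a, |f (m.origin a) - f (m.origin (m.rev a))| ≤ 1) ∧ ∀ v, m.IsRootVertex v → f v = 1

/-- A function on the arcs that is compatible with the vertices, up to a constant, comes from an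
integer valued function on the vertices if its differences along the edges are integers. -/
theorem exists_label {m : RootedMap} {r : m.Arc} {h : m.Arc → ℚ} (hσ : ∀ x, h (m.next x) = h x)
    (hα : ∀ x, ∃ k : ℤ, h (m.rev x) - h x = k) :
    ∃ f : m.Vertex → ℤ, f (m.origin r) = 1 ∧ ∀ x, (f (m.origin x) : ℚ) = h x - h r + 1 := by
  have hint : ∀ x, ∃ k : ℤ, h x - h r + 1 = k := by
    refine m.mem_of_stable (B := {x | ∃ k : ℤ, h x - h r + 1 = k}) ?_ ?_ ⟨r, 1, by simp⟩
    · rintro x ⟨k, hk⟩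
      exact ⟨k, by rw [hσ, hk]⟩
    · rintro x ⟨k, hk⟩
      obtain ⟨l, hl⟩ := hα x
      refine ⟨k + l, ?_⟩
      push_cast
      rw [← hk, ← hl]
      ring
  have hne : Nonempty m.Arc := ⟨r⟩
  choose k hk using hint
  have hconst : ∀ x y, m.origin x = m.origin y → h y = h x := fun x y hxy =>
    eq_of_mem_invariants (f := m.next) (h := h) hσ ((m.origin_eq_iff x y).1 hxy)
  have hval : ∀ x, ((k (Function.surjInv m.origin_surjective (m.origin x)) : ℤ) : ℚ) =
      h x - h r + 1 := fun x => by
    rw [← hk, hconst x _ (Function.surjInv_eq m.origin_surjective (m.origin x)).symm]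
  refine ⟨fun v => k (Function.surjInv m.origin_surjective v), ?_, hval⟩
  have := hval r
  rw [sub_self, zero_add] at this
  exact_mod_cast this

/-- A labelling is determined by its increments along the `n` edges, since the root label is
prescribed. Conversely any choice of increments in `{-1, 0, 1}` integrates: a tree has one face, so
face functions are constant and impose no condition on the cochain. -/
theorem card_isEmbedding {m : RootedMap} {n : ℕ} (hm : m.IsPlaneTreeOfSize n) :
    Finite {f : m.Vertex → ℤ // m.IsEmbedding f} ∧
      Nat.card {f : m.Vertex → ℤ // m.IsEmbedding f} = 3 ^ n := by
  classical
  rcases isEmpty_or_nonempty m.Arc with hne | hne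
  · have hn : n = 0 := by
      have := m.two_mul_numEdges
      rw [Nat.card_of_isEmpty, hm.2.2] at this
      omega
    have hroot : ∀ v, m.IsRootVertex v := fun v a => hne.elim a
    have hu : ∀ f : {f : m.Vertex → ℤ // m.IsEmbedding f}, f = ⟨fun _ => 1,
        fun a => hne.elim a, fun _ _ => rfl⟩ := fun f =>
      Subtype.ext (funext fun v => f.2.2 v (hroot v))
    have : Unique {f : m.Vertex → ℤ // m.IsEmbedding f} := ⟨⟨_⟩, hu⟩
    exact ⟨inferInstance, by rw [Nat.card_unique, hn, pow_zero]⟩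
  · have := Fintype.ofFinite m.Arc
    obtain ⟨r, hr⟩ := Option.isSome_iff_exists.1 (m.root_isSome hne)
    obtain ⟨R, hR⟩ := exists_isOrientation (α := m.revPerm) m.rev_rev
    have hcardR : R.card = n := by
      have h := hR.two_mul_card m.rev_rev
      have h0 : (Finset.univ.filter fun x => m.revPerm x = x) = ∅ :=
        Finset.filter_eq_empty_iff.2 fun x _ => m.rev_ne x
      have h1 := m.two_mul_numEdges
      rw [h0, Finset.card_empty, add_zero, ← Nat.card_eq_fintype_card, ← h1, hm.2.2] at h
      omega
    have hrootv : ∀ v, m.IsRootVertex v ↔ v = m.origin r := fun v => by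
      simp [IsRootVertex, hr, eq_comm]
    let F : {f : m.Vertex → ℤ // m.IsEmbedding f} → (R → Finset.Icc (-1 : ℤ) 1) := fun f x =>
      ⟨f.1 (m.origin (m.rev x)) - f.1 (m.origin x), by
        have := f.2.1 x
        rw [abs_le] at this
        rw [Finset.mem_Icc]
        omega⟩
    have hF : Function.Bijective F := by
      constructor
      · rintro ⟨f, hf⟩ ⟨f', hf'⟩ h
        have hR1 : ∀ x ∈ R, f (m.origin (m.rev x)) - f (m.origin x) =
            f' (m.origin (m.rev x)) - f' (m.origin x) := fun x hx =>
          congrArg Subtype.val (congrFun h ⟨x, hx⟩)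
        have hall : ∀ x, f (m.origin (m.rev x)) - f (m.origin x) =
            f' (m.origin (m.rev x)) - f' (m.origin x) := by
          intro x
          rcases (hR.2 x).1 (m.rev_ne x) with hx | hx
          · exact hR1 x hx
          · have := hR1 _ hx
            rw [SurfaceMap.revPerm_apply, m.rev_rev] at this
            omega
        refine Subtype.ext (funext fun v => ?_)
        obtain ⟨a, rfl⟩ := m.origin_surjective v
        refine m.mem_of_stable (B := {a | f (m.origin a) = f' (m.origin a)}) ?_ ?_ ⟨r, ?_⟩ a
        · intro x hx
          change f (m.origin (m.next x)) = f' (m.origin (m.next x))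
          rw [m.origin_next]
          exact hx
        · intro x hx
          have h1 := hall x
          have h2 : f (m.origin x) = f' (m.origin x) := hx
          change f (m.origin (m.rev x)) = f' (m.origin (m.rev x))
          omega
        · exact (hf.2 _ ((hrootv _).2 rfl)).trans (hf'.2 _ ((hrootv _).2 rfl)).symm
      · intro g
        have hcyc : ∀ x, m.facePerm.SameCycle r x := by
          have := hm.2.1
          rw [SurfaceMap.numFaces_eq, numCycles_eq_one_iff] at this
          obtain ⟨r', hr'⟩ := this
          exact fun x => (hr' r).symm.trans (hr' x)
        have heuler := m.isPlanar_iff.1 hm.1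
        rw [← m.two_mul_numEdges, hm.2.2, ← m.facePerm_mul_revPerm] at heuler
        -- The potential is found over `ℚ`; integrality follows from the integral increments once it
        -- is normalized at the root.
        obtain ⟨h, hh, hd⟩ := exists_edgeDiff_eq (K := ℚ) m.rev_rev hR (m.meetsStable r)
          (by rw [hcardR, Finset.card_singleton]; omega) (fun x => ((g x).1 : ℚ)) (by
            intro f' hf'
            have : edgeDiff ℚ m.revPerm R f' = 0 := by
              ext x
              change f' _ - f' _ = 0
              rw [eq_of_mem_invariants hf' (hcyc _), eq_of_mem_invariants hf' (hcyc x), sub_self]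
            rw [this, zero_dotProduct])
        have hR1 : ∀ x (hx : x ∈ R), h (m.rev x) - h x = ((g ⟨x, hx⟩).1 : ℚ) := fun x hx =>
          congrFun hd ⟨x, hx⟩
        have hall : ∀ x, ∃ k : ℤ, |k| ≤ 1 ∧ h (m.rev x) - h x = k := by
          have hb : ∀ x, |(g x).1| ≤ 1 := fun x => abs_le.2 (Finset.mem_Icc.1 (g x).2)
          intro x
          rcases (hR.2 x).1 (m.rev_ne x) with hx | hx
          · exact ⟨_, hb _, hR1 x hx⟩
          · refine ⟨_, (abs_neg _).trans_le (hb ⟨_, hx⟩), ?_⟩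
            have h1 := hR1 _ hx
            have h2 : h (m.rev (m.revPerm x)) = h x := congrArg h (m.rev_rev x)
            rw [h2] at h1
            push_cast
            rw [← h1, neg_sub]
            rfl
        obtain ⟨f, hf1, hf2⟩ := exists_label (r := r) (h := h)
          (fun x => by rw [← m.facePerm_mul_revPerm]; exact hh x)
          (fun x => (hall x).imp fun k hk => hk.2)
        have hdiff : ∀ x, ((f (m.origin (m.rev x)) - f (m.origin x) : ℤ) : ℚ) =
            h (m.rev x) - h x := fun x => by
          push_cast
          rw [hf2, hf2]
          ring
        refine ⟨⟨f, fun x => ?_, fun v hv => ?_⟩, funext fun x => Subtype.ext ?_⟩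
        · obtain ⟨k, hk1, hk2⟩ := hall x
          rw [← hdiff] at hk2
          have : f (m.origin (m.rev x)) - f (m.origin x) = k := by exact_mod_cast hk2
          rwa [abs_sub_comm, this]
        · rw [(hrootv v).1 hv, hf1]
        · have := (hdiff x).trans (hR1 x x.2)
          change f (m.origin (m.rev x)) - f (m.origin x) = (g x).1
          exact_mod_cast this
    have hcard := Nat.card_eq_of_bijective F hF
    refine ⟨Finite.of_injective F hF.1, ?_⟩
    rw [hcard, Nat.card_eq_fintype_card, Fintype.card_fun, Fintype.card_coe, Fintype.card_coe,
      hcardR]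
    rfl

end RootedMap

/-- By rigidity, distinct labellings of one rooted tree are never isomorphic. -/
theorem numRootedEmbeddedTrees_eq (n : ℕ) : numRootedEmbeddedTrees n = 3 ^ n * catalan n := by
  rw [← RootedMap.card_isPlaneTreeOfSize n, mul_comm]
  refine card_quotient_eq_mul _ _ (fun y => ⟨y.1.toRootedMap, y.2.1⟩)
    (fun x => {f : x.1.Vertex → ℤ // x.1.IsEmbedding f})
    (fun x d => ⟨⟨x.1, d.1⟩, x.2, d.2⟩) _ (fun x => (RootedMap.card_isEmbedding x.2).1)
    (fun x => (RootedMap.card_isEmbedding x.2).2) ?_ ?_ ?_ ?_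
  · rintro y y' ⟨e, -⟩
    exact ⟨e⟩
  · exact fun x d => ⟨RootedMap.Iso.refl _⟩
  · rintro x d d' ⟨e, he⟩
    have h1 := (e.eq (RootedMap.Iso.refl _)).1
    refine Subtype.ext (funext fun v => ?_)
    have := he v
    rw [h1] at this
    exact this.symm
  · rintro x ⟨y, hy1, hy2⟩ ⟨e⟩
    change RootedMap.Iso y.toRootedMap x.1 at e
    have hl : ∀ v, y.label (e.symm.onVertex (e.onVertex v)) = y.label v := fun v =>
      congrArg _ (e.onVertex.symm_apply_apply v)
    refine ⟨⟨fun v => y.label (e.symm.onVertex v), fun a => ?_, fun v hv => ?_⟩, e.symm,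
      fun v => rfl⟩
    · change |y.label (e.symm.onVertex (x.1.origin a)) -
        y.label (e.symm.onVertex (x.1.origin (x.1.rev a)))| ≤ 1
      rw [← e.symm.map_origin, ← e.symm.map_origin, ← e.symm.map_rev]
      exact hy2.1 _
    · refine hy2.2 _ fun a ha => ?_
      have h1 : e.onArc a ∈ x.1.root := by
        rw [← e.map_root]
        exact Option.mem_map_of_mem _ ha
      rw [← hv _ h1, e.map_origin]
      exact (e.onVertex.symm_apply_apply _).symm

theorem rootedEmbeddedTreeSeries_eq : rootedEmbeddedTreeSeries = tripleCatalanSeries := by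
  ext n
  rw [rootedEmbeddedTreeSeries, tripleCatalanSeries, PowerSeries.coeff_mk, PowerSeries.coeff_mk,
    numRootedEmbeddedTrees_eq]
  push_cast
  rfl

/-! ### Rooted and pointed quadrangulations. -/

theorem Equiv.Perm.card_eq_mul_numCycles {A : Type*} [Finite A] {f : Perm A} {k : ℕ}
    (h : ∀ x, (f.cyc x).ncard = k) : Nat.card A = k * f.numCycles := by
  have := Fintype.ofFinite (Quotient (SameCycle.setoid f))
  rw [numCycles, ← Nat.card_congr (Equiv.sigmaFiberEquiv (Quotient.mk (SameCycle.setoid f))),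
    Nat.card_sigma, Finset.sum_congr rfl (g := fun _ => k), Finset.sum_const, smul_eq_mul,
    Finset.card_univ, Nat.card_eq_fintype_card, mul_comm]
  intro q _
  induction q using Quotient.inductionOn with | h x => ?_
  rw [← h x, ← Nat.card_coe_set_eq]
  refine Nat.card_congr (Equiv.subtypeEquivRight fun b => ?_)
  constructor
  · exact fun h => SameCycle.symm (Quotient.exact h)
  · exact fun h => Quotient.sound (SameCycle.symm h)

namespace RootedMap

theorem isPlanarQuadrangulation_iff {m : RootedMap} : m.IsPlanarQuadrangulation ↔
    m.IsPlanar ∧ Nonempty m.Arc ∧ ∀ x, (m.facePerm.cyc x).ncard = 4 := by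
  rw [SurfaceMap.IsPlanarQuadrangulation]
  refine and_congr_right fun _ => ⟨fun h => ?_, ?_⟩
  · refine ⟨?_, fun x => (m.faceDegree_mk x).symm.trans (h _)⟩
    by_contra hn
    rw [not_nonempty_iff] at hn
    exact absurd ((h (Sum.inr ⟨hn⟩)).symm.trans (rfl : _ = 0)) (by norm_num)
  · rintro ⟨hne, h⟩ (q | e)
    · induction q using Quotient.inductionOn with | h x => ?_
      exact (m.faceDegree_mk x).trans (h x)
    · exact absurd hne (not_nonempty_iff.2 e.down)

theorem isBoundaryMap_four_iff {m : RootedMap} {N : ℕ} : m.IsBoundaryMap N 4 ↔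
    Nat.card m.Arc = N ∧ m.IsPlanarQuadrangulation := by
  rw [isPlanarQuadrangulation_iff, IsBoundaryMap]
  refine and_congr_right fun _ => ?_
  constructor
  · rintro ⟨r, hr, h⟩
    obtain ⟨h1, h2, h3⟩ := isRootedPlanar_iff.1 h
    refine ⟨h1, ⟨r⟩, fun x => ?_⟩
    by_cases hx : m.facePerm.SameCycle r x
    · rw [← SameCycle.cyc_eq hx, h2]
    · exact h3 x hx
  · rintro ⟨h1, h2, h3⟩
    obtain ⟨r, hr⟩ := Option.isSome_iff_exists.1 (m.root_isSome h2)
    exact ⟨r, hr, isRootedPlanar_iff.2 ⟨h1, h3 r, fun x _ => h3 x⟩⟩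

theorem isPlanarQuadrangulationOfSize_iff {m : RootedMap} {n : ℕ} (hn : n ≠ 0) :
    m.IsPlanarQuadrangulationOfSize n ↔ m.IsBoundaryMap (4 * n) 4 := by
  rw [isBoundaryMap_four_iff, SurfaceMap.IsPlanarQuadrangulationOfSize, and_comm]
  simp only [hn, false_and, or_false]
  refine and_congr_left fun h => ?_
  rw [isPlanarQuadrangulation_iff] at h
  obtain ⟨-, h2, h3⟩ := h
  rw [m.numFaces_eq, card_eq_mul_numCycles h3]
  omega

/-- The degenerate quadrangulation is the plane tree with one edge, so the tree count covers it.
That the single edge is planar follows from Euler's inequality, which leaves room for only one face.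
-/
theorem isPlanarQuadrangulationOfSize_zero_iff {m : RootedMap} :
    m.IsPlanarQuadrangulationOfSize 0 ↔ m.IsPlaneTreeOfSize 1 := by
  have hV : m.IsPlaneTreeOfSize 1 ↔ m.IsSingleEdge := by
    rw [SurfaceMap.IsPlaneTreeOfSize, SurfaceMap.IsSingleEdge, SurfaceMap.IsPlanar,
      SurfaceMap.HasGenus]
    constructor
    · rintro ⟨h1, h2, h3⟩
      exact ⟨by rw [h2, h3] at h1; push_cast at h1; omega, h3⟩
    · rintro ⟨h1, h2⟩
      classical
      have hne : Nonempty m.Arc := nonempty_arc_of_numEdges (by omega)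
      obtain ⟨a⟩ := id hne
      have := Fintype.ofFinite m.Arc
      obtain ⟨R, hR⟩ := exists_isOrientation (α := m.revPerm) m.rev_rev
      have h3 := numCycles_add_numCycles_le m.rev_rev hR (m.meetsStable a)
      have h4 := hR.two_mul_card m.rev_rev
      have h0 : (Finset.univ.filter fun x => m.revPerm x = x) = ∅ :=
        Finset.filter_eq_empty_iff.2 fun x _ => m.rev_ne x
      rw [h0, Finset.card_empty, add_zero, ← Nat.card_eq_fintype_card, ← m.two_mul_numEdges] at h4
      rw [m.facePerm_mul_revPerm, ← m.numVertices_eq, ← m.numFaces_eq, Finset.card_singleton] at h3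
      have h5 : 0 < m.numFaces := by
        rw [m.numFaces_eq]
        have : Nonempty (Quotient (SameCycle.setoid m.facePerm)) := ⟨Quotient.mk _ a⟩
        exact Nat.card_pos
      refine ⟨?_, by omega, h2⟩
      rw [h1, h2, show m.numFaces = 1 by omega]
      norm_num
  rw [hV, SurfaceMap.IsPlanarQuadrangulationOfSize]
  refine ⟨?_, fun h => Or.inr ⟨rfl, h⟩⟩
  rintro (⟨h1, h2⟩ | h)
  · obtain ⟨-, hne, -⟩ := isPlanarQuadrangulation_iff.1 h1
    obtain ⟨a⟩ := id hne
    have : Nonempty (Quotient (SameCycle.setoid m.facePerm)) := ⟨Quotient.mk _ a⟩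
    have h5 : 0 < m.numFaces := by
      rw [m.numFaces_eq]
      exact Nat.card_pos
    omega
  · exact h.2

/-- Four arcs to a face and two to an edge make `2 * n` edges; Euler's formula gives the vertices.
-/
theorem numVertices_of_isPlanarQuadrangulationOfSize {m : RootedMap} {n : ℕ}
    (h : m.IsPlanarQuadrangulationOfSize n) : m.numVertices = n + 2 := by
  rcases h with ⟨h1, h2⟩ | ⟨rfl, h⟩
  · obtain ⟨h3, hne, h4⟩ := isPlanarQuadrangulation_iff.1 h1
    have h5 := card_eq_mul_numCycles h4
    rw [← m.numFaces_eq, h2, ← m.two_mul_numEdges] at h5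
    rw [SurfaceMap.IsPlanar, SurfaceMap.HasGenus, h2] at h3
    push_cast at h3
    omega
  · exact h.1

end RootedMap

theorem numRootedPlanarQuadrangulations_eq (n : ℕ) :
    (numRootedPlanarQuadrangulations n : ℚ) =
      2 / ((n : ℚ) + 2) * (3 ^ n / ((n : ℚ) + 1)) * ((2 * n).choose n : ℚ) := by
  unfold numRootedPlanarQuadrangulations
  by_cases hn : n = 0
  · subst hn
    have hP : (fun m : RootedMap => m.IsPlanarQuadrangulationOfSize 0) =
        fun m : RootedMap => m.IsPlaneTreeOfSize 1 :=
      funext fun m => propext RootedMap.isPlanarQuadrangulationOfSize_zero_iff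
    rw [hP, RootedMap.card_isPlaneTreeOfSize, catalan_one]
    norm_num
  · have hP : (fun m : RootedMap => m.IsPlanarQuadrangulationOfSize n) =
        fun m : RootedMap => m.IsBoundaryMap (4 * n) 4 :=
      funext fun m => propext (RootedMap.isPlanarQuadrangulationOfSize_iff hn)
    rw [hP, RootedMap.card_isBoundaryMap _ _ (by norm_num), coeff_rootFaceSeries_four hn]

/-- Rigidity again: different basepoints on one rooted map give non-isomorphic pointed maps. -/
theorem numRootedPointedPlanarQuadrangulations_eq (n : ℕ) :
    numRootedPointedPlanarQuadrangulations n = numRootedPlanarQuadrangulations n * (n + 2) := by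
  refine card_quotient_eq_mul _ _ (fun y => ⟨y.1.toRootedMap, y.2⟩)
    (fun x : {m : RootedMap // m.IsPlanarQuadrangulationOfSize n} => x.1.Vertex)
    (fun x d => ⟨⟨x.1, d⟩, x.2⟩) (n + 2) (fun x => x.1.finite_vertex)
    (fun x => RootedMap.numVertices_of_isPlanarQuadrangulationOfSize x.2) ?_ ?_ ?_ ?_
  · rintro y y' ⟨e, -⟩
    exact ⟨e⟩
  · exact fun x d => ⟨RootedMap.Iso.refl _⟩
  · rintro x d d' ⟨e, he⟩
    have h1 := (e.eq (RootedMap.Iso.refl _)).1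
    rw [h1] at he
    exact he
  · rintro x ⟨y, hy⟩ ⟨e⟩
    change RootedMap.Iso y.toRootedMap x.1 at e
    exact ⟨e.onVertex y.basepoint, e.symm, e.onVertex.symm_apply_apply _⟩

/-! ### Tutte's bijection between planar maps and planar quadrangulations. -/

namespace Equiv.Perm

variable {A B : Type*} [Finite A] [Finite B]

theorem numCycles_inv (f : Perm A) : f⁻¹.numCycles = f.numCycles :=
  Nat.card_congr (Quotient.congr (Equiv.refl A) fun _ _ => sameCycle_inv)

theorem sameCycle_sumCongr_inl {f : Perm A} {g : Perm B} {a a' : A} :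
    (sumCongr f g).SameCycle (Sum.inl a) (Sum.inl a') ↔ f.SameCycle a a' := by
  constructor
  · intro h
    have := SameCycle.mem_of_forall (B := Sum.inl '' f.cyc a) h (by
      rintro _ ⟨b, hb, rfl⟩
      exact ⟨f b, apply_mem_cyc hb, rfl⟩) ⟨a, self_mem_cyc f a, rfl⟩
    rwa [Sum.inl_injective.mem_set_image] at this
  · intro h
    exact SameCycle.mem_of_forall (B := {z | (sumCongr f g).SameCycle
      (Sum.inl a) (Sum.inl z)}) h (fun z hz => SameCycle.apply_right hz) (SameCycle.refl _ _)

theorem sameCycle_sumCongr_inr {f : Perm A} {g : Perm B} {b b' : B} :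
    (sumCongr f g).SameCycle (Sum.inr b) (Sum.inr b') ↔ g.SameCycle b b' := by
  constructor
  · intro h
    have := SameCycle.mem_of_forall (B := Sum.inr '' g.cyc b) h (by
      rintro _ ⟨c, hc, rfl⟩
      exact ⟨g c, apply_mem_cyc hc, rfl⟩) ⟨b, self_mem_cyc g b, rfl⟩
    rwa [Sum.inr_injective.mem_set_image] at this
  · intro h
    exact SameCycle.mem_of_forall (B := {z | (sumCongr f g).SameCycle
      (Sum.inr b) (Sum.inr z)}) h (fun z hz => SameCycle.apply_right hz) (SameCycle.refl _ _)

theorem not_sameCycle_sumCongr {f : Perm A} {g : Perm B} {a : A} {b : B} :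
    ¬ (sumCongr f g).SameCycle (Sum.inl a) (Sum.inr b) := by
  intro h
  have := SameCycle.mem_of_forall (B := Set.range Sum.inl) h (by
    rintro _ ⟨c, rfl⟩
    exact ⟨f c, rfl⟩) ⟨a, rfl⟩
  simp at this

theorem numCycles_sumCongr (f : Perm A) (g : Perm B) :
    numCycles (sumCongr f g) = f.numCycles + g.numCycles := by
  let F : Quotient (SameCycle.setoid f) ⊕ Quotient (SameCycle.setoid g) →
      Quotient (SameCycle.setoid (sumCongr f g)) :=
    Sum.elim (Quotient.map' (s₁ := SameCycle.setoid f) Sum.inl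
      fun _ _ h => sameCycle_sumCongr_inl.2 h)
      (Quotient.map' (s₁ := SameCycle.setoid g) Sum.inr fun _ _ h => sameCycle_sumCongr_inr.2 h)
  have hF : Function.Bijective F := by
    constructor
    · rintro (q | q) (q' | q') h <;> induction q using Quotient.inductionOn <;>
        induction q' using Quotient.inductionOn
      · exact congrArg _ (Quotient.sound (sameCycle_sumCongr_inl.1 (Quotient.exact h)))
      · exact absurd (Quotient.exact h) not_sameCycle_sumCongr
      · exact absurd (SameCycle.symm (Quotient.exact h)) not_sameCycle_sumCongr
      · exact congrArg _ (Quotient.sound (sameCycle_sumCongr_inr.1 (Quotient.exact h)))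
    · intro q
      induction q using Quotient.inductionOn with | h x => ?_
      rcases x with a | b
      · exact ⟨Sum.inl (Quotient.mk _ a), rfl⟩
      · exact ⟨Sum.inr (Quotient.mk _ b), rfl⟩
  rw [numCycles, ← Nat.card_eq_of_bijective F hF, Nat.card_sum, numCycles, numCycles]

end Equiv.Perm

namespace RootedMap

theorem Iso.isPlanarQuadrangulation {m m' : RootedMap} (e : Iso m m')
    (h : m.IsPlanarQuadrangulation) : m'.IsPlanarQuadrangulation := by
  rw [isPlanarQuadrangulation_iff] at h ⊢
  obtain ⟨h1, hne, h2⟩ := h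
  have hne' : Nonempty m'.Arc := hne.map e.onArc
  have hφ : m'.facePerm = e.onArc.permCongr m.facePerm := by
    ext b
    obtain ⟨a, rfl⟩ := e.onArc.surjective b
    simp [e.map_face]
  have hσ : m'.next = e.onArc.permCongr m.next := by
    ext b
    obtain ⟨a, rfl⟩ := e.onArc.surjective b
    simp [e.map_next]
  refine ⟨?_, hne', fun b => ?_⟩
  · rw [SurfaceMap.isPlanar_iff] at h1 ⊢
    rw [hφ, hσ, numCycles_permCongr, numCycles_permCongr, h1, Nat.card_congr e.onArc]
  · obtain ⟨a, rfl⟩ := e.onArc.surjective b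
    rw [hφ, ncard_cyc_permCongr, h2]

section Quadrangulation

variable (m : RootedMap) [Nonempty m.Arc]

/-- The quadrangulation of a map: its vertices are the vertices and the faces of the map, its edges
are the corners of the map. -/
def quadrangulation : RootedMap where
  toSurfaceMap := SurfaceMap.ofPerms (A := m.Arc ⊕ m.Arc) (Perm.sumCongr m.next m.facePerm⁻¹)
    (Equiv.sumComm _ _) (fun x => by rcases x with x | x <;> rfl)
    (fun x => by rcases x with x | x <;> simp) (by
      intro B h1 h2 h3
      have hr : ∀ a, Sum.inl a ∈ B → Sum.inl (m.rev a) ∈ B := fun a ha => by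
        have h4 : Sum.inr (m.next a) ∈ B := h2 _ (h1 _ ha)
        have h5 : Sum.inr (m.facePerm⁻¹ (m.next a)) ∈ B := h1 _ h4
        have h6 : m.facePerm⁻¹ (m.next a) = m.rev a := by
          rw [Perm.inv_eq_iff_eq, m.facePerm_apply, m.rev_rev]
        rw [h6] at h5
        exact h2 _ h5
      have hl : ∀ a, Sum.inl a ∈ B := m.mem_of_stable (B := {a | Sum.inl a ∈ B})
        (fun a ha => h1 _ ha) hr (by
          obtain ⟨a | a, ha⟩ := h3
          · exact ⟨a, ha⟩
          · exact ⟨a, h2 _ ha⟩)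
      rintro (a | a)
      · exact hl a
      · exact h2 _ (hl a))
  root := m.root.map Sum.inl
  root_isSome _ := by
    obtain ⟨r, hr⟩ := Option.isSome_iff_exists.1 (m.root_isSome ‹Nonempty m.Arc›)
    rw [hr]
    rfl

/-- Every face of the quadrangulation surrounds one edge of `m`: two steps along it amount to the
reversal of that edge, which has no fixed point and is an involution. -/
theorem ncard_cyc_facePerm_quadrangulation (x : m.quadrangulation.Arc) :
    (m.quadrangulation.facePerm.cyc x).ncard = 4 := by
  have hinv : ∀ a, m.next (m.facePerm⁻¹ (m.next a)) = m.next (m.rev a) := fun a =>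
    congrArg m.next (by rw [Perm.inv_eq_iff_eq, m.facePerm_apply, m.rev_rev])
  -- Turning at a vertex and then back around the face crosses one edge of `m`.
  have hinv' : ∀ a, m.facePerm⁻¹ (m.next a) = m.rev a := fun a => by
    rw [Perm.inv_eq_iff_eq, m.facePerm_apply, m.rev_rev]
  have h2 : (m.quadrangulation.facePerm ^ 2) x ≠ x := by
    rcases x with a | a
    · change (Sum.inl (m.next (m.facePerm⁻¹ a)) : m.Arc ⊕ m.Arc) ≠ Sum.inl a
      obtain ⟨a, rfl⟩ := m.next.surjective a
      rw [hinv']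
      exact fun h => m.rev_ne _ (m.next.injective (Sum.inl_injective h))
    · change (Sum.inr (m.facePerm⁻¹ (m.next a)) : m.Arc ⊕ m.Arc) ≠ Sum.inr a
      rw [hinv']
      exact fun h => m.rev_ne _ (Sum.inr_injective h)
  have h4 : (m.quadrangulation.facePerm ^ 4) x = x := by
    rcases x with a | a
    · change (Sum.inl (m.next (m.facePerm⁻¹ (m.next (m.facePerm⁻¹ a)))) : m.Arc ⊕ m.Arc) = Sum.inl a
      obtain ⟨a, rfl⟩ := m.next.surjective a
      rw [hinv', hinv', m.rev_rev]
    · change (Sum.inr (m.facePerm⁻¹ (m.next (m.facePerm⁻¹ (m.next a)))) : m.Arc ⊕ m.Arc) = Sum.inr a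
      rw [hinv', hinv', m.rev_rev]
  rw [Ne, pow_apply_eq_self_iff] at h2
  rw [pow_apply_eq_self_iff] at h4
  have := Nat.le_of_dvd (by norm_num) h4
  generalize (m.quadrangulation.facePerm.cyc x).ncard = k at *
  interval_cases k <;> simp_all

theorem card_arc_quadrangulation : Nat.card m.quadrangulation.Arc = 2 * Nat.card m.Arc := by
  rw [two_mul]
  exact Nat.card_sum

/-- The quadrangulation has as vertices the vertices and faces of `m`, one face for each edge of
`m`, and twice as many arcs, so the two Euler relations are the same. -/
theorem isPlanarQuadrangulation_quadrangulation_iff :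
    m.quadrangulation.IsPlanarQuadrangulation ↔ m.IsPlanar := by
  have hne : Nonempty m.quadrangulation.Arc := inferInstanceAs (Nonempty (m.Arc ⊕ m.Arc))
  have h1 := card_eq_mul_numCycles m.ncard_cyc_facePerm_quadrangulation
  have h2 : m.quadrangulation.next.numCycles = m.next.numCycles + m.facePerm.numCycles := by
    rw [← numCycles_inv m.facePerm]
    exact numCycles_sumCongr _ _
  rw [isPlanarQuadrangulation_iff, SurfaceMap.isPlanar_iff, SurfaceMap.isPlanar_iff, h2]
  rw [card_arc_quadrangulation] at h1 ⊢
  constructor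
  · rintro ⟨h, -⟩
    omega
  · exact fun h => ⟨by omega, hne, m.ncard_cyc_facePerm_quadrangulation⟩

variable {m} {m' : RootedMap} [Nonempty m'.Arc]

theorem Iso.nonempty_quadrangulation (e : Iso m m') :
    Nonempty (Iso m.quadrangulation m'.quadrangulation) := by
  have hne : Nonempty m.quadrangulation.Arc := inferInstanceAs (Nonempty (m.Arc ⊕ m.Arc))
  obtain ⟨i, -⟩ := exists_iso_of_arc (m := m.quadrangulation) (m' := m'.quadrangulation)
    (Equiv.sumCongr e.onArc e.onArc) (by rintro (a | a) <;> rfl) (by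
      rintro (a | a)
      · exact congrArg Sum.inl (e.map_next a)
      · refine congrArg Sum.inr ?_
        change m'.facePerm⁻¹ (e.onArc a) = e.onArc (m.facePerm⁻¹ a)
        rw [Perm.inv_eq_iff_eq, e.map_face, apply_inv_apply]) (by
      change (m.root.map Sum.inl).map (Equiv.sumCongr e.onArc e.onArc) = m'.root.map Sum.inl
      rw [← e.map_root, Option.map_map, Option.map_map]
      rfl)
  exact ⟨i⟩

/-- The arcs of `m` are the arcs of the quadrangulation that leave an original vertex, and its
permutations can be read off from those of the quadrangulation. -/
theorem nonempty_iso_of_quadrangulation (e : Iso m.quadrangulation m'.quadrangulation) :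
    Nonempty (Iso m m') := by
  let g : m.Arc ⊕ m.Arc ≃ m'.Arc ⊕ m'.Arc := e.onArc
  obtain ⟨r, hr⟩ := Option.isSome_iff_exists.1 (m.root_isSome inferInstance)
  obtain ⟨r', hr'⟩ := Option.isSome_iff_exists.1 (m'.root_isSome inferInstance)
  have hgr : g (Sum.inl r) = Sum.inl r' := by
    have h : (m.root.map Sum.inl).map g = m'.root.map Sum.inl := e.map_root
    rw [hr, hr'] at h
    exact Option.some_injective _ h
  have hrev : ∀ x, g x.swap = (g x).swap := fun x => (e.map_rev x).symm
  have hnext : ∀ x, g (Perm.sumCongr m.next m.facePerm⁻¹ x) =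
    Perm.sumCongr m'.next m'.facePerm⁻¹ (g x) := fun x => (e.map_next x).symm
  -- Rotation keeps the two classes of vertices, reversal exchanges them, and the roots both leave
  -- original vertices; by connectedness the classes correspond.
  have hside : ∀ x, (g x).isLeft = x.isLeft := by
    refine m.quadrangulation.mem_of_stable
      (B := {x : m.Arc ⊕ m.Arc | (g x).isLeft = x.isLeft}) ?_ ?_ ⟨Sum.inl r, by
        change (g (Sum.inl r)).isLeft = _
        rw [hgr]
        rfl⟩
    · intro x hx
      have h1 : ∀ {C : Type} (f f' : Perm C) (y : C ⊕ C),
          (Perm.sumCongr f f' y).isLeft = y.isLeft := by rintro C f f' (y | y) <;> rfl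
      exact (congrArg Sum.isLeft (hnext x)).trans ((h1 _ _ _).trans (hx.trans (h1 _ _ _).symm))
    · intro x hx
      have h1 : ∀ {C : Type} (y : C ⊕ C), y.swap.isLeft = !y.isLeft := by
        rintro C (y | y) <;> rfl
      exact (congrArg Sum.isLeft (hrev x)).trans
        ((h1 _).trans ((congrArg not hx).trans (h1 _).symm))
  have hleft : ∀ a, ∃ b, g (Sum.inl a) = Sum.inl b := fun a => Sum.isLeft_iff.1 (hside (Sum.inl a))
  choose f hf using hleft
  have hbij : Function.Bijective f := by
    constructor
    · intro a b h
      have : g (Sum.inl a) = g (Sum.inl b) := by rw [hf, hf, h]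
      exact Sum.inl_injective (g.injective this)
    · intro b
      obtain ⟨x, hx⟩ := g.surjective (Sum.inl b)
      obtain ⟨a, rfl⟩ := Sum.isLeft_iff.1 ((hside x).symm.trans (congrArg Sum.isLeft hx))
      exact ⟨a, Sum.inl_injective ((hf a).symm.trans hx)⟩
  have hf' : ∀ a, g (Sum.inr a) = Sum.inr (f a) := fun a =>
    (hrev (Sum.inl a)).trans (congrArg Sum.swap (hf a))
  have h1 : ∀ a, m'.next (f a) = f (m.next a) := fun a => by
    have := hnext (Sum.inl a)
    rw [hf] at this
    exact (Sum.inl_injective ((hf _).symm.trans this)).symm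
  have h2 : ∀ a, m'.facePerm⁻¹ (f a) = f (m.facePerm⁻¹ a) := fun a => by
    have := hnext (Sum.inr a)
    rw [hf'] at this
    exact (Sum.inr_injective ((hf' _).symm.trans this)).symm
  have hinv : ∀ (M : SurfaceMap) a, M.facePerm⁻¹ (M.next a) = M.rev a := fun M a => by
    rw [Perm.inv_eq_iff_eq, M.facePerm_apply, M.rev_rev]
  obtain ⟨i, -⟩ := exists_iso_of_arc (Equiv.ofBijective f hbij)
    (fun a => by
      change m'.rev (f a) = f (m.rev a)
      rw [← hinv, ← hinv, h1, h2]) h1 (by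
      rw [hr, hr']
      exact congrArg some (Sum.inl_injective ((hf r).symm.trans hgr)))
  exact ⟨i⟩

end Quadrangulation

/-- Planar quadrangulations are bipartite. -/
theorem exists_coloring {Q : RootedMap} (hQ : Q.IsPlanarQuadrangulation) (r : Q.Arc) :
    ∃ c : Q.Arc → ZMod 2, (∀ x, c (Q.next x) = c x) ∧ (∀ x, c (Q.rev x) = c x + 1) ∧ c r = 0 := by
  classical
  have := Fintype.ofFinite Q.Arc
  obtain ⟨hpl, hne, hfour⟩ := isPlanarQuadrangulation_iff.1 hQ
  obtain ⟨R, hR⟩ := exists_isOrientation (α := Q.revPerm) Q.rev_rev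
  have hcardR := hR.two_mul_card Q.rev_rev
  have h0 : (Finset.univ.filter fun x => Q.revPerm x = x) = ∅ :=
    Finset.filter_eq_empty_iff.2 fun x _ => Q.rev_ne x
  rw [h0, Finset.card_empty, add_zero] at hcardR
  have heuler := Q.isPlanar_iff.1 hpl
  rw [← Q.facePerm_mul_revPerm, Nat.card_eq_fintype_card] at heuler
  have hsq : ∀ x, (Q.facePerm ^ 2) ((Q.facePerm ^ 2) x) = x := fun x => by
    rw [← mul_apply, ← pow_add, pow_apply_eq_self_iff, hfour]
  have hsq' : ∀ x, (Q.facePerm ^ 2) x ≠ x := fun x => by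
    rw [Ne, pow_apply_eq_self_iff, hfour]
    norm_num
  have h2 : ∀ a b : ZMod 2, a - b = b + a := by decide
  have h3 : ∀ a : ZMod 2, a + a = 0 := by decide
  -- A colouring is a vertex function whose difference along every edge is `1`.
  obtain ⟨c, hc1, hc2⟩ := exists_edgeDiff_eq (K := ZMod 2) Q.rev_rev hR (Q.meetsStable r)
    (by rw [Finset.card_singleton]; omega) (fun _ => 1) (by
      intro f hf
      -- In characteristic two the pairing with `1` is the sum of the face function over all arcs.
      -- It vanishes since `facePerm ^ 2` matches the four arcs of each face in pairs with equal
      -- values.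
      obtain ⟨R', hR'⟩ := exists_isOrientation hsq
      have hff : ∀ x, f ((Q.facePerm ^ 2) x) = f x := fun x => (hf _).trans (hf x)
      have hs := hR.sum_add Q.rev_rev f
      have hs' := hR'.sum_add hsq f
      have hall : (Finset.univ.filter fun x => Q.revPerm x ≠ x) = Finset.univ :=
        Finset.filter_true_of_mem fun x _ => Q.rev_ne x
      rw [hall] at hs
      rw [Finset.filter_true_of_mem fun x _ => hsq' x, Finset.sum_eq_zero fun x _ => by
        rw [hff, h3]] at hs'
      rw [← hs', ← Finset.sum_coe_sort] at hs
      refine Eq.trans ?_ hs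
      refine Finset.sum_congr rfl fun x _ => ?_
      rw [mul_one]
      exact h2 _ _)
  have hrev : ∀ x, c (Q.rev x) = c x + 1 := by
    have h4 : ∀ a b : ZMod 2, a - b = 1 → a = b + 1 := by decide
    have h5 : ∀ a b : ZMod 2, a - b = 1 → b = a + 1 := by decide
    intro x
    rcases (hR.2 x).1 (Q.rev_ne x) with hx | hx
    · exact h4 _ _ (congrFun hc2 ⟨x, hx⟩)
    · have h6 : c (Q.rev (Q.rev x)) - c (Q.rev x) = 1 := congrFun hc2 ⟨_, hx⟩
      rw [Q.rev_rev] at h6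
      exact h5 _ _ h6
  refine ⟨fun x => c x - c r, fun x => ?_, fun x => ?_, sub_self _⟩
  · dsimp only
    rw [← Q.facePerm_mul_revPerm, hc1]
  · dsimp only
    rw [hrev, add_sub_right_comm]

/-- The map is recovered by drawing in each quadrilateral the diagonal that joins the two vertices
of the colour of the root vertex. Its arcs are represented by the arcs of `Q` that leave vertices of
this colour. -/
theorem exists_iso_quadrangulation {Q : RootedMap} (hQ : Q.IsPlanarQuadrangulation) :
    ∃ (m : RootedMap) (_ : Nonempty m.Arc), Nonempty (Iso m.quadrangulation Q) := by
  obtain ⟨-, hne, hfour⟩ := isPlanarQuadrangulation_iff.1 hQ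
  obtain ⟨r, hr⟩ := Option.isSome_iff_exists.1 (Q.root_isSome hne)
  obtain ⟨c, hc1, hc2, hc3⟩ := exists_coloring hQ r
  have h4 : ∀ x, Q.next (Q.rev (Q.next (Q.rev (Q.next (Q.rev (Q.next (Q.rev x))))))) = x :=
    fun x => by
      have : (Q.facePerm ^ 4) x = x := by rw [pow_apply_eq_self_iff, hfour]
      exact this
  have h2 : ∀ x, Q.next (Q.rev (Q.next (Q.rev x))) ≠ x := fun x => by
    have : (Q.facePerm ^ 2) x ≠ x := by
      rw [Ne, pow_apply_eq_self_iff, hfour]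
      norm_num
    exact this
  have hadd : ∀ a : ZMod 2, a + 1 + 1 = a := by decide
  have h01 : (0 : ZMod 2) + 1 ≠ 0 := by decide
  let A := {x // c x = 0}
  have : Finite A := inferInstanceAs (Finite {x // c x = 0})
  have : Nonempty A := ⟨⟨r, hc3⟩⟩
  let σ : Perm A := Q.next.subtypePerm fun x => by rw [hc1]
  -- The passage to the opposite corner of the quadrilateral, which reverses the diagonal.
  let α : Perm A := ((Q.revPerm * Q.next) ^ 2).subtypePerm fun x => by
    change c (Q.rev (Q.next (Q.rev (Q.next x)))) = 0 ↔ _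
    rw [hc2, hc1, hc2, hc1, hadd]
  have hα : ∀ x : A, (α x).1 = Q.rev (Q.next (Q.rev (Q.next x.1))) := fun _ => rfl
  have hα2 : ∀ x, α (α x) = x := fun x => by
    refine Subtype.ext ?_
    rw [hα, hα]
    have := h4 (Q.rev x)
    rw [Q.rev_rev] at this
    rw [this, Q.rev_rev]
  have hfix : ∀ x, α x ≠ x := fun x h => by
    refine h2 (Q.rev x) ?_
    rw [Q.rev_rev]
    exact (Q.rev_rev _).symm.trans (congrArg (fun y => Q.rev y.1) h)
  -- Rotation about a vertex of the other colour; it becomes the inverse of the face permutation.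
  let τ : A → A := fun x => ⟨Q.rev (Q.next (Q.rev x)), by rw [hc2, hc1, hc2, hadd, x.2]⟩
  let m : RootedMap :=
    { toSurfaceMap := SurfaceMap.ofPerms σ α hα2 hfix (by
        intro B h1 h2 h3 x
        have hτ : ∀ y ∈ B, τ y ∈ B := fun y hy => by
          obtain ⟨z, rfl⟩ := σ.surjective y
          exact h2 z (apply_mem_of_forall_mem h1 hy)
        obtain ⟨y, hy, hxy⟩ := Q.mem_of_stable (B := {x | ∃ y ∈ B, x = y.1 ∨ x = Q.rev y.1})
          (by
            rintro _ ⟨y, hy, rfl | rfl⟩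
            · exact ⟨σ y, h1 y hy, Or.inl rfl⟩
            · exact ⟨τ y, hτ y hy, Or.inr (Q.rev_rev _).symm⟩)
          (by
            rintro _ ⟨y, hy, rfl | rfl⟩
            · exact ⟨y, hy, Or.inr rfl⟩
            · exact ⟨y, hy, Or.inl (Q.rev_rev _)⟩)
          (h3.elim fun y hy => ⟨y.1, y, hy, Or.inl rfl⟩) x.1
        rcases hxy with h | h
        · rwa [Subtype.ext h]
        · have := hc2 y.1
          rw [← h, x.2, y.2] at this
          exact absurd this.symm h01)
      root := some ⟨r, hc3⟩
      root_isSome := fun _ => rfl }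
  have hm : Nonempty m.Arc := inferInstanceAs (Nonempty A)
  refine ⟨m, hm, ?_⟩
  have hτ : ∀ x : m.Arc, m.facePerm⁻¹ x = τ x := fun x => Perm.inv_eq_iff_eq.2 <| by
    refine Subtype.ext ?_
    change x.1 = Q.next (Q.rev (Q.next (Q.rev (Q.next (Q.rev (Q.next (Q.rev x.1)))))))
    rw [h4]
  let g : A ⊕ A → Q.Arc := Sum.elim Subtype.val fun x => Q.rev x.1
  have hneq : ∀ a b : A, a.1 ≠ Q.rev b.1 := fun a b h => by
    have := hc2 b.1
    rw [← h, a.2, b.2] at this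
    exact h01 this.symm
  have hg : Function.Bijective g := by
    constructor
    · rintro (a | a) (b | b) h
      · exact congrArg _ (Subtype.ext h)
      · exact absurd h (hneq a b)
      · exact absurd h.symm (hneq b a)
      · refine congrArg _ (Subtype.ext ?_)
        rw [← Q.rev_rev a.1, ← Q.rev_rev b.1]
        exact congrArg Q.rev h
    · intro y
      have h01' : ∀ a : ZMod 2, a = 0 ∨ a + 1 = 0 := by decide
      rcases h01' (c y) with h | h
      · exact ⟨Sum.inl ⟨y, h⟩, rfl⟩
      · exact ⟨Sum.inr ⟨Q.rev y, (hc2 y).trans h⟩, Q.rev_rev y⟩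
  have hne' : Nonempty m.quadrangulation.Arc := inferInstanceAs (Nonempty (A ⊕ A))
  obtain ⟨i, -⟩ := exists_iso_of_arc (m := m.quadrangulation) (m' := Q) (Equiv.ofBijective g hg)
    (by
      rintro (a | a)
      · rfl
      · exact Q.rev_rev _) (by
      rintro (a | a)
      · rfl
      · change Q.next (Q.rev a.1) = Q.rev (m.facePerm⁻¹ a).1
        rw [hτ]
        exact (Q.rev_rev _).symm) hr.symm
  exact ⟨i⟩

end RootedMap

/-- The case `n = 0` is left out because the construction needs corners given by arcs. -/
theorem numRootedPlanarMaps_eq {n : ℕ} (hn : n ≠ 0) :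
    numRootedPlanarMaps n = numRootedPlanarQuadrangulations n := by
  set S := RootedMap.isoSetoid.comap
    (Subtype.val : {m : RootedMap // m.IsPlanar ∧ m.numEdges = n} → RootedMap) with hS
  set S' := RootedMap.isoSetoid.comap
    (Subtype.val : {m : RootedMap // m.IsPlanarQuadrangulationOfSize n} → RootedMap) with hS'
  have hne : ∀ m : {m : RootedMap // m.IsPlanar ∧ m.numEdges = n}, Nonempty m.1.Arc := fun m =>
    RootedMap.nonempty_arc_of_numEdges (by rw [m.2.2]; exact hn)
  have hquad : ∀ (m : RootedMap) [Nonempty m.Arc],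
      m.quadrangulation.IsPlanarQuadrangulationOfSize n ↔ m.IsPlanar ∧ m.numEdges = n := by
    intro m _
    rw [RootedMap.isPlanarQuadrangulationOfSize_iff hn, RootedMap.isBoundaryMap_four_iff,
      m.isPlanarQuadrangulation_quadrangulation_iff, m.card_arc_quadrangulation,
      ← m.two_mul_numEdges, and_comm]
    refine and_congr_right fun _ => ?_
    omega
  let F : Quotient S → Quotient S' := fun q =>
    have := hne q.out
    Quotient.mk S' ⟨q.out.1.quadrangulation, (hquad _).2 q.out.2⟩
  refine Nat.card_eq_of_bijective F ⟨?_, ?_⟩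
  · intro q q' h
    have := hne q.out
    have := hne q'.out
    obtain ⟨e⟩ : Nonempty (RootedMap.Iso q.out.1.quadrangulation q'.out.1.quadrangulation) :=
      Quotient.exact h
    rw [← Quotient.out_eq q, ← Quotient.out_eq q']
    exact Quotient.sound (s := S) (RootedMap.nonempty_iso_of_quadrangulation e)
  · intro q
    induction q using Quotient.inductionOn with | h Q => ?_
    have hQ := (RootedMap.isPlanarQuadrangulationOfSize_iff hn).1 Q.2
    rw [RootedMap.isBoundaryMap_four_iff] at hQ
    obtain ⟨m, hm, ⟨e⟩⟩ := RootedMap.exists_iso_quadrangulation hQ.2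
    have hmq : m.quadrangulation.IsPlanarQuadrangulationOfSize n := by
      rw [RootedMap.isPlanarQuadrangulationOfSize_iff hn, RootedMap.isBoundaryMap_four_iff]
      exact ⟨(Nat.card_congr e.onArc).trans hQ.1, e.symm.isPlanarQuadrangulation hQ.2⟩
    refine ⟨Quotient.mk S ⟨m, (hquad m).1 hmq⟩, ?_⟩
    have := hne (Quotient.mk S ⟨m, (hquad m).1 hmq⟩).out
    obtain ⟨e'⟩ : Nonempty (RootedMap.Iso (Quotient.mk S ⟨m, (hquad m).1 hmq⟩).out.1 m) :=
      Quotient.exact (s := S) (Quotient.out_eq _)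
    obtain ⟨e''⟩ := e'.nonempty_quadrangulation
    exact Quotient.sound (s := S') ⟨e''.trans e⟩

/-! ### The enumeration theorem. -/

theorem mainTheorem3 :
    rootedPointedQuadrangulationSeries = 2 * rootedEmbeddedTreeSeries ∧
    (∀ S : PowerSeries ℚ,
      S = 1 + 3 * PowerSeries.X * S ^ 2 ↔ S = rootedEmbeddedTreeSeries) ∧
    (∀ n : ℕ,
      (numRootedPlanarQuadrangulations n : ℚ) =
        (numRootedPointedPlanarQuadrangulations n : ℚ) / ((n : ℚ) + 2) ∧
      (numRootedPlanarQuadrangulations n : ℚ) =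
        2 / ((n : ℚ) + 2) * (3 ^ n / ((n : ℚ) + 1)) * ((2 * n).choose n : ℚ) ∧
      (numRootedPlanarMaps n : ℚ) =
        2 / ((n : ℚ) + 2) * (3 ^ n / ((n : ℚ) + 1)) * ((2 * n).choose n : ℚ)) := by
  have hpos : ∀ n : ℕ, (n : ℚ) + 2 ≠ 0 := fun n => by positivity
  refine ⟨?_, ?_, fun n => ⟨?_, numRootedPlanarQuadrangulations_eq n, ?_⟩⟩
  · ext n
    rw [(map_ofNat (PowerSeries.C (R := ℚ)) 2).symm, PowerSeries.coeff_C_mul,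
      rootedEmbeddedTreeSeries, rootedPointedQuadrangulationSeries, PowerSeries.coeff_mk,
      PowerSeries.coeff_mk, numRootedPointedPlanarQuadrangulations_eq, numRootedEmbeddedTrees_eq]
    have h1 : ((n : ℚ) + 1) * (catalan n : ℚ) = ((2 * n).choose n : ℚ) := by
      rw [← Nat.centralBinom_eq_two_mul_choose]
      exact_mod_cast succ_mul_catalan_eq_centralBinom n
    have h2 : (n : ℚ) + 1 ≠ 0 := by positivity
    push_cast
    rw [numRootedPlanarQuadrangulations_eq, ← h1]
    field_simp [hpos n]
  · intro S
    rw [rootedEmbeddedTreeSeries_eq]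
    exact eq_one_add_iff_eq_tripleCatalanSeries S
  · rw [numRootedPointedPlanarQuadrangulations_eq]
    push_cast
    rw [mul_div_cancel_right₀ _ (hpos n)]
  · by_cases hn : n = 0
    · subst hn
      -- Only the vertex map has no edges, and the formula takes the value `1`.
      rw [numRootedPlanarMaps, RootedMap.card_planar_zero]
      norm_num
    · rw [numRootedPlanarMaps_eq hn, numRootedPlanarQuadrangulations_eq]
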